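/- **Setting.** Let $A\in\mathbb Z^{r\times n}$ and $b\in\mathbb Z^r$, and let $M=\begin{pmatrix}\mathrm{id}_n&0\\A&-b\end{pmatrix}$. For distinct row indices $i_1,\dots,i_r$ and distinct column indices $j_1,\dots,j_r\in\{1,\dots,n\}$, perform Gaussian column elimination on $M$ successively with the entries in positions $(n+i_1,j_1),\dots,(n+i_r,j_r)$ as pivots, and assume that all these pivots are nonzero. Put $J=\{j_1,\dots,j_r\}$ and let $M_r\langle J\rangle\in\mathbb Q^{n\times(n-r+1)}$ be the result with rows $n+1,\dots,n+r$ and the columns in $J$ removed. For a matrix $(w_1,\dots,w_m,v)$ with $n$ rows put $$K^{\bullet}(w_1,\dots,w_m,v)=v+\Big\{\sum_i k_iw_i: k_i\in\mathbb R_{\ge0}\Big\},\qquad [(w_1,\dots,w_m,v)]=\frac{y^{v}}{\prod_i(1-y^{w_i})},$$ the latter, which may involve fractional powers of the variables, being expanded as a fractional iterated Laurent series (a monomial is small if the first nonzero entry of its exponent vector is positive). The same notation $[\,\cdot\,]$ is used for matrices whose rows correspond to the variables $y_1,\dots,y_n,\lambda_1,\dots,\lambda_r$. Let $\mathcal Z_y$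 extract the terms all of whose exponents are integers. For a nonsingular integer matrix $W$ let $(W\circ F)(y)=F(y^{We_1},\dots,y^{We_n})$. Let $\sigma_S(y)=\sum_{\alpha\in S\cap\mathbb Z^n}y^\alpha$, viewed as a rational function: $\sigma_S=p/q$ if $q\ne0$ and $p$ are Laurent polynomials such that $q\cdot\sum_{\alpha\in S\cap\mathbb Z^n}y^\alpha=p$ as formal series. The *underlined constant term* in $\lambda$ of a rational function $E$ with respect to a denominator factor $1-u\lambda^a$ ($a>0$, $u$ a monomial free of $\lambda$) is $P(0)$, where $E=\frac{P(\lambda)}{1-u\lambda^a}+R(\lambda)$, $\deg_\lambda P<a$, and $R$ is a rational function whose denominator is coprime to $1-u\lambda^a$ (as polynomials in $\lambda$). A *signed term* is $s\,x^{\gamma_0}/\prod_{k=1}^m(1-x^{\gamma_k})$ with $s=\pm1$ and integer exponent vectors; it is *unimodular* if $\gamma_1,\dots,\gamma_m$ are linearly independent and generate the lattice of all integer points in the space that they span. A *DecDenu output* for the underlined constant term in $\lambda$ of a signed term with $m$ denominator factors, one of which is underlined, is a finite list of unimodular signed terms, each free of $\lambda$ and with $m-1$ denominator factors, whose sum is that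 underlined constant term. **Theorem 5.3.** Let $W\in\mathbb Z^{n\times n}$ be unimodular ($\det W=\pm1$) and let $K^v=K^{\bullet}(W M_r\langle J\rangle)$. 1. $\mathcal Z_y[M_r\langle J\rangle]$ is (the expansion of) a rational function of $y$, and $$\sigma_{K^v}(y)=W\circ\mathcal Z_y[M_r\langle J\rangle].$$ 2. Let $A_1$ be the submatrix of $A$ of the columns $j_1,\dots,j_r$ and $A_2$ the submatrix of the other columns. There is a Smith normal form $H=UA_1V$, with $U,V$ unimodular and $H=\mathrm{diag}(h_1,\dots,h_r)$, $h_k\ge0$, $h_k\mid h_{k+1}$. For every such $U,V,H$, let $\hat M=\begin{pmatrix}\mathrm{id}_n&0\\\hat A&-Ub\end{pmatrix}$, where $\hat A$ has $H$ in the columns $j_1,\dots,j_r$ and $UA_2$ in the other columns, and let $\mathrm{diag}(V,\mathrm{id}_{n-r})$ denote the $n\times n$ matrix that acts by $V$ on the coordinates $j_1,\dots,j_r$ and by the identity on the others. Let $E_0=[\hat M]$ and, for $k=1,\dots,r$, let $E_k$ be the underlined constant term of $E_{k-1}$ in $\lambda_k$ with respect to $1-\lambda_k^{h_k}y_{j_k}$.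 All these constant terms exist, $E_r$ is a rational function of $y$ alone, and $$\mathcal Z_y[M_r\langle J\rangle]=\mathrm{diag}(V,\mathrm{id}_{n-r})\circ E_r .$$ 3. The iterated constant term can be computed by iterating DecDenu: for every such $U,V,H$ there are finite lists $L_0,\dots,L_r$ of signed terms such that $L_0$ consists of the single term $[\hat M]$; for $k=1,\dots,r$ every term of $L_{k-1}$ has the denominator factor $1-\lambda_k^{h_k}y_{j_k}$, and $L_k$ arises from $L_{k-1}$ by replacing each term by a DecDenu output for its constant term in $\lambda_k$ with this factor underlined; and the terms of $L_k$ are free of $\lambda_1,\dots,\lambda_k$. For all such lists $L_0,\dots,L_r$, applying $W\,\mathrm{diag}(V,\mathrm{id}_{n-r})$ to the exponent vectors of the terms of $L_r$ gives a unimodular decomposition (a "nearly short sum") $$\sigma_{K^v}(y)=\sum_{i\in I}s_i\,\sigma_{K_i}(y)=\sum_{i\in I}s_i\,\frac{y^{\gamma_{i,0}}}{\prod_{k=1}^{n-r}(1-y^{\gamma_{i,k}})}$$ with $I$ finite, $s_i=\pm1$, integer vectors $\gamma_{i,k}$, and $K_i=K^{\bullet}(\gamma_{i,1},\dots,\gamma_{i,n-r},\gamma_{i,0})$,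 where $\gamma_{i,1},\dots,\gamma_{i,n-r}$ are linearly independent and generate the lattice of all integer points in the space that they span. (No bound on the number $|I|$ of terms is asserted.) -/

import Mathlib

noncomputable section

open Matrix

/-! ### Rational functions in a set of variables -/

/-- Laurent polynomials over `ℂ` in the variables indexed by `σ`; a monomial is an exponent
vector in `σ → ℤ`. -/
abbrev LaurentPoly (σ : Type) : Type := AddMonoidAlgebra ℂ (σ → ℤ)

/-- Rational functions over `ℂ` in the variables indexed by `σ`. -/
abbrev RatFun (σ : Type) [Finite σ] : Type := FractionRing (LaurentPoly σ)

/-- The monomial with exponent vector `γ`, as a rational function. -/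
def mono {σ : Type} [Finite σ] (γ : σ → ℤ) : RatFun σ :=
  algebraMap (LaurentPoly σ) (RatFun σ) (AddMonoidAlgebra.single γ 1)

lemma mapDomainRingHom_inj {σ τ : Type} (L : (σ → ℤ) →+ (τ → ℤ)) (hL : Function.Injective L) :
    Function.Injective (AddMonoidAlgebra.mapDomainRingHom ℂ L) := by
  intro a b h
  exact AddMonoidAlgebra.mapDomain_injective hL h

/-- The monomial substitution `y ^ γ ↦ y ^ (L γ)` for an injective additive map `L` of
exponent vectors, as a map of rational functions. -/
def monoSubst {σ τ : Type} [Finite σ] [Finite τ] (L : (σ → ℤ) →+ (τ → ℤ))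
    (hL : Function.Injective L) : RatFun σ →+* RatFun τ :=
  IsFractionRing.map (mapDomainRingHom_inj L hL)

/-- Multiplication by an integer matrix on exponent vectors. -/
def mulVecHom {n : ℕ} (W : Matrix (Fin n) (Fin n) ℤ) : (Fin n → ℤ) →+ (Fin n → ℤ) :=
  W.mulVecLin.toAddMonoidHom

lemma mulVecHom_injective {n : ℕ} (W : Matrix (Fin n) (Fin n) ℤ) (hW : W.det ≠ 0) :
    Function.Injective (mulVecHom W) :=
  Matrix.mulVec_injective_of_det_ne_zero hW

/-- The action `(W ∘ F)(y) = F (y ^ (W e₁), …, y ^ (W eₙ))` of a nonsingular integer matrix. -/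
def matAct {n : ℕ} (W : Matrix (Fin n) (Fin n) ℤ) (hW : W.det ≠ 0) :
    RatFun (Fin n) →+* RatFun (Fin n) :=
  monoSubst (mulVecHom W) (mulVecHom_injective W hW)

/-- Extension of exponent vectors by zero to the other variables. -/
def extendHom {σ τ : Type} (f : σ → τ) (hf : Function.Injective f) : (σ → ℤ) →+ (τ → ℤ) where
  toFun γ := Function.extend f γ 0
  map_zero' := by
    ext t
    by_cases h : ∃ s, f s = t
    · obtain ⟨s, rfl⟩ := h
      simp [hf.extend_apply]
    · simp [Function.extend_apply' _ _ _ h]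
  map_add' γ δ := by
    ext t
    by_cases h : ∃ s, f s = t
    · obtain ⟨s, rfl⟩ := h
      simp [hf.extend_apply]
    · simp [Function.extend_apply' _ _ _ h]

lemma extendHom_injective {σ τ : Type} (f : σ → τ) (hf : Function.Injective f) :
    Function.Injective (extendHom f hf) := by
  intro γ δ h
  ext s
  have := congrFun h (f s)
  simpa [extendHom, hf.extend_apply] using this

/-- A rational function in the variables `σ`, regarded as a rational function in the larger set
of variables `τ`. -/
def inclVars {σ τ : Type} [Finite σ] [Finite τ] (f : σ → τ) (hf : Function.Injective f) :
    RatFun σ →+* RatFun τ :=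
  monoSubst (extendHom f hf) (extendHom_injective f hf)

/-! ### Fractional series and the operator `𝒵` -/

/-- The field of series in fractional powers of `y₁, …, yₙ` whose supports are well-ordered for
the lexicographic order of the exponent vectors. It contains the field of iterated Laurent series
`ℂ((yₙ^(1/N)))⋯((y₁^(1/N)))` for every `N`: a monomial is small if the first nonzero entry of its
exponent vector is positive. -/
abbrev FracSeries (n : ℕ) : Type := HahnSeries (Lex (Fin n → ℚ)) ℂ

/-- The monomial `y ^ γ` with a rational exponent vector. -/
def fmono {n : ℕ} (γ : Fin n → ℚ) : FracSeries n := HahnSeries.single (toLex γ) 1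

/-- The integer exponent vectors among the rational ones. -/
def intExp {n : ℕ} (γ : Fin n → ℤ) : Lex (Fin n → ℚ) := toLex fun p => (γ p : ℚ)

/-- The operator `𝒵_y`: it keeps the terms all of whose exponents are integers. -/
def zOp {n : ℕ} (F : FracSeries n) : FracSeries n := by
  classical
  exact
    { coeff := fun κ => if κ ∈ Set.range (intExp (n := n)) then F.coeff κ else 0
      isPWO_support' := F.isPWO_support.mono (by
        intro κ hκ
        simp only [Function.mem_support, ne_eq, ite_eq_right_iff, Classical.not_imp] at hκ
        exact hκ.2) }

/-- The Laurent polynomials inside the field of fractional series. -/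
def laurentToSeries (n : ℕ) : LaurentPoly (Fin n) →+* FracSeries n :=
  ((AddMonoidAlgebra.lift ℂ (FracSeries n) (Fin n → ℤ))
    { toFun := fun γ => HahnSeries.single (intExp γ.toAdd) 1
      map_one' := by
        have h : intExp (0 : Fin n → ℤ) = 0 :=
          congrArg toLex (funext fun p => by simp)
        simp [h]
      map_mul' := fun γ δ => by
        have h : intExp (γ.toAdd + δ.toAdd) = intExp γ.toAdd + intExp δ.toAdd :=
          congrArg toLex (funext fun p => by simp; rfl)
        simp [h] } : LaurentPoly (Fin n) →ₐ[ℂ] FracSeries n)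

lemma intExp_injective (n : ℕ) : Function.Injective (intExp (n := n)) := by
  intro γ δ h
  ext p
  have := congrFun (toLex.injective h) p
  exact_mod_cast this

lemma laurentToSeries_coeff {n : ℕ} (q : LaurentPoly (Fin n)) (γ : Fin n → ℤ) :
    (laurentToSeries n q).coeff (intExp γ) = q.coeff γ := by
  classical
  induction q using AddMonoidAlgebra.induction_linear with
  | zero => simp
  | add p q hp hq => simp [hp, hq]
  | single α a =>
    simp only [laurentToSeries, RingHom.coe_coe, AddMonoidAlgebra.lift_single]
    simp [HahnSeries.coeff_single, (intExp_injective n).eq_iff, Finsupp.single_apply, eq_comm]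

lemma laurentToSeries_injective (n : ℕ) : Function.Injective (laurentToSeries n) := by
  intro p q h
  ext γ
  rw [← laurentToSeries_coeff, ← laurentToSeries_coeff, h]

/-- The series expansion of a rational function in `y₁, …, yₙ`. -/
def expandSeries (n : ℕ) : RatFun (Fin n) →+* FracSeries n :=
  IsFractionRing.lift (laurentToSeries_injective n)

/-! ### Shifted cones and lattice point generating functions -/

/-- The shifted cone `v + {∑ kᵢ wᵢ : kᵢ ≥ 0}` in `ℝⁿ`, where the `wᵢ` are the columns of the left
block of the matrix and the vertex `v` is its last column. -/
def shiftedCone {n : ℕ} {κ : Type} [Fintype κ] (B : Matrix (Fin n) (κ ⊕ Unit) ℚ) :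
    Set (Fin n → ℝ) :=
  {x | ∃ k : κ → ℝ, (∀ c, 0 ≤ k c) ∧
    ∀ p, x p = (B p (Sum.inr ()) : ℝ) + ∑ c, k c * (B p (Sum.inl c) : ℝ)}

open scoped Classical in
/-- The coefficient at `γ` of the formal series `σ_S(y) = ∑ y ^ α` over the lattice points `α`
of `S`. -/
def latticeCoeff {n : ℕ} (S : Set (Fin n → ℝ)) (γ : Fin n → ℤ) : ℂ :=
  if (fun p => (γ p : ℝ)) ∈ S then 1 else 0

/-- The rational function `f` is the lattice point generating function of `S`: there are Laurent
polynomials `p` and `q ≠ 0` with `q · ∑_{α ∈ S ∩ ℤⁿ} y ^ α = p` as formal series (in which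
exponents of both signs may occur), and `f = p / q`. Such an `f` is unique. -/
def IsGenFun {n : ℕ} (S : Set (Fin n → ℝ)) (f : RatFun (Fin n)) : Prop :=
  ∃ p q : LaurentPoly (Fin n), q ≠ 0 ∧
    (∀ γ, (∑ α ∈ q.coeff.support, q.coeff α * latticeCoeff S (γ - α)) = p.coeff γ) ∧
    f = algebraMap (LaurentPoly (Fin n)) (RatFun (Fin n)) p /
      algebraMap (LaurentPoly (Fin n)) (RatFun (Fin n)) q

/-! ### Matrix forms and column operations -/

/-- The matrix `[[id, 0], [A, -b]]`. Its rows are indexed by the variables `y₁, …, yₙ` and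
`λ₁, …, λᵣ`. -/
def startMatrix {n r : ℕ} (A : Matrix (Fin r) (Fin n) ℤ) (b : Fin r → ℤ) :
    Matrix (Fin n ⊕ Fin r) (Fin n ⊕ Unit) ℤ :=
  Matrix.fromBlocks 1 0 A (Matrix.of fun k _ => -b k)

/-- Gaussian column elimination `M ← (i, j)` with the entry in row `n + i` and column `j` as the
pivot: every column but the `j`-th gets a multiple of the `j`-th column added. -/
def pivotStep {n r : ℕ} (M : Matrix (Fin n ⊕ Fin r) (Fin n ⊕ Unit) ℚ) (ij : Fin r × Fin n) :
    Matrix (Fin n ⊕ Fin r) (Fin n ⊕ Unit) ℚ :=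
  Matrix.of fun p s =>
    if s = Sum.inl ij.2 then M p s
    else M p s - M (Sum.inr ij.1) s / M (Sum.inr ij.1) (Sum.inl ij.2) * M p (Sum.inl ij.2)

/-- Successive elimination `M ← (i₁, j₁) ← ⋯ ← (iₖ, jₖ)`. -/
def pivotAll {n r : ℕ} (M : Matrix (Fin n ⊕ Fin r) (Fin n ⊕ Unit) ℚ)
    (s : List (Fin r × Fin n)) : Matrix (Fin n ⊕ Fin r) (Fin n ⊕ Unit) ℚ :=
  s.foldl pivotStep M

/-- All pivots of the successive elimination are nonzero. -/
def PivotsNonzero {n r : ℕ} :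
    Matrix (Fin n ⊕ Fin r) (Fin n ⊕ Unit) ℚ → List (Fin r × Fin n) → Prop
  | _, [] => True
  | M, ij :: s => M (Sum.inr ij.1) (Sum.inl ij.2) ≠ 0 ∧ PivotsNonzero (pivotStep M ij) s

/-- The sequence of pivot positions `(i₁, j₁), …, (iᵣ, jᵣ)`. -/
def pivotList {n r : ℕ} (i : Equiv.Perm (Fin r)) (j : Fin r ↪ Fin n) : List (Fin r × Fin n) :=
  List.ofFn fun k => (i k, j k)

/-- The columns outside `J = {j₁, …, jᵣ}`. -/
abbrev CoCols {n r : ℕ} (j : Fin r ↪ Fin n) : Type := ((Set.range j)ᶜ : Set (Fin n))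

/-- The matrix `M_r⟨J⟩`: the result of the eliminations with the rows `n + 1, …, n + r` and the
columns in `J` removed. -/
def reducedMatrix {n r : ℕ} (A : Matrix (Fin r) (Fin n) ℤ) (b : Fin r → ℤ)
    (i : Equiv.Perm (Fin r)) (j : Fin r ↪ Fin n) : Matrix (Fin n) (CoCols j ⊕ Unit) ℚ :=
  (pivotAll ((startMatrix A b).map (Int.cast : ℤ → ℚ)) (pivotList i j)).submatrix Sum.inl
    (Sum.map Subtype.val id)

/-- The rational function `y ^ v / ∏ (1 - y ^ wᵢ)` with fractional powers attached to a matrix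
with columns `wᵢ` and last column `v`. -/
def eratSeries {n : ℕ} {κ : Type} [Fintype κ] (B : Matrix (Fin n) (κ ⊕ Unit) ℚ) : FracSeries n :=
  fmono (fun p => B p (Sum.inr ())) / ∏ c, (1 - fmono fun p => B p (Sum.inl c))

/-! ### Smith normal form -/

/-- `H = U A₁ V` with `U`, `V` unimodular and `H = diag(h₁, …, hᵣ)`, `hₖ ∣ hₖ₊₁`, `hₖ ≥ 0`. -/
def IsSmithForm {r : ℕ} (A₁ U V : Matrix (Fin r) (Fin r) ℤ) (h : Fin r → ℕ) : Prop :=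
  IsUnit U.det ∧ IsUnit V.det ∧ Matrix.diagonal (fun k => (h k : ℤ)) = U * A₁ * V ∧
    ∀ k l, k ≤ l → h k ∣ h l

open scoped Classical in
/-- The columns in `J` (in the order `j₁, …, jᵣ`) followed by the other columns. -/
def colEquiv {n r : ℕ} (j : Fin r ↪ Fin n) : Fin r ⊕ CoCols j ≃ Fin n :=
  ((Equiv.ofInjective j j.injective).sumCongr (Equiv.refl _)).trans
    (Equiv.Set.sumCompl (Set.range j))

/-- The matrix `diag(V, id)`, where `V` acts on the coordinates in `J`. -/
def diagExt {n r : ℕ} (j : Fin r ↪ Fin n) (V : Matrix (Fin r) (Fin r) ℤ) :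
    Matrix (Fin n) (Fin n) ℤ :=
  Matrix.reindex (colEquiv j) (colEquiv j) (Matrix.fromBlocks V 0 0 1)

open scoped Classical in
lemma diagExt_det {n r : ℕ} (j : Fin r ↪ Fin n) (V : Matrix (Fin r) (Fin r) ℤ) :
    (diagExt j V).det = V.det := by
  simp [diagExt]

/-- The matrix `M̂ = [[id, 0], [Â, -U b]]`, where `Â` has `diag(h₁, …, hᵣ)` in the columns in `J`
and `U A₂` in the other columns, `A₂` being the submatrix of `A` of these columns. -/
def smithMatrix {n r : ℕ} (A : Matrix (Fin r) (Fin n) ℤ) (b : Fin r → ℤ) (j : Fin r ↪ Fin n)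
    (U : Matrix (Fin r) (Fin r) ℤ) (h : Fin r → ℕ) :
    Matrix (Fin n ⊕ Fin r) (Fin n ⊕ Unit) ℤ :=
  startMatrix
    ((Matrix.fromCols (Matrix.diagonal fun k => (h k : ℤ))
      (U * A.submatrix id (Subtype.val : CoCols j → Fin n))).submatrix id (colEquiv j).symm)
    (U *ᵥ b)

/-! ### Underlined constant terms -/

/-- `c` is the underlined constant term in the variable `i` of the rational function `E` with
respect to the denominator factor `1 - x ^ μ`. Here `x ^ μ = u λ ^ a`, where `λ` is the variable
`i`, `a > 0`, and `u` is a monomial in the other variables. If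
`E = P(λ) / (1 - u λ ^ a) + N(λ) / D(λ)` where the coefficients do not involve `λ`, `deg P < a`,
and `D` is coprime to `1 - u λ ^ a`, then the underlined constant term is `P(0)`. -/
def IsUnderlinedCT {σ : Type} [Finite σ] (i : σ) (μ : σ → ℤ) (E c : RatFun σ) : Prop :=
  let incl : RatFun {s // s ≠ i} →+* RatFun σ := inclVars Subtype.val Subtype.val_injective
  let F : Polynomial (RatFun {s // s ≠ i}) :=
    1 - Polynomial.C (mono fun s => μ s.1) * Polynomial.X ^ (μ i).toNat
  let ev : Polynomial (RatFun {s // s ≠ i}) → RatFun σ := fun P =>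
    P.eval₂ incl (mono (by classical exact Pi.single i 1))
  0 < μ i ∧ ∃ P N D : Polynomial (RatFun {s // s ≠ i}),
    P.degree < ((μ i).toNat : WithBot ℕ) ∧ IsCoprime D F ∧
    E = ev P / ev F + ev N / ev D ∧ c = incl (P.coeff 0)

/-- The exponent vector of the monomial `λₖ ^ hₖ y_{jₖ}`. -/
def lamFactor {n r : ℕ} (j : Fin r ↪ Fin n) (h : Fin r → ℕ) (k : Fin r) : Fin n ⊕ Fin r → ℤ :=
  Sum.elim (Pi.single (j k) 1) (Pi.single k (h k : ℤ))

/-! ### Sums of simple rational functions -/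

/-- A term `s · x ^ γ₀ / ∏ (1 - x ^ γₖ)` with `s = ±1` and integer exponent vectors. -/
structure SignedTerm (σ : Type) where
  sgn : ℤˣ
  num : σ → ℤ
  den : List (σ → ℤ)

namespace SignedTerm

/-- The rational function `x ^ γ₀ / ∏ (1 - x ^ γₖ)` of a term, without its sign. -/
def frac {σ : Type} [Finite σ] (T : SignedTerm σ) : RatFun σ :=
  mono T.num / (T.den.map fun γ => 1 - mono γ).prod

/-- The rational function `s · x ^ γ₀ / ∏ (1 - x ^ γₖ)` of a term. -/
def toRat {σ : Type} [Finite σ] (T : SignedTerm σ) : RatFun σ :=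
  ((T.sgn : ℤ) : RatFun σ) * T.frac

/-- The sum of the rational functions of a list of terms. -/
def sumRat {σ : Type} [Finite σ] (D : List (SignedTerm σ)) : RatFun σ :=
  (D.map toRat).sum

/-- The variable `i` does not occur in the term. -/
def FreeOf {σ : Type} (i : σ) (T : SignedTerm σ) : Prop :=
  T.num i = 0 ∧ ∀ γ ∈ T.den, γ i = 0

/-- The term is unimodular: the `γₖ` are linearly independent and they generate the lattice of
all integer points of the space that they span. -/
def IsUnimodular {σ : Type} (T : SignedTerm σ) : Prop :=
  LinearIndependent ℤ T.den.get ∧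
    ∀ x : σ → ℤ, (∃ m : ℤ, m ≠ 0 ∧ m • x ∈ Submodule.span ℤ {γ | γ ∈ T.den}) →
      x ∈ Submodule.span ℤ {γ | γ ∈ T.den}

/-- The matrix `(γ₁, …, γₘ, γ₀)` of a term, which describes a shifted cone. -/
def coneMatrix {n : ℕ} (T : SignedTerm (Fin n)) :
    Matrix (Fin n) (Fin T.den.length ⊕ Unit) ℚ :=
  Matrix.of fun p => Sum.elim (fun c => (T.den.get c p : ℚ)) fun _ => (T.num p : ℚ)

/-- Apply a map to all exponent vectors of a term. -/
def mapExp {σ τ : Type} (φ : (σ → ℤ) → (τ → ℤ)) (T : SignedTerm σ) : SignedTerm τ :=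
  ⟨T.sgn, φ T.num, T.den.map φ⟩

/-- The rational function `[M]` of an integer matrix: the last column gives the numerator and the
other columns the denominator factors. -/
def ofMatrix {σ : Type} {m : ℕ} (M : Matrix σ (Fin m ⊕ Unit) ℤ) : SignedTerm σ :=
  ⟨1, fun s => M s (Sum.inr ()), List.ofFn fun c s => M s (Sum.inl c)⟩

end SignedTerm

/-- `D` is an admissible output of the algorithm `DecDenu` for the underlined constant term, in the
variable `i`, of the term `T` whose denominator factor `1 - x ^ μ` is underlined: `D` is a
signed sum of unimodular terms free of the variable `i`, with one denominator factor fewer than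
`T`, and its value is the underlined constant term. -/
def IsDecDenuOutput {σ : Type} [Finite σ] (i : σ) (μ : σ → ℤ) (T : SignedTerm σ)
    (D : List (SignedTerm σ)) : Prop :=
  μ ∈ T.den ∧ IsUnderlinedCT i μ T.toRat (SignedTerm.sumRat D) ∧
    ∀ T' ∈ D, T'.FreeOf i ∧ T'.den.length + 1 = T.den.length ∧ T'.IsUnimodular

/-- `L` is a run of the iterated `DecDenu` computation on the matrix `M`: it starts from the single
term `[M]`, and for `k = 1, …, r` in this order every term of the current sum is replaced by a
`DecDenu` output for its constant term in `λₖ` with `1 - λₖ ^ hₖ y_{jₖ}` underlined. After `k`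
steps the terms involve only the variables `y` and `λₖ₊₁, …, λᵣ`. -/
structure IsDecDenuRun {n r : ℕ} (j : Fin r ↪ Fin n) (h : Fin r → ℕ)
    (M : Matrix (Fin n ⊕ Fin r) (Fin n ⊕ Unit) ℤ)
    (L : Fin (r + 1) → List (SignedTerm (Fin n ⊕ Fin r))) : Prop where
  start : L 0 = [SignedTerm.ofMatrix M]
  step : ∀ k : Fin r, ∃ D : SignedTerm (Fin n ⊕ Fin r) → List (SignedTerm (Fin n ⊕ Fin r)),
    L k.succ = (L k.castSucc).flatMap D ∧
    ∀ T ∈ L k.castSucc, IsDecDenuOutput (Sum.inr k) (lamFactor j h k) T (D T)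
  free : ∀ k, ∀ T ∈ L k, ∀ l : Fin r, l.castSucc < k → T.FreeOf (Sum.inr l)

/-- `E` is the sequence of iterated underlined constant terms: `E 0 = [M]`, and `E k` is obtained
from `E (k - 1)` by the constant term in `λₖ` with `1 - λₖ ^ hₖ y_{jₖ}` underlined. -/
def IsIteratedCT {n r : ℕ} (j : Fin r ↪ Fin n) (h : Fin r → ℕ)
    (M : Matrix (Fin n ⊕ Fin r) (Fin n ⊕ Unit) ℤ)
    (E : Fin (r + 1) → RatFun (Fin n ⊕ Fin r)) : Prop :=
  E 0 = (SignedTerm.ofMatrix M).toRat ∧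
    ∀ k : Fin r, IsUnderlinedCT (Sum.inr k) (lamFactor j h k) (E k.castSucc) (E k.succ)

/-- `D` is a decomposition of the lattice point generating function of `S` as a finite signed sum
`∑ sᵢ σ_{Kᵢ}(y) = ∑ sᵢ y ^ γ_{i,0} / ∏ₖ (1 - y ^ γ_{i,k})`, `1 ≤ k ≤ d`, over shifted
unimodular cones `Kᵢ` of dimension `d` with integral vertices. -/
def IsUnimodularDecomposition {n : ℕ} (d : ℕ) (S : Set (Fin n → ℝ))
    (D : List (SignedTerm (Fin n))) : Prop :=
  IsGenFun S (SignedTerm.sumRat D) ∧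
    ∀ T ∈ D, T.den.length = d ∧ T.IsUnimodular ∧ IsGenFun (shiftedCone T.coneMatrix) T.frac

end

/-! All three parts rest on one explicit rational function. Let `w_c` (`c ∉ J`) and `v` be the
columns of `M_r⟨J⟩`, and let `N = |det A₁|`, which is nonzero because the pivots are. Every `N w_c`
is integral, and `1 / (1 - y^{w_c}) = (1 + y^{w_c} + ⋯ + y^{(N-1) w_c}) / (1 - y^{N w_c})`.
Expanding these numerators and discarding the monomials with a non-integral exponent leaves
`coneFun`: the integer points `v + ∑ k_c w_c` of the box `0 ≤ k_c < N`, divided by `∏ (1 - y^{N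
w_c})`. Since `𝒵` is linear over Laurent polynomials, its expansion is `𝒵[M_r⟨J⟩]`
(`expandSeries_coneFun`). It is also a generating function: the coordinate `c` of `v + ∑ k_d w_d` is
`k_c`, so lattice points of the cone have natural coefficients, and multiplication by `1 - y^{N
w_c}` cuts them off at `k_c < N` (`isGenFun_coneFun`). A unimodular `W` only transports this
(`matAct_coneFun`).

Constant terms are computed modulo `1 - x^μ`, in the ring of functions whose denominator is coprime
to it. There `x^μ ≡ 1`, so exponents may be shifted by multiples of `μ` (`isUnderlinedCT_shift`).
After the same expansion with `N`, applied to `M̂`, the `λ_k`-exponents of all denominators other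
than the underlined one are divisible by `h_k`. The constant term then keeps the numerators whose
`λ_k`-exponent is divisible by `h_k` and substitutes `λ_k = y_{j_k}^{-1/h_k}`
(`isUnderlinedCT_of_dvd`, `isIteratedCT_elimSum`). The divisibility conditions together say that the
resulting exponent is integral, so `E_r` is again a `coneFun` (`inclVars_coneFun`). Its columns
become those of `M_r⟨J⟩` under `diag(V, id)`, as both solve one linear system with invertible `A₁`
(`IsSmithForm.diagExt_mul_elimMatrix`).

DecDenu is Euclid's algorithm on the exponents of `λ` (`exists_isDecDenuOutput`). The other
denominators are reduced modulo the underlined one. If `λ` disappears from all of them, the constant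
term is read off. Otherwise the term can be made proper and zero at `λ = 0`; by partial fractions
its underlined constant terms then add up to zero, so the wanted one is minus the sum of those at
factors with a smaller exponent. Unimodularity is carried along as a system of dual functionals
(`HasDual`). Additivity and uniqueness of constant terms force every run to sum to `E_r`
(`IsDecDenuRun.sumRat_eq`). -/

noncomputable section

open Matrix

/-! ### Arithmetic of monomials and monomial substitutions. -/

section Monomials

variable {σ τ : Type} [Finite σ] [Finite τ]

lemma mono_zero : mono (0 : σ → ℤ) = 1 := by
  rw [mono, ← AddMonoidAlgebra.one_def, map_one]

lemma mono_add (γ δ : σ → ℤ) : mono (γ + δ) = mono γ * mono δ := by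
  rw [mono, mono, mono, ← map_mul, AddMonoidAlgebra.single_mul_single, one_mul]

lemma mono_injective : Function.Injective (mono : (σ → ℤ) → RatFun σ) := by
  intro γ δ h
  have := IsFractionRing.injective (LaurentPoly σ) (RatFun σ) h
  exact (AddMonoidAlgebra.single_left_inj one_ne_zero).1 this

lemma mono_ne_zero (γ : σ → ℤ) : mono γ ≠ 0 := by
  intro h
  have h1 : mono γ * mono (-γ) = 1 := by rw [← mono_add, add_neg_cancel, mono_zero]
  rw [h, zero_mul] at h1
  exact zero_ne_one h1

lemma mono_neg (γ : σ → ℤ) : mono (-γ) = (mono γ)⁻¹ := by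
  rw [← one_div, eq_div_iff (mono_ne_zero γ), ← mono_add, neg_add_cancel, mono_zero]

lemma mono_sub (γ δ : σ → ℤ) : mono (γ - δ) = mono γ / mono δ := by
  rw [sub_eq_add_neg, mono_add, mono_neg, div_eq_mul_inv]

lemma mono_nsmul (k : ℕ) (γ : σ → ℤ) : mono (k • γ) = mono γ ^ k := by
  induction k with
  | zero => simp [mono_zero]
  | succ k ih => rw [succ_nsmul, mono_add, ih, pow_succ]

lemma mono_sum {ι : Type*} (s : Finset ι) (γ : ι → σ → ℤ) :
    mono (∑ c ∈ s, γ c) = ∏ c ∈ s, mono (γ c) := by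
  classical
  induction s using Finset.induction_on with
  | empty => simp [mono_zero]
  | insert c s hc ih => rw [Finset.sum_insert hc, Finset.prod_insert hc, mono_add, ih]

lemma one_sub_mono_ne_zero {γ : σ → ℤ} (hγ : γ ≠ 0) : 1 - mono γ ≠ 0 := by
  intro h
  rw [sub_eq_zero, ← mono_zero] at h
  exact hγ (mono_injective h).symm

lemma monoSubst_algebraMap (L : (σ → ℤ) →+ (τ → ℤ)) (hL : Function.Injective L)
    (p : LaurentPoly σ) :
    monoSubst L hL (algebraMap (LaurentPoly σ) (RatFun σ) p) =
      algebraMap (LaurentPoly τ) (RatFun τ) (AddMonoidAlgebra.mapDomainRingHom ℂ L p) := by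
  rw [monoSubst, IsFractionRing.map, IsLocalization.map_eq]

lemma monoSubst_mono (L : (σ → ℤ) →+ (τ → ℤ)) (hL : Function.Injective L) (γ : σ → ℤ) :
    monoSubst L hL (mono γ) = mono (L γ) := by
  rw [mono, monoSubst_algebraMap, mono]
  simp

end Monomials

/-! ### Rational functions as quotients of polynomials in one variable `λ`. -/

section Elimination

variable {σ : Type}

/-- The exponent vector of the variable `i`. -/
def varExp (i : σ) : σ → ℤ := by classical exact Pi.single i 1

lemma varExp_self (i : σ) : varExp i i = 1 := by simp [varExp]

lemma varExp_ne {i s : σ} (h : s ≠ i) : varExp i s = 0 := by simp [varExp, h]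

lemma extendHom_apply_val (i : σ) (γ : {s // s ≠ i} → ℤ) (s : {s // s ≠ i}) :
    extendHom Subtype.val Subtype.val_injective γ s.1 = γ s := by
  simp [extendHom]

lemma extendHom_apply_self (i : σ) (γ : {s // s ≠ i} → ℤ) :
    extendHom (Subtype.val : {s // s ≠ i} → σ) Subtype.val_injective γ i = 0 := by
  simp [extendHom]

/-- The `i`-coordinate of an exponent separates the powers of `λ`, because the coefficients do not
involve `λ`. This reads the coefficients of a polynomial in `λ` off its value. -/
lemma coeff_mul_single_varExp (i : σ) (p : LaurentPoly {s // s ≠ i}) (k : ℕ) (m : ℕ)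
    (γ : {s // s ≠ i} → ℤ) :
    (AddMonoidAlgebra.mapDomainRingHom ℂ (extendHom Subtype.val Subtype.val_injective) p *
      (AddMonoidAlgebra.single (varExp i) 1) ^ k).coeff
        (extendHom Subtype.val Subtype.val_injective γ + m • varExp i) =
      if k = m then p.coeff γ else 0 := by
  have hinj := extendHom_injective (Subtype.val : {s // s ≠ i} → σ) Subtype.val_injective
  induction p using AddMonoidAlgebra.induction_linear with
  | zero => simp
  | add p q hp hq =>
    rw [map_add (AddMonoidAlgebra.mapDomainRingHom ℂ _), add_mul, AddMonoidAlgebra.coeff_add,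
      Finsupp.add_apply, hp, hq]
    split_ifs <;> simp
  | single α a =>
    rw [AddMonoidAlgebra.mapDomainRingHom_apply, AddMonoidAlgebra.mapDomain_single,
      AddMonoidAlgebra.single_pow, AddMonoidAlgebra.single_mul_single,
      AddMonoidAlgebra.coeff_single, AddMonoidAlgebra.coeff_single]
    classical
    rw [Finsupp.single_apply, Finsupp.single_apply]
    by_cases hkm : k = m
    · subst hkm
      simp [hinj.eq_iff]
    · rw [if_neg hkm, if_neg]
      intro h
      have := congrFun h i
      rw [Pi.add_apply, Pi.add_apply, extendHom_apply_self, extendHom_apply_self] at this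
      apply hkm
      exact_mod_cast (by simpa [varExp_self] using this)

variable [Finite σ]

/-- The inclusion of the rational functions that do not involve the variable `i`. -/
abbrev inclNe (i : σ) : RatFun {s // s ≠ i} →+* RatFun σ :=
  inclVars Subtype.val Subtype.val_injective

/-- Polynomials in the variable `i`, regarded as rational functions. -/
def evalVar (i : σ) : Polynomial (RatFun {s // s ≠ i}) →+* RatFun σ :=
  Polynomial.eval₂RingHom (inclNe i) (mono (varExp i))

@[simp] lemma evalVar_C (i : σ) (c : RatFun {s // s ≠ i}) :
    evalVar i (Polynomial.C c) = inclNe i c := by simp [evalVar]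

@[simp] lemma evalVar_X (i : σ) : evalVar i Polynomial.X = mono (varExp i) := by simp [evalVar]

lemma inclNe_mono (i : σ) (γ : σ → ℤ) (hγ : γ i = 0) :
    inclNe i (mono fun s => γ s.1) = mono γ := by
  rw [inclNe, inclVars, monoSubst_mono]
  congr 1
  ext s
  by_cases h : s = i
  · subst h
    rw [extendHom_apply_self, hγ]
  · exact extendHom_apply_val i _ ⟨s, h⟩

/-- The variable `λ` is transcendental over the rational functions in the other variables: clear the
denominators of the coefficients, then compare Laurent coefficients. -/
lemma evalVar_injective (i : σ) : Function.Injective (evalVar i) := by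
  rw [injective_iff_map_eq_zero]
  intro P hP
  obtain ⟨b, hb0, hb⟩ := IsLocalization.integerNormalization_spec
    (nonZeroDivisors (LaurentPoly {s // s ≠ i})) P
  set Q := IsLocalization.integerNormalization (nonZeroDivisors (LaurentPoly {s // s ≠ i})) P
  have hb' : Q.map (algebraMap (LaurentPoly {s // s ≠ i}) (RatFun {s // s ≠ i})) =
      Polynomial.C (algebraMap _ _ b) * P := by
    ext k
    rw [hb, Polynomial.coeff_smul, Polynomial.coeff_C_mul, Algebra.smul_def]
  have h0 : evalVar i (Q.map (algebraMap (LaurentPoly {s // s ≠ i}) (RatFun {s // s ≠ i}))) = 0 := by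
    rw [hb', map_mul, hP, mul_zero]
  have h1 : algebraMap (LaurentPoly σ) (RatFun σ)
      (Q.eval₂ (AddMonoidAlgebra.mapDomainRingHom ℂ (extendHom Subtype.val Subtype.val_injective))
        (AddMonoidAlgebra.single (varExp i) 1)) = 0 := by
    rw [← h0, evalVar, Polynomial.coe_eval₂RingHom, Polynomial.eval₂_map, Polynomial.hom_eval₂]
    congr 1
    refine RingHom.ext fun p => ?_
    exact (monoSubst_algebraMap _ (extendHom_injective _ Subtype.val_injective) p).symm
  have h2 := (map_eq_zero_iff _ (IsFractionRing.injective (LaurentPoly σ) (RatFun σ))).1 h1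
  have hQ : Q = 0 := by
    ext m γ
    have h3 := congrArg (fun p : LaurentPoly σ => p.coeff
      (extendHom Subtype.val Subtype.val_injective γ + m • varExp i)) h2
    simp only [Polynomial.eval₂_eq_sum_range, AddMonoidAlgebra.coeff_sum, Finsupp.finsetSum_apply,
      coeff_mul_single_varExp, AddMonoidAlgebra.coeff_zero, Finsupp.zero_apply,
      Finset.sum_ite_eq', Finset.mem_range] at h3
    split_ifs at h3 with h
    · simpa using h3
    · rw [Polynomial.coeff_eq_zero_of_natDegree_lt (by omega)]
      rfl
  rw [hQ, Polynomial.map_zero] at hb'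
  have := mul_eq_zero.1 hb'.symm
  rcases this with h | h
  · rw [Polynomial.C_eq_zero, map_eq_zero_iff _ (IsFractionRing.injective _ _)] at h
    exact absurd h (nonZeroDivisors.ne_zero hb0)
  · exact h

/-- The polynomial `u λ ^ a` in the variable `λ = i` for a monomial `x ^ γ = u λ ^ a`, `a ≥ 0`. -/
def monoPoly (i : σ) (γ : σ → ℤ) : Polynomial (RatFun {s // s ≠ i}) :=
  Polynomial.C (mono fun s => γ s.1) * Polynomial.X ^ (γ i).toNat

lemma evalVar_monoPoly (i : σ) (γ : σ → ℤ) (hγ : 0 ≤ γ i) :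
    evalVar i (monoPoly i γ) = mono γ := by
  have h1 : (fun s : {s // s ≠ i} => γ s.1) =
      fun s : {s // s ≠ i} => (γ - (γ i).toNat • varExp i) s.1 := by
    ext s
    simp [varExp_ne s.2]
  rw [monoPoly, map_mul, map_pow, evalVar_C, evalVar_X, h1, inclNe_mono, ← mono_nsmul,
    ← mono_add, sub_add_cancel]
  simp [varExp_self, hγ]

lemma degree_monoPoly (i : σ) (γ : σ → ℤ) : (monoPoly i γ).degree = (γ i).toNat := by
  rw [monoPoly, Polynomial.degree_C_mul_X_pow _ (mono_ne_zero _)]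

lemma degree_one_sub_monoPoly (i : σ) (γ : σ → ℤ) (hγ : 0 < γ i) :
    (1 - monoPoly i γ).degree = (γ i).toNat := by
  rw [Polynomial.degree_sub_eq_right_of_degree_lt, degree_monoPoly]
  rw [degree_monoPoly, Polynomial.degree_one]
  have : 0 < (γ i).toNat := by omega
  exact_mod_cast this

lemma evalVar_one_sub_monoPoly (i : σ) (γ : σ → ℤ) (hγ : 0 ≤ γ i) :
    evalVar i (1 - monoPoly i γ) = 1 - mono γ := by
  rw [map_sub, map_one, evalVar_monoPoly i γ hγ]

/-- For `x^μ = u λ^a` with `a > 0`, the Bézout relation is `u λ^(a-1) · λ + (1 - u λ^a) = 1`. -/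
lemma isCoprime_X_pow_one_sub_monoPoly (i : σ) (μ : σ → ℤ) (hμ : 0 < μ i) (k : ℕ) :
    IsCoprime (Polynomial.X ^ k) (1 - monoPoly i μ) := by
  apply IsCoprime.pow_left
  refine ⟨Polynomial.C (mono fun s => μ s.1) * Polynomial.X ^ ((μ i).toNat - 1), 1, ?_⟩
  rw [monoPoly]
  have : (μ i).toNat = (μ i).toNat - 1 + 1 := by omega
  conv_lhs => rw [this]
  simp only [Nat.add_sub_cancel]
  ring

/-- With `a = μ i` and `b = γ i`, the monomials `(x^γ)^a` and `(x^μ)^b` have the same power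
`λ^(ab)`. Their difference lies in the ideal of the two polynomials and equals `w λ^(ab)`, where `w
≠ 0` is free of `λ` because the exponents are not proportional. So the ideal contains `λ^(ab)`,
which is coprime to `1 - x^μ`. -/
lemma isCoprime_one_sub_monoPoly (i : σ) (γ μ : σ → ℤ) (hγ : 0 ≤ γ i) (hμ : 0 < μ i)
    (h : μ i • γ ≠ γ i • μ) : IsCoprime (1 - monoPoly i γ) (1 - monoPoly i μ) := by
  have key : ∀ (δ : σ → ℤ) (k : ℕ), monoPoly i δ ^ k =
      Polynomial.C (mono fun s => k * δ s.1) * Polynomial.X ^ ((δ i).toNat * k) := by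
    intro δ k
    rw [monoPoly, mul_pow, ← pow_mul, ← Polynomial.C_pow, ← mono_nsmul]
    congr 3
  set a := (μ i).toNat
  set b := (γ i).toNat
  have ha : (a : ℤ) = μ i := Int.toNat_of_nonneg hμ.le
  have hb : (b : ℤ) = γ i := Int.toNat_of_nonneg hγ
  obtain ⟨S, hS⟩ := one_sub_dvd_one_sub_pow (monoPoly i γ) a
  obtain ⟨R, hR⟩ := one_sub_dvd_one_sub_pow (monoPoly i μ) b
  set w : RatFun {s // s ≠ i} := (mono fun s => b * μ s.1) - mono fun s => a * γ s.1 with hw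
  have hw0 : w ≠ 0 := by
    intro h0
    have h1 := mono_injective (sub_eq_zero.1 h0)
    apply h
    ext s
    by_cases hs : s = i
    · subst hs; simp [mul_comm]
    · have := congrFun h1 ⟨s, hs⟩
      simp only [Pi.smul_apply, smul_eq_mul]
      rw [← ha, ← hb]
      exact this.symm
  obtain ⟨α, β, hαβ⟩ := isCoprime_X_pow_one_sub_monoPoly i μ hμ (a * b)
  have hkey : Polynomial.C w * Polynomial.X ^ (a * b) =
      (1 - monoPoly i γ) * S - (1 - monoPoly i μ) * R := by
    rw [← hS, ← hR, key, key, hw, Polynomial.C_sub]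
    simp only [a, b]
    rw [mul_comm (γ i).toNat]
    ring
  have hX : Polynomial.X ^ (a * b) =
      Polynomial.C w⁻¹ * ((1 - monoPoly i γ) * S - (1 - monoPoly i μ) * R) := by
    rw [← hkey, ← mul_assoc, ← Polynomial.C_mul, inv_mul_cancel₀ hw0, Polynomial.C_1, one_mul]
  refine ⟨α * Polynomial.C w⁻¹ * S, β - α * Polynomial.C w⁻¹ * R, ?_⟩
  rw [hX] at hαβ
  refine Eq.trans ?_ hαβ
  ring

end Elimination

/-! ### Regular functions at `1 - x^μ`, and the calculus of underlined constant terms. -/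

section ConstantTerm

variable {σ : Type} {i : σ} {μ : σ → ℤ}

lemma not_proportional_sub {γ : σ → ℤ} (h : μ i • γ ≠ γ i • μ) (k : ℤ) :
    μ i • (γ - k • μ) ≠ (γ - k • μ) i • μ := by
  intro h1
  apply h
  ext s
  have := congrFun h1 s
  simp only [Pi.smul_apply, Pi.sub_apply, smul_eq_mul] at this ⊢
  linear_combination this

lemma ne_zero_of_not_proportional {γ : σ → ℤ} (h : μ i • γ ≠ γ i • μ) : γ ≠ 0 := by
  rintro rfl
  simp at h

variable [Finite σ]

/-- The rational functions whose denominator, as a polynomial in the variable `i`, is coprime to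
`1 - x ^ μ`. -/
def IsReg (i : σ) (μ : σ → ℤ) (G : RatFun σ) : Prop :=
  ∃ N D : Polynomial (RatFun {s // s ≠ i}),
    IsCoprime D (1 - monoPoly i μ) ∧ G = evalVar i N / evalVar i D

lemma ne_zero_of_isCoprime_one_sub (hμ : 0 < μ i) {D : Polynomial (RatFun {s // s ≠ i})}
    (h : IsCoprime D (1 - monoPoly i μ)) : D ≠ 0 := by
  rintro rfl
  rw [isCoprime_zero_left] at h
  have h1 := Polynomial.degree_eq_zero_of_isUnit h
  rw [degree_one_sub_monoPoly i μ hμ] at h1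
  have : (μ i).toNat = 0 := by exact_mod_cast h1
  omega

lemma evalVar_ne_zero {D : Polynomial (RatFun {s // s ≠ i})} (h : D ≠ 0) : evalVar i D ≠ 0 :=
  fun h0 => h ((map_eq_zero_iff _ (evalVar_injective i)).1 h0)

lemma isReg_evalVar (N : Polynomial (RatFun {s // s ≠ i})) : IsReg i μ (evalVar i N) :=
  ⟨N, 1, isCoprime_one_left, by simp⟩

lemma isReg_incl (c : RatFun {s // s ≠ i}) : IsReg i μ (inclNe i c) := by
  rw [← evalVar_C]
  exact isReg_evalVar _

lemma isReg_zero : IsReg i μ 0 := by simpa using isReg_evalVar (i := i) (μ := μ) 0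

lemma isReg_one : IsReg i μ 1 := by simpa using isReg_evalVar (i := i) (μ := μ) 1

lemma IsReg.mul {G H : RatFun σ} (hG : IsReg i μ G) (hH : IsReg i μ H) : IsReg i μ (G * H) := by
  obtain ⟨N, D, hD, rfl⟩ := hG
  obtain ⟨N', D', hD', rfl⟩ := hH
  exact ⟨N * N', D * D', hD.mul_left hD', by rw [map_mul, map_mul, div_mul_div_comm]⟩

lemma IsReg.neg {G : RatFun σ} (hG : IsReg i μ G) : IsReg i μ (-G) := by
  obtain ⟨N, D, hD, rfl⟩ := hG
  exact ⟨-N, D, hD, by rw [map_neg, ← neg_div]⟩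

lemma IsReg.add (hμ : 0 < μ i) {G H : RatFun σ} (hG : IsReg i μ G) (hH : IsReg i μ H) :
    IsReg i μ (G + H) := by
  obtain ⟨N, D, hD, rfl⟩ := hG
  obtain ⟨N', D', hD', rfl⟩ := hH
  refine ⟨N * D' + D * N', D * D', hD.mul_left hD', ?_⟩
  rw [div_add_div _ _ (evalVar_ne_zero (ne_zero_of_isCoprime_one_sub hμ hD))
    (evalVar_ne_zero (ne_zero_of_isCoprime_one_sub hμ hD'))]
  simp

lemma IsReg.sub (hμ : 0 < μ i) {G H : RatFun σ} (hG : IsReg i μ G) (hH : IsReg i μ H) :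
    IsReg i μ (G - H) := by
  rw [sub_eq_add_neg]
  exact hG.add hμ hH.neg

lemma isReg_sum (hμ : 0 < μ i) {ι : Type*} (s : Finset ι) (G : ι → RatFun σ)
    (h : ∀ c ∈ s, IsReg i μ (G c)) : IsReg i μ (∑ c ∈ s, G c) := by
  classical
  induction s using Finset.induction_on with
  | empty => simpa using isReg_zero
  | insert c s hc ih =>
    rw [Finset.sum_insert hc]
    exact (h c (Finset.mem_insert_self c s)).add hμ
      (ih fun d hd => h d (Finset.mem_insert_of_mem hd))

/-- Negative powers of `λ` are allowed because `λ` is coprime to `1 - x^μ`. -/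
lemma isReg_mono (hμ : 0 < μ i) (γ : σ → ℤ) : IsReg i μ (mono γ) := by
  by_cases hγ : 0 ≤ γ i
  · rw [← evalVar_monoPoly i γ hγ]
    exact isReg_evalVar _
  · have h1 : mono γ = mono (γ + (-γ i).toNat • varExp i) /
        evalVar i (Polynomial.X ^ (-γ i).toNat) := by
      rw [map_pow, evalVar_X, ← mono_nsmul, ← mono_sub, add_sub_cancel_right]
    refine ⟨monoPoly i (γ + (-γ i).toNat • varExp i), Polynomial.X ^ (-γ i).toNat,
      isCoprime_X_pow_one_sub_monoPoly i μ hμ _, ?_⟩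
    rw [evalVar_monoPoly, ← h1]
    have : ((-γ i).toNat : ℤ) = -γ i := Int.toNat_of_nonneg (by omega)
    simp [varExp_self, this]

lemma isReg_inv_one_sub_mono (hμ : 0 < μ i) (γ : σ → ℤ) (h : μ i • γ ≠ γ i • μ) :
    IsReg i μ (1 - mono γ)⁻¹ := by
  have key : ∀ γ : σ → ℤ, 0 ≤ γ i → μ i • γ ≠ γ i • μ → IsReg i μ (1 - mono γ)⁻¹ := by
    intro γ hγ h
    refine ⟨1, 1 - monoPoly i γ, isCoprime_one_sub_monoPoly i γ μ hγ hμ h, ?_⟩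
    rw [evalVar_one_sub_monoPoly i γ hγ, map_one, one_div]
  by_cases hγ : 0 ≤ γ i
  · exact key γ hγ h
  · have hγ0 : γ ≠ 0 := by rintro rfl; simp at hγ
    -- A negative power of `λ` is removed by `1 / (1 - x^γ) = -x^{-γ} / (1 - x^{-γ})`.
    have h1 := (isReg_mono hμ (-γ)).neg.mul (key (-γ) (by simp; omega)
      (fun h2 => h (by simpa using h2)))
    convert h1 using 1
    have h2 := one_sub_mono_ne_zero hγ0
    have h3 := one_sub_mono_ne_zero (neg_ne_zero.2 hγ0)
    have h4 := mono_ne_zero γ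
    rw [mono_neg] at h3 ⊢
    rw [neg_mul, ← mul_inv, mul_sub, mul_one, mul_inv_cancel₀ h4, ← inv_neg, neg_sub]

/-- Congruence of regular rational functions modulo `1 - x ^ μ`. -/
def RegCongr (i : σ) (μ : σ → ℤ) (G H : RatFun σ) : Prop :=
  IsReg i μ G ∧ IsReg i μ H ∧ IsReg i μ ((G - H) / (1 - mono μ))

lemma RegCongr.refl {G : RatFun σ} (h : IsReg i μ G) : RegCongr i μ G G :=
  ⟨h, h, by simpa using isReg_zero⟩

lemma RegCongr.mul (hμ : 0 < μ i) {G H G' H' : RatFun σ} (h : RegCongr i μ G H)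
    (h' : RegCongr i μ G' H') : RegCongr i μ (G * G') (H * H') := by
  refine ⟨h.1.mul h'.1, h.2.1.mul h'.2.1, ?_⟩
  have : (G * G' - H * H') / (1 - mono μ) =
      (G - H) / (1 - mono μ) * G' + H * ((G' - H') / (1 - mono μ)) := by ring
  rw [this]
  exact (h.2.2.mul h'.1).add hμ (h.2.1.mul h'.2.2)

lemma regCongr_list_prod (hμ : 0 < μ i) {ι : Type*} (l : List ι) (G H : ι → RatFun σ)
    (h : ∀ c ∈ l, RegCongr i μ (G c) (H c)) :
    RegCongr i μ (l.map G).prod (l.map H).prod := by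
  induction l with
  | nil => simpa using RegCongr.refl isReg_one
  | cons c l ih =>
    rw [List.map_cons, List.map_cons, List.prod_cons, List.prod_cons]
    exact (h c List.mem_cons_self).mul hμ (ih fun d hd => h d (List.mem_cons_of_mem c hd))

/-- For `k ≥ 0` this is a finite geometric sum; `1 - x^{-mμ} = -x^{-mμ} (1 - x^{mμ})` handles
negative `k`. -/
lemma isReg_one_sub_zsmul_div (hμ : 0 < μ i) (k : ℤ) :
    IsReg i μ ((1 - mono (k • μ)) / (1 - mono μ)) := by
  have hμ0 : μ ≠ 0 := by rintro rfl; simp at hμ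
  have key : ∀ k : ℕ, IsReg i μ ((1 - mono (k • μ)) / (1 - mono μ)) := by
    intro k
    have h1 : (1 - mono (k • μ)) / (1 - mono μ) = ∑ c ∈ Finset.range k, mono (c • μ) := by
      rw [div_eq_iff (one_sub_mono_ne_zero hμ0)]
      simp only [mono_nsmul]
      rw [geom_sum_mul_neg]
    rw [h1]
    exact isReg_sum hμ _ _ fun c _ => isReg_mono hμ _
  obtain ⟨m, rfl | rfl⟩ := k.eq_nat_or_neg
  · simpa using key m
  · have h1 : (1 - mono (-(m : ℤ) • μ)) / (1 - mono μ) =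
        -(mono (-(m • μ)) * ((1 - mono (m • μ)) / (1 - mono μ))) := by
      rw [neg_smul, natCast_zsmul, mono_neg]
      have := mono_ne_zero (m • μ)
      field_simp
      ring
    rw [h1]
    exact ((isReg_mono hμ _).mul (key m)).neg

/-- Modulo `1 - x^μ` the monomial `x^μ` is `1`, so only the class of an exponent modulo `μ` matters.
All later exponent reductions rest on this. -/
lemma regCongr_mono (hμ : 0 < μ i) (γ : σ → ℤ) (k : ℤ) :
    RegCongr i μ (mono γ) (mono (γ - k • μ)) := by
  refine ⟨isReg_mono hμ _, isReg_mono hμ _, ?_⟩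
  have : (mono γ - mono (γ - k • μ)) / (1 - mono μ) =
      -(mono (γ - k • μ) * ((1 - mono (k • μ)) / (1 - mono μ))) := by
    rw [mono_sub γ]
    have := mono_ne_zero (k • μ)
    field_simp
    ring
  rw [this]
  exact ((isReg_mono hμ _).mul (isReg_one_sub_zsmul_div hμ k)).neg

lemma regCongr_inv_one_sub_mono (hμ : 0 < μ i) (γ : σ → ℤ) (h : μ i • γ ≠ γ i • μ) (k : ℤ) :
    RegCongr i μ (1 - mono γ)⁻¹ (1 - mono (γ - k • μ))⁻¹ := by
  have hγ := isReg_inv_one_sub_mono hμ γ h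
  have hγ' := isReg_inv_one_sub_mono hμ _ (not_proportional_sub h k)
  refine ⟨hγ, hγ', ?_⟩
  have h2 := one_sub_mono_ne_zero (ne_zero_of_not_proportional h)
  have h3 := one_sub_mono_ne_zero (ne_zero_of_not_proportional (not_proportional_sub h k))
  have : ((1 - mono γ)⁻¹ - (1 - mono (γ - k • μ))⁻¹) / (1 - mono μ) =
      (mono γ - mono (γ - k • μ)) / (1 - mono μ) *
        ((1 - mono γ)⁻¹ * (1 - mono (γ - k • μ))⁻¹) := by
    rw [inv_sub_inv h2 h3]
    field_simp
    ring
  rw [this]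
  exact (regCongr_mono hμ γ k).2.2.mul (hγ.mul hγ')

lemma isUnderlinedCT_iff {E c : RatFun σ} : IsUnderlinedCT i μ E c ↔ 0 < μ i ∧
    ∃ P : Polynomial (RatFun {s // s ≠ i}), P.degree < ((μ i).toNat : WithBot ℕ) ∧
      IsReg i μ (E - evalVar i P / (1 - mono μ)) ∧ c = inclNe i (P.coeff 0) := by
  constructor
  · rintro ⟨hμ, P, N, D, hP, hD, hE, hc⟩
    refine ⟨hμ, P, hP, ⟨N, D, hD, ?_⟩, hc⟩
    rw [hE, ← evalVar_one_sub_monoPoly i μ hμ.le]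
    exact add_sub_cancel_left _ _
  · rintro ⟨hμ, P, hP, ⟨N, D, hD, hE⟩, hc⟩
    refine ⟨hμ, P, N, D, hP, hD, ?_, hc⟩
    rw [← evalVar_one_sub_monoPoly i μ hμ.le, sub_eq_iff_eq_add'] at hE
    exact hE

/-- A regular function changes only the remainder `R`, never the part `P`. -/
lemma IsUnderlinedCT.congr {E E' c : RatFun σ} (h : IsUnderlinedCT i μ E c)
    (h' : IsReg i μ (E' - E)) : IsUnderlinedCT i μ E' c := by
  rw [isUnderlinedCT_iff] at h ⊢
  obtain ⟨hμ, P, hP, hE, hc⟩ := h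
  refine ⟨hμ, P, hP, ?_, hc⟩
  have := h'.add hμ hE
  rwa [sub_add_sub_cancel] at this

lemma IsUnderlinedCT.add {E E' c c' : RatFun σ} (h : IsUnderlinedCT i μ E c)
    (h' : IsUnderlinedCT i μ E' c') : IsUnderlinedCT i μ (E + E') (c + c') := by
  rw [isUnderlinedCT_iff] at h h' ⊢
  obtain ⟨hμ, P, hP, hE, hc⟩ := h
  obtain ⟨-, P', hP', hE', hc'⟩ := h'
  refine ⟨hμ, P + P', (Polynomial.degree_add_le _ _).trans_lt (max_lt hP hP'), ?_, ?_⟩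
  · convert hE.add hμ hE' using 1
    rw [map_add]
    ring
  · rw [hc, hc', Polynomial.coeff_add, map_add]

lemma isUnderlinedCT_of_isReg (hμ : 0 < μ i) {E : RatFun σ} (h : IsReg i μ E) :
    IsUnderlinedCT i μ E 0 := by
  rw [isUnderlinedCT_iff]
  exact ⟨hμ, 0, by rw [Polynomial.degree_zero]; exact WithBot.bot_lt_coe _, by simpa using h,
    by simp⟩

lemma isUnderlinedCT_list_sum (hμ : 0 < μ i) {ι : Type*} (l : List ι) (E c : ι → RatFun σ)
    (h : ∀ t ∈ l, IsUnderlinedCT i μ (E t) (c t)) :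
    IsUnderlinedCT i μ (l.map E).sum (l.map c).sum := by
  induction l with
  | nil => simpa using isUnderlinedCT_of_isReg hμ isReg_zero
  | cons t l ih =>
    simp only [List.map_cons, List.sum_cons]
    exact (h t List.mem_cons_self).add (ih fun d hd => h d (List.mem_cons_of_mem t hd))

lemma isUnderlinedCT_sum (hμ : 0 < μ i) {ι : Type*} (s : Finset ι) (E c : ι → RatFun σ)
    (h : ∀ t ∈ s, IsUnderlinedCT i μ (E t) (c t)) :
    IsUnderlinedCT i μ (∑ t ∈ s, E t) (∑ t ∈ s, c t) := by
  have := isUnderlinedCT_list_sum hμ s.toList E c fun t ht => h t (Finset.mem_toList.1 ht)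
  rwa [Finset.sum_map_toList, Finset.sum_map_toList] at this

/-- The difference of two candidates for `P`, divided by `1 - x^μ`, is regular. By coprimality `1 -
x^μ` divides that difference, whose degree is too small unless it is zero. -/
lemma IsUnderlinedCT.unique {E c c' : RatFun σ} (h : IsUnderlinedCT i μ E c)
    (h' : IsUnderlinedCT i μ E c') : c = c' := by
  rw [isUnderlinedCT_iff] at h h'
  obtain ⟨hμ, P, hP, hE, rfl⟩ := h
  obtain ⟨-, P', hP', hE', rfl⟩ := h'
  obtain ⟨N, D, hD, hND⟩ := hE'.sub hμ hE
  have hF : (1 - monoPoly i μ) ≠ 0 := by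
    intro h0
    have := degree_one_sub_monoPoly i μ hμ
    rw [h0, Polynomial.degree_zero] at this
    exact absurd this (by simp)
  have h1 : (P - P') * D = N * (1 - monoPoly i μ) := by
    apply evalVar_injective i
    have hF' := evalVar_ne_zero hF
    have hD' := evalVar_ne_zero (ne_zero_of_isCoprime_one_sub hμ hD)
    rw [evalVar_one_sub_monoPoly i μ hμ.le] at hF'
    simp only [map_mul, map_sub, evalVar_monoPoly i μ hμ.le, map_one]
    field_simp at hND
    linear_combination hND
  have h2 : (1 - monoPoly i μ) ∣ P - P' := hD.symm.dvd_of_dvd_mul_right ⟨N, by rw [h1, mul_comm]⟩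
  have h3 : P - P' = 0 := by
    apply Polynomial.eq_zero_of_dvd_of_degree_lt h2
    rw [degree_one_sub_monoPoly i μ hμ]
    exact (Polynomial.degree_sub_le _ _).trans_lt (max_lt hP hP')
  rw [sub_eq_zero.1 h3]

lemma isUnderlinedCT_div_one_sub (G : RatFun {s // s ≠ i}) (δ : σ → ℤ) (h0 : 0 ≤ δ i)
    (h1 : δ i < μ i) :
    IsUnderlinedCT i μ (inclNe i G * mono δ / (1 - mono μ))
      (if δ i = 0 then inclNe i G * mono δ else 0) := by
  rw [isUnderlinedCT_iff]
  refine ⟨h0.trans_lt h1, Polynomial.C G * monoPoly i δ, ?_, ?_, ?_⟩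
  · rw [monoPoly, ← mul_assoc, ← Polynomial.C_mul]
    refine (Polynomial.degree_C_mul_X_pow_le _ _).trans_lt ?_
    have : (δ i).toNat < (μ i).toNat := by omega
    exact_mod_cast this
  · rw [map_mul, evalVar_C, evalVar_monoPoly i δ h0, sub_self]
    exact isReg_zero
  · rw [monoPoly, ← mul_assoc, ← Polynomial.C_mul, Polynomial.coeff_C_mul_X_pow]
    by_cases h : δ i = 0
    · simp [h, inclNe_mono i δ h]
    · have : ¬ 0 = (δ i).toNat := by omega
      simp [h, this]

/-- The factors are made monic, the decomposition with a polynomial part is taken, and the scalars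
are put back. The error is then a multiple of the whole product but of smaller degree, so the
polynomial part contributes nothing. -/
lemma exists_partialFractions {K ι : Type*} [Field K] [DecidableEq ι] {s : Finset ι}
    {f : Polynomial K} {g : ι → Polynomial K} (hg : ∀ c ∈ s, g c ≠ 0)
    (hgg : (s : Set ι).Pairwise fun c d => IsCoprime (g c) (g d))
    (hf : f.degree < (∏ c ∈ s, g c).degree) :
    ∃ r : ι → Polynomial K, (∀ c ∈ s, (r c).degree < (g c).degree) ∧
      f = ∑ c ∈ s, r c * ∏ d ∈ s.erase c, g d := by
  have hu : ∀ c ∈ s, IsUnit (Polynomial.C (g c).leadingCoeff⁻¹) := fun c hc =>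
    Polynomial.isUnit_C.2 (IsUnit.mk0 _ (inv_ne_zero (Polynomial.leadingCoeff_ne_zero.2 (hg c hc))))
  obtain ⟨q, r, hr, hq⟩ := Polynomial.eq_quo_mul_prod_add_sum_rem_mul_prod (s := s) f
    (g := fun c => g c * Polynomial.C (g c).leadingCoeff⁻¹)
    (fun c hc => Polynomial.monic_mul_leadingCoeff_inv (hg c hc))
    (fun c hc d hd hcd => ((isCoprime_mul_unit_right_left (hu c hc) _ _).2
      ((isCoprime_mul_unit_right_right (hu d hd) _ _).2 (hgg hc hd hcd))))
  have hdeg : ∀ c ∈ s, (g c * Polynomial.C (g c).leadingCoeff⁻¹).degree = (g c).degree :=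
    fun c hc => Polynomial.degree_mul_leadingCoeff_inv _ (hg c hc)
  have hr' : ∀ c ∈ s, (r c).degree < (g c).degree := fun c hc => (hr c hc).trans_eq (hdeg c hc)
  let R : ι → Polynomial K := fun c => r c * ∏ d ∈ s.erase c, Polynomial.C (g d).leadingCoeff⁻¹
  have hR : ∀ c ∈ s, (R c).degree < (g c).degree := by
    intro c hc
    refine lt_of_eq_of_lt ?_ (hr' c hc)
    simp only [R]
    rw [← map_prod, Polynomial.degree_mul, Polynomial.degree_C, add_zero]
    exact Finset.prod_ne_zero_iff.2 fun d hd =>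
      inv_ne_zero (Polynomial.leadingCoeff_ne_zero.2 (hg d (Finset.mem_of_mem_erase hd)))
  have hterm : ∀ c ∈ s, r c * ∏ d ∈ s.erase c, (g d * Polynomial.C (g d).leadingCoeff⁻¹) =
      R c * ∏ d ∈ s.erase c, g d := by
    intro c _
    simp only [R]
    rw [Finset.prod_mul_distrib]
    ring
  rw [Finset.sum_congr rfl hterm, Finset.prod_mul_distrib] at hq
  refine ⟨R, hR, ?_⟩
  have hprod : ∏ c ∈ s, g c ≠ 0 := Finset.prod_ne_zero_iff.2 hg
  have hsum : (∑ c ∈ s, R c * ∏ d ∈ s.erase c, g d).degree < (∏ c ∈ s, g c).degree := by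
    refine (Polynomial.degree_sum_le s _).trans_lt ?_
    rw [Finset.sup_lt_iff (bot_lt_iff_ne_bot.2 (by simpa using hprod))]
    intro c hc
    have h1 : ∏ d ∈ s.erase c, g d ≠ 0 :=
      Finset.prod_ne_zero_iff.2 fun d hd => hg d (Finset.mem_of_mem_erase hd)
    rw [← Finset.mul_prod_erase s g hc]
    rw [Polynomial.degree_mul (p := R c), Polynomial.degree_mul (p := g c)]
    exact WithBot.add_lt_add_right (Polynomial.degree_ne_bot.2 h1) (hR c hc)
  have h0 : f - ∑ c ∈ s, R c * ∏ d ∈ s.erase c, g d = 0 := by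
    refine Polynomial.eq_zero_of_dvd_of_degree_lt
      ⟨q * ∏ c ∈ s, Polynomial.C (g c).leadingCoeff⁻¹, ?_⟩
      ((Polynomial.degree_sub_le _ _).trans_lt (max_lt hf hsum))
    conv_lhs => rw [hq]
    ring
  exact sub_eq_zero.1 h0

/-- The underlined constant terms of a proper rational function that vanishes at `λ = 0` and has
pairwise coprime denominator factors add up to zero. -/
lemma exists_isUnderlinedCT_sum_eq_zero (G : RatFun {s // s ≠ i}) (δ : σ → ℤ)
    (s : Finset (σ → ℤ)) (hs : ∀ γ ∈ s, 0 < γ i)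
    (hprop : ∀ γ ∈ s, ∀ γ' ∈ s, γ ≠ γ' → γ' i • γ ≠ γ i • γ')
    (h0 : 0 < δ i) (h1 : δ i < ∑ γ ∈ s, γ i) :
    ∃ c : (σ → ℤ) → RatFun σ, ∑ γ ∈ s, c γ = 0 ∧
      ∀ γ ∈ s, IsUnderlinedCT i γ (inclNe i G * mono δ * ∏ γ ∈ s, (1 - mono γ)⁻¹) (c γ) := by
  classical
  have hg0 : ∀ γ ∈ s, (1 - monoPoly i γ) ≠ 0 := fun γ hγ h => by
    have := degree_one_sub_monoPoly i γ (hs γ hγ)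
    rw [h, Polynomial.degree_zero] at this
    exact absurd this (by simp)
  have hcop : (s : Set (σ → ℤ)).Pairwise fun γ γ' =>
      IsCoprime (1 - monoPoly i γ) (1 - monoPoly i γ') := fun γ hγ γ' hγ' hne =>
    isCoprime_one_sub_monoPoly i γ γ' (hs γ hγ).le (hs γ' hγ') (hprop γ hγ γ' hγ' hne)
  have hdeg : (Polynomial.C G * monoPoly i δ).degree < (∏ γ ∈ s, (1 - monoPoly i γ)).degree := by
    rw [Polynomial.degree_prod, Finset.sum_congr rfl fun γ hγ =>
      degree_one_sub_monoPoly i γ (hs γ hγ), monoPoly, ← mul_assoc, ← Polynomial.C_mul]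
    refine (Polynomial.degree_C_mul_X_pow_le _ _).trans_lt ?_
    have : (δ i).toNat < ∑ γ ∈ s, (γ i).toNat := by
      zify
      rw [Int.toNat_of_nonneg h0.le]
      refine h1.trans_eq (Finset.sum_congr rfl fun γ hγ => ?_)
      exact (Int.toNat_of_nonneg (hs γ hγ).le).symm
    exact_mod_cast this
  obtain ⟨r, hr, hsum⟩ := exists_partialFractions hg0 hcop hdeg
  have hone : ∀ γ ∈ s, (1 - mono γ : RatFun σ) ≠ 0 := fun γ hγ => by
    rw [← evalVar_one_sub_monoPoly i γ (hs γ hγ).le]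
    exact evalVar_ne_zero (hg0 γ hγ)
  have hE : inclNe i G * mono δ * ∏ γ ∈ s, (1 - mono γ)⁻¹ =
      ∑ γ ∈ s, evalVar i (r γ) / (1 - mono γ) := by
    have h2 := congrArg (evalVar i) hsum
    rw [map_mul, evalVar_C, evalVar_monoPoly i δ h0.le, map_sum] at h2
    rw [h2, Finset.sum_mul]
    refine Finset.sum_congr rfl fun γ hγ => ?_
    rw [map_mul, map_prod, Finset.prod_congr rfl fun γ' hγ' =>
      evalVar_one_sub_monoPoly i γ' (hs γ' (Finset.mem_of_mem_erase hγ')).le,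
      ← Finset.mul_prod_erase s _ hγ, mul_assoc, mul_left_comm (∏ d ∈ s.erase γ, (1 - mono d)),
      ← Finset.prod_mul_distrib, Finset.prod_congr rfl fun γ' hγ' =>
      mul_inv_cancel₀ (hone γ' (Finset.mem_of_mem_erase hγ')), Finset.prod_const_one, mul_one,
      div_eq_mul_inv]
  refine ⟨fun γ => inclNe i ((r γ).coeff 0), ?_, fun γ hγ => ?_⟩
  · rw [← map_sum]
    -- At `λ = 0` every denominator factor is `1`, and the numerator vanishes because `δ i > 0`.
    have h2 := congrArg (Polynomial.eval 0) hsum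
    have h3 : ∀ γ ∈ s, (1 - monoPoly i γ).eval 0 = 1 := by
      intro γ hγ
      have := hs γ hγ
      have : (γ i).toNat ≠ 0 := by omega
      simp [monoPoly, this]
    rw [Polynomial.eval_finsetSum, Finset.sum_congr rfl fun γ hγ => by
      rw [Polynomial.eval_mul, Polynomial.eval_prod, Finset.prod_congr rfl fun γ' hγ' =>
        h3 γ' (Finset.mem_of_mem_erase hγ'), Finset.prod_const_one, mul_one,
        ← Polynomial.coeff_zero_eq_eval_zero]] at h2
    rw [← h2]
    have : (δ i).toNat ≠ 0 := by omega
    simp [monoPoly, this]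
  · rw [isUnderlinedCT_iff]
    refine ⟨hs γ hγ, r γ, (hr γ hγ).trans_eq (degree_one_sub_monoPoly i γ (hs γ hγ)), ?_, rfl⟩
    rw [hE, ← Finset.add_sum_erase s _ hγ, add_sub_cancel_left]
    refine isReg_sum (hs γ hγ) _ _ fun γ' hγ' => ⟨r γ', 1 - monoPoly i γ', ?_, ?_⟩
    · exact hcop (Finset.mem_of_mem_erase hγ') hγ (Finset.ne_of_mem_erase hγ')
    · rw [evalVar_one_sub_monoPoly i γ' (hs γ' (Finset.mem_of_mem_erase hγ')).le]

end ConstantTerm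

/-! ### Dual functionals as a working form of unimodularity. -/

section Dual

variable {σ : Type}

/-- The vectors of the list form part of a `ℤ`-basis: there is a dual system of functionals. -/
def HasDual (l : List (σ → ℤ)) : Prop :=
  l.Nodup ∧ ∀ γ ∈ l, ∃ φ : (σ → ℤ) →ₗ[ℤ] ℤ, φ γ = 1 ∧ ∀ γ' ∈ l, γ' ≠ γ → φ γ' = 0

lemma HasDual.perm {l l' : List (σ → ℤ)} (h : HasDual l) (hl : l.Perm l') : HasDual l' := by
  refine ⟨hl.nodup_iff.1 h.1, fun γ hγ => ?_⟩
  obtain ⟨φ, h1, h2⟩ := h.2 γ (hl.mem_iff.2 hγ)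
  exact ⟨φ, h1, fun γ' hγ' => h2 γ' (hl.mem_iff.2 hγ')⟩

lemma HasDual.tail {μ : σ → ℤ} {l : List (σ → ℤ)} (h : HasDual (μ :: l)) : HasDual l := by
  refine ⟨(List.nodup_cons.1 h.1).2, fun γ hγ => ?_⟩
  obtain ⟨φ, h1, h2⟩ := h.2 γ (List.mem_cons_of_mem μ hγ)
  exact ⟨φ, h1, fun γ' hγ' => h2 γ' (List.mem_cons_of_mem μ hγ')⟩

lemma HasDual.map_of_leftInverse {τ : Type} {l : List (σ → ℤ)} (h : HasDual l)
    (f : (σ → ℤ) → (τ → ℤ)) (g : (τ → ℤ) →ₗ[ℤ] (σ → ℤ)) (hgf : ∀ γ ∈ l, g (f γ) = γ) :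
    HasDual (l.map f) := by
  refine ⟨List.Nodup.map_on (fun γ hγ γ' hγ' hf => ?_) h.1, fun γ hγ => ?_⟩
  · rw [← hgf γ hγ, ← hgf γ' hγ', hf]
  · obtain ⟨γ, hγl, rfl⟩ := List.mem_map.1 hγ
    obtain ⟨φ, h1, h2⟩ := h.2 γ hγl
    refine ⟨φ ∘ₗ g, by simp [hgf γ hγl, h1], fun γ' hγ' hne => ?_⟩
    obtain ⟨γ', hγl', rfl⟩ := List.mem_map.1 hγ'
    simpa [hgf γ' hγl'] using h2 γ' hγl' fun h => hne (by rw [h])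

lemma map_sub_zsmul (φ : (σ → ℤ) →ₗ[ℤ] ℤ) (γ μ : σ → ℤ) (k : ℤ) :
    φ (γ - k • μ) = φ γ - k * φ μ := by
  rw [map_sub, map_smul, smul_eq_mul]

/-- The shift is a shear along `μ`. The functionals dual to `l` vanish on `μ`, so they do not notice
it; only the one dual to `μ` needs a correction. -/
lemma HasDual.shift {μ : σ → ℤ} {l : List (σ → ℤ)} (h : HasDual (μ :: l)) (k : (σ → ℤ) → ℤ) :
    HasDual (μ :: l.map fun γ => γ - k γ • μ) := by
  classical
  have hdual : ∀ γ ∈ l, ∃ φ : (σ → ℤ) →ₗ[ℤ] ℤ, φ γ = 1 ∧ φ μ = 0 ∧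
      ∀ γ' ∈ l, γ' ≠ γ → φ γ' = 0 := by
    intro γ hγ
    obtain ⟨φ, h1, h2⟩ := h.2 γ (List.mem_cons_of_mem μ hγ)
    refine ⟨φ, h1, h2 μ List.mem_cons_self ?_, fun γ' hγ' => h2 γ' (List.mem_cons_of_mem μ hγ')⟩
    rintro rfl
    exact (List.nodup_cons.1 h.1).1 hγ
  choose! φ h1 h2 h3 using hdual
  obtain ⟨ψ, hψ1, hψ2⟩ := h.2 μ List.mem_cons_self
  have hne : ∀ γ ∈ l, γ ≠ μ := by
    rintro γ hγ rfl
    exact (List.nodup_cons.1 h.1).1 hγ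
  have hinj : ∀ γ ∈ l, ∀ γ' ∈ l, γ - k γ • μ = γ' - k γ' • μ → γ = γ' := by
    intro γ hγ γ' hγ' he
    by_contra hγγ'
    have := congrArg (φ γ) he
    simp [map_sub_zsmul, -zsmul_eq_mul, h1 γ hγ, h2 γ hγ, h3 γ hγ γ' hγ' (Ne.symm hγγ')] at this
  refine ⟨List.nodup_cons.2 ⟨fun hμ => ?_, List.Nodup.map_on (fun γ hγ γ' hγ' =>
    hinj γ hγ γ' hγ') (List.nodup_cons.1 h.1).2⟩, fun γ hγ => ?_⟩
  · obtain ⟨γ, hγ, he⟩ := List.mem_map.1 hμ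
    have := congrArg (φ γ) he
    simp [map_sub_zsmul, -zsmul_eq_mul, h1 γ hγ, h2 γ hγ] at this
  · rcases List.mem_cons.1 hγ with rfl | hγ
    -- The sum compensates for the multiples of `μ` that were subtracted: on `γ' - k γ' • μ` it
    -- contributes `k γ'`, while `ψ` gives `-k γ'`.
    · refine ⟨ψ + ∑ γ' ∈ l.toFinset, k γ' • φ γ', ?_, fun γ' hγ' hγγ' => ?_⟩
      · rw [LinearMap.add_apply, hψ1, LinearMap.sum_apply, Finset.sum_eq_zero, add_zero]
        intro γ' hγ'
        simp [h2 γ' (List.mem_toFinset.1 hγ')]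
      · rcases List.mem_cons.1 hγ' with rfl | hγ'
        · exact absurd rfl hγγ'
        · obtain ⟨γ', hγl, rfl⟩ := List.mem_map.1 hγ'
          rw [LinearMap.add_apply, LinearMap.sum_apply, Finset.sum_eq_single γ']
          · simp [map_sub_zsmul, -zsmul_eq_mul, h1 γ' hγl, h2 γ' hγl, hψ1,
              hψ2 γ' (List.mem_cons_of_mem γ hγl) (hne γ' hγl)]
          · intro ν hν hνγ'
            simp [map_sub_zsmul, -zsmul_eq_mul, h2 ν (List.mem_toFinset.1 hν),
              h3 ν (List.mem_toFinset.1 hν) γ' hγl hνγ'.symm]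
          · intro hν
            exact absurd (List.mem_toFinset.2 hγl) hν
    · obtain ⟨γ, hγl, rfl⟩ := List.mem_map.1 hγ
      refine ⟨φ γ, by simp [map_sub_zsmul, -zsmul_eq_mul, h1 γ hγl, h2 γ hγl],
        fun γ' hγ' hγγ' => ?_⟩
      rcases List.mem_cons.1 hγ' with rfl | hγ'
      · exact h2 γ hγl
      · obtain ⟨γ', hγl', rfl⟩ := List.mem_map.1 hγ'
        have : γ' ≠ γ := by rintro rfl; exact hγγ' rfl
        simp [map_sub_zsmul, -zsmul_eq_mul, h2 γ hγl, h3 γ hγl γ' hγl' this]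

/-- The functional that is `1` on `γ` and `0` on `μ` would turn proportionality into `μ i = 0`. -/
lemma HasDual.not_proportional {l : List (σ → ℤ)} (h : HasDual l) {γ μ : σ → ℤ} (hγ : γ ∈ l)
    (hμ : μ ∈ l) (hne : μ ≠ γ) {i : σ} (hi : 0 < μ i) : μ i • γ ≠ γ i • μ := by
  intro he
  obtain ⟨φ, h1, h2⟩ := h.2 γ hγ
  have := congrArg φ he
  rw [map_smul, map_smul, h1, h2 μ hμ hne] at this
  simp at this
  omega

/-- The dual functionals are integral coordinates on the span, which gives both independence and
saturation. -/
lemma isUnimodular_of_hasDual {T : SignedTerm σ} (h : HasDual T.den) : T.IsUnimodular := by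
  classical
  constructor
  · rw [Fintype.linearIndependent_iff]
    intro g hg c
    obtain ⟨φ, h1, h2⟩ := h.2 (T.den.get c) (List.get_mem _ _)
    have := congrArg φ hg
    rw [map_sum, Finset.sum_eq_single c] at this
    · simpa [-List.get_eq_getElem, -zsmul_eq_mul, h1] using this
    · intro d _ hd
      rw [map_smul, h2 _ (List.get_mem _ _) fun he => hd (List.nodup_iff_injective_get.1 h.1 he),
        smul_zero]
    · simp
  · rintro x ⟨m, hm, hx⟩
    choose! φ h1 h2 using h.2
    have key : ∀ y ∈ Submodule.span ℤ {γ | γ ∈ T.den},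
        y = ∑ γ ∈ T.den.toFinset, φ γ y • γ := by
      intro y hy
      induction hy using Submodule.span_induction with
      | mem γ hγ =>
        rw [Finset.sum_eq_single γ]
        · rw [h1 γ hγ, one_smul]
        · intro γ' hγ' hne
          rw [h2 γ' (List.mem_toFinset.1 hγ') γ hγ hne.symm, zero_smul]
        · intro hγ'
          exact absurd (List.mem_toFinset.2 hγ) hγ'
      | zero => simp
      | add y z _ _ hy hz =>
        conv_lhs => rw [hy, hz]
        simp [add_smul, Finset.sum_add_distrib]
      | smul c y _ hy =>
        conv_lhs => rw [hy]
        simp only [Finset.smul_sum, map_smul, smul_assoc]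
    -- The coordinates of `m • x` are `m` times the values of the functionals at `x`, so `m` cancels
    -- and `x` is an integral combination.
    have hx' := key _ hx
    simp only [map_smul, smul_assoc, ← Finset.smul_sum] at hx'
    rw [smul_right_injective _ hm hx']
    exact Submodule.sum_mem _ fun γ hγ => Submodule.smul_mem _ _
      (Submodule.subset_span (List.mem_toFinset.1 hγ))

/-- Saturation makes the quotient by the span `N` torsion-free, hence free over `ℤ`, so `N` is a
direct summand. The coordinates of the basis of `N` extend along the projection onto `N`. -/
lemma hasDual_of_isUnimodular [Finite σ] {T : SignedTerm σ} (h : T.IsUnimodular) :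
    HasDual T.den := by
  obtain ⟨hli, hsat⟩ := h
  have hrange : Set.range T.den.get = {γ | γ ∈ T.den} := by
    ext γ
    simp [List.mem_iff_get]
  rw [← hrange] at hsat
  set N := Submodule.span ℤ (Set.range T.den.get)
  have hfree : Module.IsTorsionFree ℤ ((σ → ℤ) ⧸ N) := by
    rw [Module.isTorsionFree_iff_smul_eq_zero]
    intro m y hmy
    obtain ⟨x, rfl⟩ := N.mkQ_surjective y
    by_cases hm : m = 0
    · exact Or.inl hm
    · right
      rw [← map_smul, Submodule.mkQ_apply, Submodule.Quotient.mk_eq_zero] at hmy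
      rw [Submodule.mkQ_apply, Submodule.Quotient.mk_eq_zero]
      exact hsat x ⟨m, hm, hmy⟩
  obtain ⟨s, hs⟩ := LinearMap.exists_rightInverse_of_surjective N.mkQ N.range_mkQ
  have hmem : ∀ x, x - s (N.mkQ x) ∈ N := by
    intro x
    rw [← Submodule.Quotient.mk_eq_zero, ← Submodule.mkQ_apply, map_sub,
      ← LinearMap.comp_apply, hs, LinearMap.id_apply, sub_self]
  let π : (σ → ℤ) →ₗ[ℤ] N := LinearMap.codRestrict N (LinearMap.id - s ∘ₗ N.mkQ) hmem
  have hπ : ∀ c, π (T.den.get c) = Module.Basis.span hli c := by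
    intro c
    apply Subtype.ext
    have hc : T.den.get c ∈ N := Submodule.subset_span ⟨c, rfl⟩
    have h0 : N.mkQ (T.den.get c) = 0 := by
      rwa [Submodule.mkQ_apply, Submodule.Quotient.mk_eq_zero]
    rw [Module.Basis.span_apply]
    change T.den.get c - s (N.mkQ (T.den.get c)) = _
    rw [h0, map_zero, sub_zero]
  refine ⟨List.nodup_iff_injective_get.2 hli.injective, fun γ hγ => ?_⟩
  obtain ⟨c, rfl⟩ := List.mem_iff_get.1 hγ
  refine ⟨(Module.Basis.span hli).coord c ∘ₗ π, ?_, fun γ' hγ' hne => ?_⟩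
  · rw [LinearMap.comp_apply, hπ, Module.Basis.coord_apply, Module.Basis.repr_self,
      Finsupp.single_eq_same]
  · obtain ⟨d, rfl⟩ := List.mem_iff_get.1 hγ'
    have : d ≠ c := by rintro rfl; exact hne rfl
    rw [LinearMap.comp_apply, hπ, Module.Basis.coord_apply, Module.Basis.repr_self,
      Finsupp.single_eq_of_ne this.symm]

end Dual

/-! ### Existence of DecDenu outputs by Euclid's algorithm. -/

section DecDenu

variable {σ : Type} [Finite σ]

lemma list_sum_map_neg {ι M : Type*} [AddCommGroup M] (l : List ι) (f : ι → M) :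
    (l.map fun t => -f t).sum = -(l.map f).sum := by
  induction l with
  | nil => simp
  | cons t l ih => simp [ih, add_comm]

namespace SignedTerm

lemma toRat_eq (T : SignedTerm σ) : T.toRat =
    ((T.sgn : ℤ) : RatFun σ) * mono T.num * (T.den.map fun γ => (1 - mono γ)⁻¹).prod := by
  have : (T.den.map fun γ => (1 - mono γ)⁻¹).prod = (T.den.map fun γ => 1 - mono γ).prod⁻¹ := by
    induction T.den with
    | nil => simp
    | cons γ l ih => simp [ih, mul_comm]
  rw [toRat, frac, this, div_eq_mul_inv, mul_assoc]

lemma toRat_perm (z : ℤˣ) (δ : σ → ℤ) {l l' : List (σ → ℤ)} (h : l.Perm l') :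
    toRat ⟨z, δ, l⟩ = toRat ⟨z, δ, l'⟩ := by
  rw [toRat_eq, toRat_eq, (h.map _).prod_eq]

lemma toRat_neg (T : SignedTerm σ) : toRat ⟨-T.sgn, T.num, T.den⟩ = -T.toRat := by
  rw [toRat_eq, toRat_eq]
  simp

lemma sumRat_append (D D' : List (SignedTerm σ)) : sumRat (D ++ D') = sumRat D + sumRat D' := by
  simp [sumRat]

lemma sumRat_flatMap {ι : Type*} (l : List ι) (D : ι → List (SignedTerm σ)) :
    sumRat (l.flatMap D) = (l.map fun t => sumRat (D t)).sum := by
  induction l with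
  | nil => simp [sumRat]
  | cons t l ih => simp [sumRat_append, ih]

end SignedTerm

open SignedTerm

variable {i : σ} {μ : σ → ℤ}

lemma isReg_intCast (z : ℤ) : IsReg i μ (z : RatFun σ) := by
  have := isReg_incl (i := i) (μ := μ) (z : RatFun {s // s ≠ i})
  rwa [map_intCast] at this

/-- Apart from the factor `1 / (1 - x^μ)`, the two terms are congruent modulo `1 - x^μ`. Their
difference is therefore regular. -/
lemma isUnderlinedCT_shift (hμ : 0 < μ i) (z : ℤˣ) (δ : σ → ℤ) (l : List (σ → ℤ))
    (hl : ∀ γ ∈ l, μ i • γ ≠ γ i • μ) (k : ℤ) (κ : (σ → ℤ) → ℤ) {c : RatFun σ}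
    (h : IsUnderlinedCT i μ (toRat ⟨z, δ - k • μ, μ :: l.map fun γ => γ - κ γ • μ⟩) c) :
    IsUnderlinedCT i μ (toRat ⟨z, δ, μ :: l⟩) c := by
  apply h.congr
  have h1 := ((RegCongr.refl (isReg_intCast (i := i) (μ := μ) (z : ℤ))).mul hμ
    (regCongr_mono hμ δ k)).mul hμ (regCongr_list_prod hμ l (fun γ => (1 - mono γ)⁻¹)
      (fun γ => (1 - mono (γ - κ γ • μ))⁻¹) fun γ hγ => regCongr_inv_one_sub_mono hμ γ (hl γ hγ) _)
  convert h1.2.2 using 1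
  rw [toRat_eq, toRat_eq, List.map_cons, List.map_cons, List.prod_cons, List.prod_cons,
    List.map_map, Function.comp_def]
  ring

/-- Shifting removes `λ` from all other denominators and leaves the numerator with the remainder of
`δ i` modulo `μ i`. The numerator is then itself the polynomial `P`, and `P(0)` survives exactly
when this remainder is zero. -/
lemma isUnderlinedCT_of_dvd (hμ : 0 < μ i) (z : ℤˣ) (δ : σ → ℤ) (l : List (σ → ℤ))
    (hl : ∀ γ ∈ l, μ i • γ ≠ γ i • μ) (hdvd : ∀ γ ∈ l, μ i ∣ γ i) :
    IsUnderlinedCT i μ (toRat ⟨z, δ, μ :: l⟩)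
      (if μ i ∣ δ i then toRat ⟨z, δ - (δ i / μ i) • μ, l.map fun γ => γ - (γ i / μ i) • μ⟩
        else 0) := by
  apply isUnderlinedCT_shift hμ z δ l hl (δ i / μ i) fun γ => γ i / μ i
  set δ' := δ - (δ i / μ i) • μ
  have hδ' : δ' i = δ i % μ i := by
    simp only [δ', Pi.sub_apply, Pi.smul_apply, smul_eq_mul]
    rw [Int.emod_def, mul_comm]
  set l' := l.map fun γ => γ - (γ i / μ i) • μ
  have hl' : ∀ γ ∈ l', γ i = 0 := by
    intro γ hγ
    obtain ⟨γ, hγl, rfl⟩ := List.mem_map.1 hγ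
    simp [Int.ediv_mul_cancel (hdvd γ hγl)]
  set G : RatFun {s // s ≠ i} :=
    ((z : ℤ) : RatFun {s // s ≠ i}) *
      (l'.map fun γ => (1 - mono fun s : {s // s ≠ i} => γ s.1)⁻¹).prod with hG
  have h1 : ((z : ℤ) : RatFun σ) * (l'.map fun γ => (1 - mono γ)⁻¹).prod =
      inclNe i G := by
    rw [hG, map_mul, map_intCast, map_list_prod]
    congr 2
    refine Eq.trans (List.map_congr_left fun γ hγ => ?_) List.map_map.symm
    rw [Function.comp_apply, map_inv₀, map_sub, map_one, inclNe_mono i γ (hl' γ hγ)]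
  have h2 := isUnderlinedCT_div_one_sub (μ := μ) G δ'
    (by rw [hδ']; exact Int.emod_nonneg _ hμ.ne') (by rw [hδ']; exact Int.emod_lt_of_pos _ hμ)
  rw [← h1] at h2
  simp only [hδ', ← Int.dvd_iff_emod_eq_zero] at h2
  convert h2 using 1
  · rw [toRat_eq, List.map_cons, List.prod_cons]
    ring
  · rw [toRat_eq]
    congr 1
    ring

/-- The underlined constant term of a proper term with respect to one of its denominator factors
is minus the sum of those with respect to the other factors that involve the variable. -/
lemma isUnderlinedCT_of_forall_pos (hμ : 0 < μ i) (z : ℤˣ) (δ : σ → ℤ) (l : List (σ → ℤ))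
    (hl : HasDual (μ :: l)) (hnn : ∀ γ ∈ l, 0 ≤ γ i) (hpos : ∃ γ ∈ l, 0 < γ i) (h0 : 0 < δ i)
    (h1 : δ i ≤ μ i) (c : (σ → ℤ) → RatFun σ)
    (hc : ∀ γ ∈ l, 0 < γ i → IsUnderlinedCT i γ (toRat ⟨z, δ, μ :: l⟩) (c γ)) :
    IsUnderlinedCT i μ (toRat ⟨z, δ, μ :: l⟩)
      (-((l.filter fun γ => 0 < γ i).map c).sum) := by
  classical
  set p := l.filter fun γ => 0 < γ i with hp
  set q := l.filter fun γ => ¬ 0 < γ i with hq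
  have hpq : (p ++ q).Perm l := by
    have := List.filter_append_perm (fun γ : σ → ℤ => decide (0 < γ i)) l
    simpa only [hp, hq, decide_not] using this
  have hmemp : ∀ γ ∈ p, γ ∈ l ∧ 0 < γ i := fun γ hγ => by simpa [hp] using hγ
  have hmemq : ∀ γ ∈ q, γ i = 0 := fun γ hγ => by
    have : γ ∈ l ∧ γ i ≤ 0 := by simpa [hq] using hγ
    exact le_antisymm this.2 (hnn γ this.1)
  have hnd : (μ :: p).Nodup := by
    have h2 := List.nodup_cons.1 hl.1
    exact List.nodup_cons.2 ⟨fun h => h2.1 (hmemp μ h).1, h2.2.filter _⟩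
  have hmem : ∀ γ ∈ (μ :: p).toFinset, γ ∈ μ :: l ∧ 0 < γ i := by
    intro γ hγ
    rcases List.mem_cons.1 (List.mem_toFinset.1 hγ) with rfl | hγ
    · exact ⟨List.mem_cons_self, hμ⟩
    · exact ⟨List.mem_cons_of_mem _ (hmemp γ hγ).1, (hmemp γ hγ).2⟩
  -- Denominators free of `λ` are absorbed into the coefficient; partial fractions involve only
  -- those with a positive exponent.
  set G : RatFun {s // s ≠ i} :=
    ((z : ℤ) : RatFun {s // s ≠ i}) *
      (q.map fun γ => (1 - mono fun s : {s // s ≠ i} => γ s.1)⁻¹).prod with hG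
  have hGz : ((z : ℤ) : RatFun σ) * (q.map fun γ => (1 - mono γ)⁻¹).prod = inclNe i G := by
    rw [hG, map_mul, map_intCast, map_list_prod]
    congr 2
    refine Eq.trans (List.map_congr_left fun γ hγ => ?_) List.map_map.symm
    rw [Function.comp_apply, map_inv₀, map_sub, map_one, inclNe_mono i γ (hmemq γ hγ)]
  have hE : inclNe i G * mono δ * ∏ γ ∈ (μ :: p).toFinset, (1 - mono γ)⁻¹ =
      toRat ⟨z, δ, μ :: l⟩ := by
    rw [List.prod_toFinset _ hnd, ← hGz, toRat_perm z δ (hpq.symm.cons μ), toRat_eq]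
    simp only [List.map_cons, List.prod_cons, List.map_append, List.prod_append]
    ring
  obtain ⟨C, hC0, hC⟩ := exists_isUnderlinedCT_sum_eq_zero G δ (μ :: p).toFinset
    (fun γ hγ => (hmem γ hγ).2) (fun γ hγ γ' hγ' hne =>
      hl.not_proportional (hmem γ hγ).1 (hmem γ' hγ').1 hne.symm (hmem γ' hγ').2) h0 (by
        rw [List.toFinset_cons, Finset.sum_insert fun h =>
          (List.nodup_cons.1 hnd).1 (List.mem_toFinset.1 h)]
        obtain ⟨γ, hγ, hγi⟩ := hpos
        have := Finset.sum_pos (s := p.toFinset) (f := fun γ => γ i)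
          (fun γ hγ => (hmemp γ (List.mem_toFinset.1 hγ)).2)
          ⟨γ, List.mem_toFinset.2 (by simp [hp, hγ, hγi])⟩
        omega)
  rw [hE] at hC
  rw [List.sum_toFinset _ hnd, List.map_cons, List.sum_cons] at hC0
  have hCp : p.map C = p.map c := List.map_congr_left fun γ hγ =>
    (hC γ (List.mem_toFinset.2 (List.mem_cons_of_mem μ hγ))).unique
      (hc γ (hmemp γ hγ).1 (hmemp γ hγ).2)
  rw [hCp] at hC0
  rw [← eq_neg_of_add_eq_zero_left hC0]
  exact hC μ (List.mem_toFinset.2 List.mem_cons_self)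

/-- Strong induction on the exponent of `λ` in the underlined factor: after reduction the recursive
calls underline factors with a strictly smaller exponent. The clauses beyond `IsDecDenuOutput` keep
the factors needed by later variables and the freeness from earlier ones, so that the construction
can be iterated. -/
lemma exists_isDecDenuOutput (i : σ) (a : ℕ) : ∀ (T : SignedTerm σ) (μ : σ → ℤ), HasDual T.den →
    μ ∈ T.den → μ i = a → 0 < a → ∃ D, IsDecDenuOutput i μ T D ∧ ∀ T' ∈ D, HasDual T'.den ∧
      (∀ γ ∈ T.den, γ i = 0 → γ ∈ T'.den) ∧ ∀ l, T.FreeOf l → T'.FreeOf l := by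
  classical
  induction a using Nat.strong_induction_on with
  | _ a ih =>
  intro T μ hT hμT hμa ha
  have hμ : 0 < μ i := by rw [hμa]; exact_mod_cast ha
  set l := T.den.erase μ with hl
  have hperm : T.den.Perm (μ :: l) := List.perm_cons_erase hμT
  have hlen : l.length + 1 = T.den.length := by rw [hperm.length_eq, List.length_cons]
  have hdual : HasDual (μ :: l) := hT.perm hperm
  have hne : ∀ γ ∈ l, μ ≠ γ := by
    rintro γ hγ rfl
    exact (List.nodup_cons.1 hdual.1).1 hγ
  have hprop : ∀ γ ∈ l, μ i • γ ≠ γ i • μ := fun γ hγ =>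
    hdual.not_proportional (List.mem_cons_of_mem μ hγ) List.mem_cons_self (hne γ hγ) hμ
  have hTrat : T.toRat = toRat ⟨T.sgn, T.num, μ :: l⟩ := toRat_perm T.sgn T.num hperm
  have hfix : ∀ γ ∈ T.den, γ i = 0 → γ ∈ l.map fun γ => γ - (γ i / μ i) • μ := by
    intro γ hγ h0
    rcases List.mem_cons.1 (hperm.mem_iff.1 hγ) with rfl | hγ
    · omega
    · exact List.mem_map.2 ⟨γ, hγ, by simp [h0]⟩
  have hfreeμ : ∀ v, T.FreeOf v → μ v = 0 := fun v hv => hv.2 μ hμT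
  have hfreel : ∀ v, T.FreeOf v → ∀ γ ∈ l.map fun γ => γ - (γ i / μ i) • μ, γ v = 0 := by
    intro v hv γ hγ
    obtain ⟨γ, hγl, rfl⟩ := List.mem_map.1 hγ
    simp [hfreeμ v hv, hv.2 γ (hperm.mem_iff.2 (List.mem_cons_of_mem μ hγl))]
  by_cases hdvd : ∀ γ ∈ l, μ i ∣ γ i
  · have hct := isUnderlinedCT_of_dvd hμ T.sgn T.num l hprop hdvd
    rw [← hTrat] at hct
    by_cases hδ : μ i ∣ T.num i
    · rw [if_pos hδ] at hct
      refine ⟨[⟨T.sgn, T.num - (T.num i / μ i) • μ, l.map fun γ => γ - (γ i / μ i) • μ⟩],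
        ⟨hμT, by simpa [sumRat] using hct, ?_⟩, ?_⟩
      · intro T' hT'
        rw [List.mem_singleton.1 hT']
        refine ⟨⟨?_, ?_⟩, ?_, isUnimodular_of_hasDual (hdual.shift _).tail⟩
        · simp [Int.ediv_mul_cancel hδ]
        · intro γ hγ
          obtain ⟨γ, hγl, rfl⟩ := List.mem_map.1 hγ
          simp [Int.ediv_mul_cancel (hdvd γ hγl)]
        · simp [hlen]
      · intro T' hT'
        rw [List.mem_singleton.1 hT']
        exact ⟨(hdual.shift _).tail, hfix, fun v hv =>
          ⟨by simp [hv.1, hfreeμ v hv], hfreel v hv⟩⟩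
    · rw [if_neg hδ] at hct
      exact ⟨[], ⟨hμT, by simpa [sumRat] using hct, by simp⟩, by simp⟩
  · push Not at hdvd
    obtain ⟨γ₀, hγ₀, hγ₀μ⟩ := hdvd
    -- Subtracting `1` before dividing puts the exponent of the numerator in `1, …, μ i` instead of
    -- `0, …, μ i - 1`, so that the term vanishes at `λ = 0`.
    set δ' := T.num - ((T.num i - 1) / μ i) • μ with hδ'
    set l' := l.map fun γ => γ - (γ i / μ i) • μ with hl'
    have hshift : ∀ γ : σ → ℤ, (γ - (γ i / μ i) • μ) i = γ i % μ i := by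
      intro γ
      rw [Int.emod_def, Pi.sub_apply, Pi.smul_apply, smul_eq_mul, mul_comm]
    have hδi : δ' i = (T.num i - 1) % μ i + 1 := by
      rw [Int.emod_def, hδ', Pi.sub_apply, Pi.smul_apply, smul_eq_mul]
      ring
    have hrange : ∀ γ ∈ l', 0 ≤ γ i ∧ γ i < μ i := by
      intro γ hγ
      obtain ⟨γ, -, rfl⟩ := List.mem_map.1 hγ
      rw [hshift]
      exact ⟨Int.emod_nonneg _ hμ.ne', Int.emod_lt_of_pos _ hμ⟩
    have hdual' : HasDual (μ :: l') := hdual.shift _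
    have hih : ∀ γ ∈ l', 0 < γ i → ∃ D, IsDecDenuOutput i γ ⟨T.sgn, δ', μ :: l'⟩ D ∧
        ∀ T' ∈ D, HasDual T'.den ∧ (∀ γ ∈ μ :: l', γ i = 0 → γ ∈ T'.den) ∧
          ∀ v, FreeOf v ⟨T.sgn, δ', μ :: l'⟩ → T'.FreeOf v := by
      intro γ hγ hpos
      have h1 := hrange γ hγ
      exact ih (γ i).toNat (by omega) ⟨T.sgn, δ', μ :: l'⟩ γ hdual' (List.mem_cons_of_mem μ hγ)
        (by omega) (by omega)
    choose! D hD1 hD2 using hih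
    -- The factor coming from `γ₀` keeps a positive exponent. This makes the total degree of the
    -- denominator exceed `μ i`, so the term is proper even if the numerator has exponent `μ i`.
    have hct := isUnderlinedCT_shift hμ T.sgn T.num l hprop _ _
      (isUnderlinedCT_of_forall_pos hμ T.sgn δ' l' hdual' (fun γ hγ => (hrange γ hγ).1)
        ⟨_, List.mem_map.2 ⟨γ₀, hγ₀, rfl⟩, by
          rw [hshift]
          exact lt_of_le_of_ne (Int.emod_nonneg _ hμ.ne')
            fun h => hγ₀μ (Int.dvd_of_emod_eq_zero h.symm)⟩
        (by rw [hδi]; have := Int.emod_nonneg (T.num i - 1) hμ.ne'; omega)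
        (by rw [hδi]; have := Int.emod_lt_of_pos (T.num i - 1) hμ; omega)
        (fun γ => sumRat (D γ)) fun γ hγ hpos => (hD1 γ hγ hpos).2.1)
    rw [← hTrat] at hct
    refine ⟨(l'.filter fun γ => 0 < γ i).flatMap fun γ =>
      (D γ).map fun T' => ⟨-T'.sgn, T'.num, T'.den⟩, ⟨hμT, ?_, ?_⟩, ?_⟩
    · convert hct using 1
      rw [sumRat_flatMap, ← list_sum_map_neg]
      congr 1
      refine List.map_congr_left fun γ _ => ?_
      simp only [sumRat, List.map_map, Function.comp_def, toRat_neg]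
      exact list_sum_map_neg _ _
    · intro T' hT'
      obtain ⟨γ, hγ, T'', hT'', rfl⟩ := by simpa using hT'
      obtain ⟨h1, h2, h3⟩ := (hD1 γ hγ.1 hγ.2).2.2 T'' hT''
      refine ⟨h1, ?_, isUnimodular_of_hasDual ((hD2 γ hγ.1 hγ.2) T'' hT'').1⟩
      rw [← hlen]
      simpa [hl'] using h2
    · intro T' hT'
      obtain ⟨γ, hγ, T'', hT'', rfl⟩ := by simpa using hT'
      obtain ⟨h1, h2, h3⟩ := (hD2 γ hγ.1 hγ.2) T'' hT''
      refine ⟨h1, fun γ' hγ' h0 => h2 γ' (List.mem_cons_of_mem μ (hfix γ' hγ' h0)) h0,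
        fun v hv => h3 v ⟨by simp [hδ', hv.1, hfreeμ v hv], fun γ' hγ' => ?_⟩⟩
      rcases List.mem_cons.1 hγ' with rfl | hγ'
      · exact hfreeμ v hv
      · exact hfreel v hv γ' hγ'

end DecDenu

/-! ### Iterated DecDenu: existence, value and shape of runs. -/

section Runs

open SignedTerm

variable {n r : ℕ} {j : Fin r ↪ Fin n} {h : Fin r → ℕ}

lemma lamFactor_inr_self (j : Fin r ↪ Fin n) (h : Fin r → ℕ) (k : Fin r) :
    lamFactor j h k (Sum.inr k) = h k := by simp [lamFactor]

lemma lamFactor_inr_ne (j : Fin r ↪ Fin n) (h : Fin r → ℕ) {k l : Fin r} (hkl : l ≠ k) :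
    lamFactor j h k (Sum.inr l) = 0 := by simp [lamFactor, hkl]

/-- The factor to be underlined for a later `λ_l` does not involve `λ_k`, so it is still present
when its turn comes. -/
lemma exists_isDecDenuRun (hh : ∀ k, 0 < h k)
    (M : Matrix (Fin n ⊕ Fin r) (Fin n ⊕ Unit) ℤ) (hM : HasDual (ofMatrix M).den)
    (hlam : ∀ k, lamFactor j h k ∈ (ofMatrix M).den) : ∃ L, IsDecDenuRun j h M L := by
  classical
  have hD : ∀ (k : Fin r) (T : SignedTerm (Fin n ⊕ Fin r)), ∃ D, HasDual T.den →
      lamFactor j h k ∈ T.den → IsDecDenuOutput (Sum.inr k) (lamFactor j h k) T D ∧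
        ∀ T' ∈ D, HasDual T'.den ∧ (∀ γ ∈ T.den, γ (Sum.inr k) = 0 → γ ∈ T'.den) ∧
          ∀ l, T.FreeOf l → T'.FreeOf l := by
    -- The empty list is a dummy output for terms that lack the factor or the dual system; by `inv`
    -- these never occur in the run.
    intro k T
    by_cases hT : HasDual T.den ∧ lamFactor j h k ∈ T.den
    · obtain ⟨D, hD⟩ := exists_isDecDenuOutput (Sum.inr k) (h k) T _ hT.1 hT.2
        (lamFactor_inr_self j h k) (hh k)
      exact ⟨D, fun _ _ => hD⟩
    · exact ⟨[], fun h1 h2 => absurd ⟨h1, h2⟩ hT⟩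
  choose D hD using hD
  let L : ℕ → List (SignedTerm (Fin n ⊕ Fin r)) := fun m => Nat.rec [ofMatrix M]
    (fun m l => if hm : m < r then l.flatMap (D ⟨m, hm⟩) else l) m
  have hL : ∀ k : Fin r, L (k + 1) = (L k).flatMap (D k) := fun k => dif_pos k.2
  have inv : ∀ m ≤ r, ∀ T ∈ L m, HasDual T.den ∧
      (∀ l : Fin r, m ≤ l → lamFactor j h l ∈ T.den) ∧
      ∀ l : Fin r, (l : ℕ) < m → T.FreeOf (Sum.inr l) := by
    intro m
    induction m with
    | zero =>
      intro _ T hT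
      have hT' : T = ofMatrix M := by simpa [L] using hT
      rw [hT']
      exact ⟨hM, fun l _ => hlam l, fun l hl => absurd hl (Nat.not_lt_zero _)⟩
    | succ m ih =>
      intro hm T hT
      rw [hL ⟨m, hm⟩] at hT
      obtain ⟨T₀, hT₀, hT⟩ := List.mem_flatMap.1 hT
      obtain ⟨h1, h2, h3⟩ := ih (by omega) T₀ hT₀
      obtain ⟨hout, hpres⟩ := hD ⟨m, hm⟩ T₀ h1 (h2 ⟨m, hm⟩ le_rfl)
      obtain ⟨h1', h2', h3'⟩ := hpres T hT
      refine ⟨h1', fun l hl => h2' _ (h2 l (by omega)) (lamFactor_inr_ne j h fun he => ?_),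
        fun l hl => ?_⟩
      · rw [← he] at hl
        simp at hl
      · rcases Nat.lt_succ_iff_lt_or_eq.1 hl with hl | hl
        · exact h3' _ (h3 l hl)
        · have : l = ⟨m, hm⟩ := Fin.ext hl
          rw [this]
          exact (hout.2.2 T hT).1
  refine ⟨fun k => L k, rfl, fun k => ⟨D k, hL k, fun T hT => ?_⟩, fun k T hT l hl => ?_⟩
  · obtain ⟨h1, h2, -⟩ := inv k k.2.le T hT
    exact (hD k T h1 (h2 k le_rfl)).1
  · exact (inv k (Nat.lt_succ_iff.1 k.2) T hT).2.2 l hl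

/-- Constant terms are additive and unique, so the choices made in a run cannot affect its sum. -/
lemma IsDecDenuRun.sumRat_eq (hh : ∀ k, 0 < h k) {M : Matrix (Fin n ⊕ Fin r) (Fin n ⊕ Unit) ℤ}
    {L : Fin (r + 1) → List (SignedTerm (Fin n ⊕ Fin r))} (hL : IsDecDenuRun j h M L)
    {E : Fin (r + 1) → RatFun (Fin n ⊕ Fin r)} (hE : IsIteratedCT j h M E) (k : Fin (r + 1)) :
    sumRat (L k) = E k := by
  induction k using Fin.induction with
  | zero => rw [hL.start, hE.1]; simp [sumRat]
  | succ k ih =>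
    obtain ⟨D, hLk, hD⟩ := hL.step k
    have h1 := isUnderlinedCT_list_sum (i := Sum.inr k) (μ := lamFactor j h k)
      (by rw [lamFactor_inr_self]; exact_mod_cast hh k) (L k.castSucc) toRat
      (fun T => sumRat (D T)) fun T hT => (hD T hT).2.1
    rw [hLk, sumRat_flatMap]
    have h2 := hE.2 k
    rw [← ih] at h2
    exact h1.unique h2

lemma IsDecDenuRun.length_den {M : Matrix (Fin n ⊕ Fin r) (Fin n ⊕ Unit) ℤ}
    {L : Fin (r + 1) → List (SignedTerm (Fin n ⊕ Fin r))} (hL : IsDecDenuRun j h M L)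
    (k : Fin (r + 1)) : ∀ T ∈ L k, T.den.length + k = n := by
  induction k using Fin.induction with
  | zero =>
    intro T hT
    rw [hL.start, List.mem_singleton] at hT
    simp [hT, ofMatrix]
  | succ k ih =>
    obtain ⟨D, hLk, hD⟩ := hL.step k
    intro T hT
    rw [hLk] at hT
    obtain ⟨T₀, hT₀, hT⟩ := List.mem_flatMap.1 hT
    have h1 := ih T₀ hT₀
    have h2 := ((hD T₀ hT₀).2.2 T hT).2.1
    simp at h1 ⊢
    omega

/-- This must hold for arbitrary runs, so it is drawn from the unimodularity of the outputs and not
from the construction above. -/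
lemma IsDecDenuRun.hasDual {M : Matrix (Fin n ⊕ Fin r) (Fin n ⊕ Unit) ℤ}
    {L : Fin (r + 1) → List (SignedTerm (Fin n ⊕ Fin r))} (hL : IsDecDenuRun j h M L)
    (hM : HasDual (ofMatrix M).den) (k : Fin (r + 1)) : ∀ T ∈ L k, HasDual T.den := by
  induction k using Fin.induction with
  | zero =>
    intro T hT
    rw [hL.start, List.mem_singleton] at hT
    rwa [hT]
  | succ k _ =>
    obtain ⟨D, hLk, hD⟩ := hL.step k
    intro T hT
    rw [hLk] at hT
    obtain ⟨T₀, hT₀, hT⟩ := List.mem_flatMap.1 hT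
    exact hasDual_of_isUnimodular ((hD T₀ hT₀).2.2 T hT).2.2

end Runs

/-! ### The term attached to the initial matrix. -/

section StartMatrix

open SignedTerm

variable {n r : ℕ}

/-- The exponent vector of the denominator factor of the column `c`. -/
def startCol (B : Matrix (Fin r) (Fin n) ℤ) (c : Fin n) : Fin n ⊕ Fin r → ℤ :=
  Sum.elim (Pi.single c 1) fun l => B l c

/-- The exponent vector of the numerator. -/
def startNum (n : ℕ) (β : Fin r → ℤ) : Fin n ⊕ Fin r → ℤ := Sum.elim 0 fun l => -β l

lemma ofMatrix_startMatrix (B : Matrix (Fin r) (Fin n) ℤ) (β : Fin r → ℤ) :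
    ofMatrix (startMatrix B β) = ⟨1, startNum n β, List.ofFn (startCol B)⟩ := by
  have h1 : (fun s => startMatrix B β s (Sum.inr ())) = startNum n β := by
    ext (p | l) <;> simp [startMatrix, startNum]
  have h2 : (fun c s => startMatrix B β s (Sum.inl c)) = startCol B := by
    ext c (p | l)
    · simp [startMatrix, startCol, Matrix.one_apply, Pi.single_apply]
    · simp [startMatrix, startCol]
  rw [ofMatrix, h1, h2]

/-- The identity block makes the coordinate functions of the `y`-variables a dual system. -/
lemma hasDual_ofFn_startCol (B : Matrix (Fin r) (Fin n) ℤ) :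
    HasDual (List.ofFn (startCol B)) := by
  have hinl : ∀ c d, startCol B c (Sum.inl d) = if d = c then 1 else 0 := by
    intro c d
    simp [startCol, Pi.single_apply]
  refine ⟨List.nodup_ofFn.2 fun c d hcd => ?_, fun γ hγ => ?_⟩
  · by_contra hne
    have := congrFun hcd (Sum.inl c)
    simp [hinl, hne] at this
  · obtain ⟨c, rfl⟩ := (List.mem_ofFn' _ _).1 hγ
    refine ⟨LinearMap.proj (Sum.inl c), by simp [hinl], fun γ' hγ' hne => ?_⟩
    obtain ⟨d, rfl⟩ := (List.mem_ofFn' _ _).1 hγ'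
    have : c ≠ d := by rintro rfl; exact hne rfl
    simp [hinl, this]

/-- The block of the columns in `J` is `diag(h)`. -/
def IsDiagOn (j : Fin r ↪ Fin n) (h : Fin r → ℕ) (B : Matrix (Fin r) (Fin n) ℤ) : Prop :=
  ∀ l k, B l (j k) = if l = k then (h k : ℤ) else 0

variable {j : Fin r ↪ Fin n} {h : Fin r → ℕ} {B : Matrix (Fin r) (Fin n) ℤ}

lemma IsDiagOn.startCol_eq (hB : IsDiagOn j h B) (k : Fin r) :
    startCol B (j k) = lamFactor j h k := by
  ext (p | l)
  · rfl
  · simp [startCol, lamFactor, hB l k, Pi.single_apply]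

end StartMatrix

/-! ### A closed form for the iterated constant term. -/

section IteratedCT

open SignedTerm

variable {n r : ℕ} {j : Fin r ↪ Fin n} {h : Fin r → ℕ} {B : Matrix (Fin r) (Fin n) ℤ}

/-- Elimination of `λ₁, …, λₘ` from a monomial by means of the relations
`λₖ ^ hₖ y_{jₖ} = 1`. -/
def elimExp (j : Fin r ↪ Fin n) (h : Fin r → ℕ) (m : ℕ) (γ : Fin n ⊕ Fin r → ℤ) :
    Fin n ⊕ Fin r → ℤ :=
  γ - ∑ l ∈ Finset.univ.filter (fun l : Fin r => (l : ℕ) < m), (γ (Sum.inr l) / h l) • lamFactor j h l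

lemma elimExp_zero (γ : Fin n ⊕ Fin r → ℤ) : elimExp j h 0 γ = γ := by simp [elimExp]

lemma elimExp_inr (m : ℕ) (γ : Fin n ⊕ Fin r → ℤ) (k : Fin r) (hk : m ≤ k) :
    elimExp j h m γ (Sum.inr k) = γ (Sum.inr k) := by
  rw [elimExp, Pi.sub_apply, Finset.sum_apply, Finset.sum_eq_zero, sub_zero]
  intro l hl
  rw [Finset.mem_filter] at hl
  have : k ≠ l := by rintro rfl; omega
  simp [lamFactor_inr_ne j h this]

lemma elimExp_succ (k : Fin r) (γ : Fin n ⊕ Fin r → ℤ) :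
    elimExp j h (k + 1) γ =
      elimExp j h k γ - (elimExp j h k γ (Sum.inr k) / h k) • lamFactor j h k := by
  classical
  rw [elimExp_inr _ _ _ le_rfl, elimExp, elimExp]
  have : (Finset.univ.filter fun l : Fin r => (l : ℕ) < k + 1) =
      insert k (Finset.univ.filter fun l : Fin r => (l : ℕ) < k) := by
    ext l
    simp [Fin.ext_iff]
    omega
  rw [this, Finset.sum_insert (by simp)]
  abel

lemma elimExp_last_inr (γ : Fin n ⊕ Fin r → ℤ) (k : Fin r) :
    elimExp j h r γ (Sum.inr k) = γ (Sum.inr k) % h k := by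
  rw [elimExp, Pi.sub_apply, Finset.sum_apply, Finset.sum_eq_single k]
  · rw [Pi.smul_apply, lamFactor_inr_self, smul_eq_mul, Int.emod_def, mul_comm]
  · intro l _ hl
    simp [lamFactor_inr_ne j h hl.symm]
  · simp

lemma elimExp_last_inl (γ : Fin n ⊕ Fin r → ℤ) (p : Fin n) :
    elimExp j h r γ (Sum.inl p) =
      γ (Sum.inl p) - ∑ l, γ (Sum.inr l) / h l * (if p = j l then 1 else 0) := by
  rw [elimExp, Pi.sub_apply, Finset.sum_apply]
  simp [lamFactor, Pi.single_apply]

/-- The exponent of the numerator monomial that arises by expanding the denominators of the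
columns outside `J`. -/
def expandedNum (B : Matrix (Fin r) (Fin n) ℤ) (β : Fin r → ℤ) (j : Fin r ↪ Fin n) {N : ℕ}
    (k : CoCols j → Fin N) : Fin n ⊕ Fin r → ℤ :=
  startNum n β + ∑ c, (k c : ℕ) • startCol B c

/-- The denominators after `m` constant terms. -/
def elimDen (B : Matrix (Fin r) (Fin n) ℤ) (j : Fin r ↪ Fin n) (h : Fin r → ℕ) (N : ℕ) (m : ℕ) :
    List (Fin n ⊕ Fin r → ℤ) :=
  (List.ofFn (lamFactor j h)).drop m ++
    (Finset.univ : Finset (CoCols j)).toList.map fun c : CoCols j => elimExp j h m (N • startCol B c)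

open scoped Classical in
/-- The explicit form of the iterated constant term after `m` steps. -/
def elimSum (B : Matrix (Fin r) (Fin n) ℤ) (β : Fin r → ℤ) (j : Fin r ↪ Fin n) (h : Fin r → ℕ)
    (N : ℕ) (m : ℕ) : RatFun (Fin n ⊕ Fin r) :=
  ∑ k : CoCols j → Fin N,
    if ∀ l : Fin r, (l : ℕ) < m → (h l : ℤ) ∣ expandedNum B β j k (Sum.inr l) then
      toRat ⟨1, elimExp j h m (expandedNum B β j k), elimDen B j h N m⟩ else 0

/-- Used with `N` a common multiple of the `h_k`: the new denominator has `λ`-exponents divisible by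
all of them. -/
lemma inv_one_sub_mono_eq {σ : Type} [Finite σ] {γ : σ → ℤ} (hγ : γ ≠ 0) {N : ℕ} (hN : 0 < N) :
    (1 - mono γ)⁻¹ = (∑ k : Fin N, mono ((k : ℕ) • γ)) * (1 - mono (N • γ))⁻¹ := by
  have h1 := one_sub_mono_ne_zero hγ
  have h2 : N • γ ≠ 0 := smul_ne_zero hN.ne' hγ
  rw [Fin.sum_univ_eq_sum_range fun k => mono (k • γ), eq_mul_inv_iff_mul_eq₀
    (one_sub_mono_ne_zero h2), mono_nsmul, ← geom_sum_mul_neg, mul_comm, mul_assoc,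
    mul_inv_cancel₀ h1, mul_one]
  simp only [mono_nsmul]

lemma elimSum_zero (hB : IsDiagOn j h B) (β : Fin r → ℤ) {N : ℕ} (hN : 0 < N) :
    elimSum B β j h N 0 = (ofMatrix (startMatrix B β)).toRat := by
  classical
  have hcol : ∀ c, startCol B c ≠ 0 := fun c hc => by
    have := congrFun hc (Sum.inl c)
    simp [startCol] at this
  have h1 : ∏ p : Fin n, (1 - mono (startCol B p))⁻¹ =
      (∏ l, (1 - mono (lamFactor j h l))⁻¹) * ∏ c : CoCols j, (1 - mono (startCol B c))⁻¹ := by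
    rw [← (colEquiv j).prod_comp, Fintype.prod_sum_type]
    congr 1
    · refine Finset.prod_congr rfl fun l _ => ?_
      rw [← hB.startCol_eq l]
      rfl
  have h2 : ∏ c : CoCols j, (1 - mono (startCol B c))⁻¹ =
      (∑ k : CoCols j → Fin N, mono (∑ c, (k c : ℕ) • startCol B c)) *
        ∏ c : CoCols j, (1 - mono (N • startCol B c))⁻¹ := by
    rw [Finset.prod_congr rfl fun (c : CoCols j) _ => inv_one_sub_mono_eq (hcol c) hN,
      Finset.prod_mul_distrib, Finset.prod_univ_sum, Fintype.piFinset_univ]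
    simp only [mono_sum]
  rw [ofMatrix_startMatrix, toRat_eq, elimSum, List.map_ofFn, List.prod_ofFn]
  simp only [Function.comp_def]
  rw [h1, h2, Finset.sum_mul, Finset.mul_sum, Finset.mul_sum]
  refine Finset.sum_congr rfl fun k _ => ?_
  rw [if_pos fun l hl => absurd hl (Nat.not_lt_zero _), toRat_eq, elimExp_zero, expandedNum,
    mono_add, elimDen]
  simp only [List.drop_zero, List.map_append, List.prod_append, List.map_ofFn, List.prod_ofFn,
    List.map_map, Function.comp_def, elimExp_zero, Finset.prod_map_toList]
  ring

/-- Since each `h_k` divides `N`, every summand falls under `isUnderlinedCT_of_dvd` at each step.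
Summands failing the divisibility test drop out, and the shifts add up to `elimExp`. -/
lemma isIteratedCT_elimSum (hh : ∀ k, 0 < h k) (hB : IsDiagOn j h B) (β : Fin r → ℤ) {N : ℕ}
    (hN : 0 < N) (hdvd : ∀ k, h k ∣ N) :
    IsIteratedCT j h (startMatrix B β) fun m => elimSum B β j h N m := by
  classical
  refine ⟨elimSum_zero hB β hN, fun k => ?_⟩
  have hμ : 0 < lamFactor j h k (Sum.inr k) := by
    rw [lamFactor_inr_self]
    exact_mod_cast hh k
  refine isUnderlinedCT_sum hμ _ _ _ fun t _ => ?_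
  set l := (List.ofFn (lamFactor j h)).drop (k + 1) ++
    (Finset.univ : Finset (CoCols j)).toList.map fun c : CoCols j => elimExp j h k (N • startCol B c) with hl
  have hden : elimDen B j h N k = lamFactor j h k :: l := by
    rw [elimDen, List.drop_eq_getElem_cons (by simp), hl]
    simp
  have hmem : ∀ γ ∈ l, (∃ m, k < m ∧ γ = lamFactor j h m) ∨
      ∃ c : CoCols j, γ = elimExp j h k (N • startCol B c) := by
    intro γ hγ
    rcases List.mem_append.1 hγ with hγ | hγ
    · left
      obtain ⟨m, hm, rfl⟩ := List.mem_drop_iff_getElem.1 hγ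
      simp only [List.length_ofFn] at hm
      refine ⟨⟨k + 1 + m, by omega⟩, ?_, by simp⟩
      rw [Fin.lt_def]
      simp
      omega
    · right
      obtain ⟨c, -, rfl⟩ := List.mem_map.1 hγ
      exact ⟨c, rfl⟩
  -- Each other factor involves some `y_{j_m}` with `m > k`, or some `y_c` with `c ∉ J`, and the
  -- underlined factor involves neither. This rules out proportionality.
  have hcoord : ∀ γ ∈ l, ∃ s, γ s ≠ 0 ∧ lamFactor j h k s = 0 := by
    intro γ hγ
    rcases hmem γ hγ with ⟨m, hkm, rfl⟩ | ⟨c, rfl⟩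
    · refine ⟨Sum.inl (j m), by simp [lamFactor], ?_⟩
      simp [lamFactor, j.injective.eq_iff, hkm.ne']
    · have hc : ∀ m, (c : Fin n) ≠ j m := fun m hm => c.2 ⟨m, hm.symm⟩
      refine ⟨Sum.inl c, ?_, ?_⟩
      · rw [elimExp, Pi.sub_apply, Finset.sum_apply, Finset.sum_eq_zero]
        · simp [startCol, hN.ne']
        · intro m _
          simp [lamFactor, hc m]
      · simp [lamFactor, hc k]
  have hprop : ∀ γ ∈ l, lamFactor j h k (Sum.inr k) • γ ≠ γ (Sum.inr k) • lamFactor j h k := by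
    intro γ hγ he
    obtain ⟨s, hs, hs'⟩ := hcoord γ hγ
    have := congrFun he s
    rw [Pi.smul_apply, Pi.smul_apply, hs', smul_zero, smul_eq_mul] at this
    exact (mul_ne_zero hμ.ne' hs) this
  have hd : ∀ γ ∈ l, lamFactor j h k (Sum.inr k) ∣ γ (Sum.inr k) := by
    intro γ hγ
    rw [lamFactor_inr_self]
    rcases hmem γ hγ with ⟨m, hkm, rfl⟩ | ⟨c, rfl⟩
    · rw [lamFactor_inr_ne j h hkm.ne]
      exact dvd_zero _
    · rw [elimExp_inr _ _ _ le_rfl, Pi.smul_apply, nsmul_eq_mul]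
      exact Dvd.dvd.mul_right (Int.natCast_dvd_natCast.2 (hdvd k)) _
  have hlmap : (l.map fun γ => γ - (γ (Sum.inr k) / lamFactor j h k (Sum.inr k)) •
      lamFactor j h k) = elimDen B j h N (k + 1) := by
    rw [hl, List.map_append, elimDen, List.map_map]
    congr 1
    · conv_rhs => rw [← List.map_id ((List.ofFn (lamFactor j h)).drop (k + 1))]
      refine List.map_congr_left fun γ hγ => ?_
      obtain ⟨m, hm, rfl⟩ := List.mem_drop_iff_getElem.1 hγ
      simp only [List.length_ofFn] at hm
      have : lamFactor j h ⟨k + 1 + m, by omega⟩ (Sum.inr k) = 0 :=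
        lamFactor_inr_ne j h (by rw [Ne, Fin.ext_iff]; simp; omega)
      simp [this]
    · refine List.map_congr_left fun c _ => ?_
      rw [Function.comp_apply, elimExp_succ, lamFactor_inr_self]
  have hct := isUnderlinedCT_of_dvd hμ 1 (elimExp j h k (expandedNum B β j t)) l hprop hd
  rw [← hden, hlmap, elimExp_inr _ _ _ le_rfl, lamFactor_inr_self] at hct
  have hexp := elimExp_succ (j := j) (h := h) k (expandedNum B β j t)
  rw [elimExp_inr _ _ _ le_rfl] at hexp
  rw [← hexp] at hct
  have hiff : (∀ m : Fin r, (m : ℕ) < k.succ → (h m : ℤ) ∣ expandedNum B β j t (Sum.inr m)) ↔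
      (∀ m : Fin r, (m : ℕ) < k.castSucc → (h m : ℤ) ∣ expandedNum B β j t (Sum.inr m)) ∧
        (h k : ℤ) ∣ expandedNum B β j t (Sum.inr k) := by
    refine ⟨fun H => ⟨fun m hm => H m (by simp at hm ⊢; omega), H k (by simp)⟩, fun H m hm => ?_⟩
    rcases Nat.lt_succ_iff_lt_or_eq.1 (show (m : ℕ) < k + 1 from hm) with hm | hm
    · exact H.1 m hm
    · rw [Fin.ext hm]
      exact H.2
  by_cases h1 : ∀ m : Fin r, (m : ℕ) < k.castSucc →
      (h m : ℤ) ∣ expandedNum B β j t (Sum.inr m)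
  · by_cases h2 : (h k : ℤ) ∣ expandedNum B β j t (Sum.inr k)
    · rw [if_pos h2] at hct
      rw [if_pos h1, if_pos (hiff.2 ⟨h1, h2⟩)]
      exact hct
    · rw [if_neg h2] at hct
      rw [if_pos h1, if_neg fun H => h2 (hiff.1 H).2]
      exact hct
  · rw [if_neg h1, if_neg fun H => h1 (hiff.1 H).1]
    exact isUnderlinedCT_of_isReg hμ isReg_zero

end IteratedCT

/-! ### Integral vectors among the rational ones. -/

section IntegerMonomials

variable {n : ℕ}

/-- The vector of rational numbers with the given integer entries. -/
def castVec (γ : Fin n → ℤ) : Fin n → ℚ := fun p => γ p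

lemma castVec_injective : Function.Injective (castVec (n := n)) := fun γ δ h => by
  ext p
  simpa [castVec] using congrFun h p

lemma intExp_eq (γ : Fin n → ℤ) : intExp γ = toLex (castVec γ) := rfl

open scoped Classical in
/-- The monomial `y ^ z` if `z` is integral, and zero otherwise. -/
def intMono (z : Fin n → ℚ) : LaurentPoly (Fin n) :=
  if z ∈ Set.range (castVec (n := n)) then AddMonoidAlgebra.single (fun p => (z p).num) 1 else 0

lemma intMono_castVec (γ : Fin n → ℤ) : intMono (castVec γ) = AddMonoidAlgebra.single γ 1 := by
  rw [intMono, if_pos ⟨γ, rfl⟩]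
  simp [castVec]

lemma intMono_of_notMem {z : Fin n → ℚ} (hz : z ∉ Set.range (castVec (n := n))) :
    intMono z = 0 := by
  rw [intMono, if_neg hz]

open scoped Classical in
lemma coeff_intMono (z : Fin n → ℚ) (γ : Fin n → ℤ) :
    (intMono z).coeff γ = if castVec γ = z then 1 else 0 := by
  by_cases hz : z ∈ Set.range (castVec (n := n))
  · obtain ⟨δ, rfl⟩ := hz
    rw [intMono_castVec, AddMonoidAlgebra.coeff_single, Finsupp.single_apply]
    simp [castVec_injective.eq_iff, eq_comm]
  · rw [intMono_of_notMem hz, if_neg fun h => hz ⟨γ, h⟩]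
    rfl

lemma castVec_mulVec (W : Matrix (Fin n) (Fin n) ℤ) (γ : Fin n → ℤ) :
    castVec (W *ᵥ γ) = W.map (Int.cast : ℤ → ℚ) *ᵥ castVec γ := by
  ext p
  simp [castVec, Matrix.mulVec, dotProduct]

lemma castVec_add (γ δ : Fin n → ℤ) : castVec (γ + δ) = castVec γ + castVec δ := by
  ext p
  simp [castVec]

lemma castVec_sub (γ δ : Fin n → ℤ) : castVec (γ - δ) = castVec γ - castVec δ := by
  ext p
  simp [castVec]

lemma mulVec_mem_range_castVec_iff (W : Matrix (Fin n) (Fin n) ℤ) (hW : IsUnit W.det)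
    (z : Fin n → ℚ) : W.map (Int.cast : ℤ → ℚ) *ᵥ z ∈ Set.range (castVec (n := n)) ↔
      z ∈ Set.range (castVec (n := n)) := by
  constructor
  · rintro ⟨γ, hγ⟩
    refine ⟨W⁻¹ *ᵥ γ, ?_⟩
    rw [castVec_mulVec, hγ, Matrix.mulVec_mulVec,
      show W⁻¹.map (Int.cast : ℤ → ℚ) * W.map (Int.cast : ℤ → ℚ) = 1 from ?_, Matrix.one_mulVec]
    rw [← Matrix.map_mul_intCast, Matrix.nonsing_inv_mul _ hW]
    simp
  · rintro ⟨γ, rfl⟩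
    exact ⟨W *ᵥ γ, castVec_mulVec W γ⟩

lemma mapDomain_intMono (W : Matrix (Fin n) (Fin n) ℤ) (hW : IsUnit W.det) (z : Fin n → ℚ) :
    AddMonoidAlgebra.mapDomainRingHom ℂ (mulVecHom W) (intMono z) =
      intMono (W.map (Int.cast : ℤ → ℚ) *ᵥ z) := by
  by_cases hz : z ∈ Set.range (castVec (n := n))
  · obtain ⟨γ, rfl⟩ := hz
    rw [← castVec_mulVec, intMono_castVec, intMono_castVec]
    simp [mulVecHom]
  · rw [intMono_of_notMem hz, intMono_of_notMem, map_zero]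
    rwa [mulVec_mem_range_castVec_iff W hW]

end IntegerMonomials

/-! ### The explicit rational function of a shifted cone. -/

section ConeFunction

variable {n : ℕ} {κ : Type}

/-- A product of denominator factors. -/
def coneDen (s : Finset κ) (G : κ → Fin n → ℤ) : LaurentPoly (Fin n) :=
  ∏ c ∈ s, (1 - AddMonoidAlgebra.single (G c) 1)

lemma coneDen_ne_zero (s : Finset κ) {G : κ → Fin n → ℤ} (hG : ∀ c, G c ≠ 0) :
    coneDen s G ≠ 0 := by
  rw [coneDen, Finset.prod_ne_zero_iff]
  intro c _ h
  rw [sub_eq_zero, AddMonoidAlgebra.one_def] at h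
  exact hG c ((AddMonoidAlgebra.single_left_inj one_ne_zero).1 h).symm

variable [Fintype κ]

/-- The point `v + ∑ k_c w_c`. -/
def conePoint (B : Matrix (Fin n) (κ ⊕ Unit) ℚ) (k : κ → ℕ) : Fin n → ℚ :=
  fun p => B p (Sum.inr ()) + ∑ c, (k c : ℚ) * B p (Sum.inl c)

open scoped Classical in
/-- The numerator of the generating function of the integer points of the form `v + ∑ k_c w_c`. -/
def coneNum (N : ℕ) (B : Matrix (Fin n) (κ ⊕ Unit) ℚ) : LaurentPoly (Fin n) :=
  ∑ k : κ → Fin N, intMono (conePoint B fun c => k c)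

/-- The generating function of the integer points of the form `v + ∑ k_c w_c`, where the integer
vectors `G_c` are `N w_c`. -/
def coneFun (N : ℕ) (B : Matrix (Fin n) (κ ⊕ Unit) ℚ) (G : κ → Fin n → ℤ) : RatFun (Fin n) :=
  algebraMap (LaurentPoly (Fin n)) (RatFun (Fin n)) (coneNum N B) /
    algebraMap (LaurentPoly (Fin n)) (RatFun (Fin n)) (coneDen Finset.univ G)

lemma conePoint_mul (W : Matrix (Fin n) (Fin n) ℚ) (B : Matrix (Fin n) (κ ⊕ Unit) ℚ)
    (k : κ → ℕ) : conePoint (W * B) k = W *ᵥ conePoint B k := by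
  ext p
  simp only [conePoint, Matrix.mul_apply, Matrix.mulVec, dotProduct, mul_add,
    Finset.sum_add_distrib, Finset.mul_sum]
  congr 1
  rw [Finset.sum_comm]
  exact Finset.sum_congr rfl fun p _ => Finset.sum_congr rfl fun c _ => by ring

/-- A unimodular matrix preserves integrality in both directions, so selecting integer points
commutes with it. -/
lemma matAct_coneFun (W : Matrix (Fin n) (Fin n) ℤ) (hW : IsUnit W.det) (hW' : W.det ≠ 0) (N : ℕ)
    (B : Matrix (Fin n) (κ ⊕ Unit) ℚ) (G : κ → Fin n → ℤ) :
    matAct W hW' (coneFun N B G) =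
      coneFun N (W.map (Int.cast : ℤ → ℚ) * B) fun c => W *ᵥ G c := by
  rw [coneFun, map_div₀, matAct, monoSubst_algebraMap, monoSubst_algebraMap, coneFun]
  congr 2
  · rw [coneNum, map_sum, coneNum]
    exact Finset.sum_congr rfl fun k _ => by rw [mapDomain_intMono W hW, conePoint_mul]
  · rw [coneDen, map_prod, coneDen]
    refine Finset.prod_congr rfl fun c _ => ?_
    rw [map_sub, map_one]
    simp [mulVecHom]

lemma algebraMap_coneDen (G : κ → Fin n → ℤ) :
    algebraMap (LaurentPoly (Fin n)) (RatFun (Fin n)) (coneDen Finset.univ G) =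
      ∏ c, (1 - mono (G c)) := by
  simp [coneDen, mono]

end ConeFunction

/-! ### Series expansion and the operator `𝒵`. -/

section Expansion

variable {n : ℕ}

lemma laurentToSeries_single (γ : Fin n → ℤ) (a : ℂ) :
    laurentToSeries n (AddMonoidAlgebra.single γ a) = HahnSeries.single (intExp γ) a := by
  simp only [laurentToSeries, RingHom.coe_coe, AddMonoidAlgebra.lift_single]
  rw [← HahnSeries.single_zero_mul_eq_smul]
  simp

lemma fmono_castVec (γ : Fin n → ℤ) :
    fmono (castVec γ) = laurentToSeries n (AddMonoidAlgebra.single γ 1) := by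
  rw [laurentToSeries_single]
  rfl

lemma fmono_add (x y : Fin n → ℚ) : fmono (x + y) = fmono x * fmono y := by
  simp [fmono]

lemma fmono_zero : fmono (0 : Fin n → ℚ) = 1 := rfl

lemma fmono_nsmul (k : ℕ) (x : Fin n → ℚ) : fmono (k • x) = fmono x ^ k := by
  induction k with
  | zero => simp [fmono_zero]
  | succ k ih => rw [succ_nsmul, fmono_add, ih, pow_succ]

lemma fmono_sum {ι : Type*} (s : Finset ι) (x : ι → Fin n → ℚ) :
    fmono (∑ c ∈ s, x c) = ∏ c ∈ s, fmono (x c) := by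
  classical
  induction s using Finset.induction_on with
  | empty => simp [fmono_zero]
  | insert c s hc ih => rw [Finset.sum_insert hc, Finset.prod_insert hc, fmono_add, ih]

lemma one_sub_fmono_ne_zero {x : Fin n → ℚ} (hx : x ≠ 0) : (1 - fmono x : FracSeries n) ≠ 0 := by
  intro h
  rw [sub_eq_zero] at h
  have h1 := congrArg (fun F : FracSeries n => F.coeff 0) h
  have h2 : (0 : Lex (Fin n → ℚ)) ≠ toLex x := fun h => hx (toLex.injective h.symm)
  simp [fmono, HahnSeries.coeff_single_of_ne h2] at h1

open scoped Classical in
lemma zOp_coeff (F : FracSeries n) (κ : Lex (Fin n → ℚ)) :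
    (zOp F).coeff κ = if κ ∈ Set.range (intExp (n := n)) then F.coeff κ else 0 := rfl

lemma zOp_add (F G : FracSeries n) : zOp (F + G) = zOp F + zOp G := by
  ext κ
  rw [HahnSeries.coeff_add, zOp_coeff, zOp_coeff, zOp_coeff, HahnSeries.coeff_add]
  split_ifs <;> simp

lemma zOp_zero : zOp (0 : FracSeries n) = 0 := by
  ext κ
  rw [zOp_coeff]
  simp

lemma zOp_sum {ι : Type*} (s : Finset ι) (F : ι → FracSeries n) :
    zOp (∑ c ∈ s, F c) = ∑ c ∈ s, zOp (F c) := by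
  classical
  induction s using Finset.induction_on with
  | empty => simp [zOp_zero]
  | insert c s hc ih => rw [Finset.sum_insert hc, Finset.sum_insert hc, zOp_add, ih]

/-- Shifting by an integer vector does not change integrality of an exponent. -/
lemma zOp_laurentToSeries_mul (q : LaurentPoly (Fin n)) (F : FracSeries n) :
    zOp (laurentToSeries n q * F) = laurentToSeries n q * zOp F := by
  induction q using AddMonoidAlgebra.induction_linear with
  | zero => simp [zOp_zero]
  | add p q hp hq => rw [map_add, add_mul, zOp_add, hp, hq, add_mul]
  | single γ a =>
    rw [laurentToSeries_single]
    ext κ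
    obtain ⟨κ, rfl⟩ : ∃ κ', κ = κ' + intExp γ := ⟨κ - intExp γ, by simp⟩
    rw [zOp_coeff, HahnSeries.coeff_single_mul_add, HahnSeries.coeff_single_mul_add, zOp_coeff]
    have : κ + intExp γ ∈ Set.range (intExp (n := n)) ↔ κ ∈ Set.range (intExp (n := n)) := by
      constructor
      · rintro ⟨δ, hδ⟩
        exact ⟨δ - γ, by rw [intExp_eq, castVec_sub, toLex_sub, ← intExp_eq, ← intExp_eq, hδ,
          add_sub_cancel_right]⟩
      · rintro ⟨δ, rfl⟩
        exact ⟨δ + γ, by rw [intExp_eq, castVec_add, toLex_add]; rfl⟩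
    by_cases hκ : κ ∈ Set.range (intExp (n := n))
    · rw [if_pos hκ, if_pos (this.2 hκ)]
    · rw [if_neg hκ, if_neg fun h => hκ (this.1 h), mul_zero]

lemma zOp_fmono (z : Fin n → ℚ) : zOp (fmono z) = laurentToSeries n (intMono z) := by
  classical
  ext κ
  rw [zOp_coeff]
  by_cases hz : z ∈ Set.range (castVec (n := n))
  · obtain ⟨γ, rfl⟩ := hz
    rw [intMono_castVec, laurentToSeries_single, fmono, ← intExp_eq, ite_eq_left_iff]
    intro hκ
    rw [HahnSeries.coeff_single_of_ne]
    rintro rfl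
    exact hκ ⟨γ, rfl⟩
  · rw [intMono_of_notMem hz, map_zero, HahnSeries.coeff_zero, ite_eq_right_iff]
    rintro ⟨γ, rfl⟩
    rw [fmono, HahnSeries.coeff_single_of_ne]
    intro h
    exact hz ⟨γ, toLex.injective h⟩

lemma expandSeries_div (p q : LaurentPoly (Fin n)) :
    expandSeries n (algebraMap _ (RatFun (Fin n)) p / algebraMap _ (RatFun (Fin n)) q) =
      laurentToSeries n p / laurentToSeries n q := by
  rw [map_div₀, expandSeries, IsFractionRing.lift_algebraMap, IsFractionRing.lift_algebraMap]

/-- Multiplying `[B]` by `∏ (1 - y^{N w_c})` leaves a finite sum of fractional monomials, on which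
`𝒵` acts term by term; the factor is a Laurent polynomial and passes through `𝒵`. -/
lemma expandSeries_coneFun {κ : Type} [Fintype κ] (N : ℕ)
    (B : Matrix (Fin n) (κ ⊕ Unit) ℚ) (G : κ → Fin n → ℤ)
    (hG : ∀ c, castVec (G c) = N • fun p => B p (Sum.inl c)) (hG0 : ∀ c, G c ≠ 0) :
    expandSeries n (coneFun N B G) = zOp (eratSeries B) := by
  classical
  set w : κ → Fin n → ℚ := fun c p => B p (Sum.inl c)
  have hw : ∀ c, w c ≠ 0 := fun c hc => hG0 c (castVec_injective (by
    rw [hG c, show (fun p => B p (Sum.inl c)) = w c from rfl, hc, smul_zero]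
    ext p
    simp [castVec]))
  have hden : laurentToSeries n (coneDen Finset.univ G) = ∏ c, (1 - fmono (w c) ^ N) := by
    rw [coneDen, map_prod]
    refine Finset.prod_congr rfl fun c _ => ?_
    rw [map_sub, map_one, ← fmono_castVec, hG, fmono_nsmul]
  have h0 : laurentToSeries n (coneDen Finset.univ G) ≠ 0 := by
    rw [Ne, map_eq_zero_iff _ (laurentToSeries_injective n)]
    exact coneDen_ne_zero _ hG0
  rw [coneFun, expandSeries_div, div_eq_iff h0, mul_comm, ← zOp_laurentToSeries_mul]
  have h1 : laurentToSeries n (coneDen Finset.univ G) * eratSeries B =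
      ∑ k : κ → Fin N, fmono (conePoint B fun c => k c) := by
    have h2 : ∀ k : κ → Fin N, fmono (conePoint B fun c => k c) =
        fmono (fun p => B p (Sum.inr ())) * ∏ c, fmono (w c) ^ (k c : ℕ) := by
      intro k
      rw [← Finset.prod_congr rfl fun c _ => fmono_nsmul (k c : ℕ) (w c), ← fmono_sum, ← fmono_add]
      congr 1
      ext p
      simp [conePoint, w, Finset.sum_apply]
    simp only [h2]
    rw [← Finset.mul_sum, hden, eratSeries]
    have h3 : ∑ k : κ → Fin N, ∏ c, fmono (w c) ^ (k c : ℕ) =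
        ∏ c, ∑ k : Fin N, fmono (w c) ^ (k : ℕ) := by
      rw [Finset.prod_univ_sum, Fintype.piFinset_univ]
    rw [h3, mul_div_assoc', div_eq_iff (Finset.prod_ne_zero_iff.2 fun c _ =>
      one_sub_fmono_ne_zero (hw c)), mul_assoc, ← Finset.prod_mul_distrib, mul_comm]
    congr 1
    refine Finset.prod_congr rfl fun c _ => ?_
    rw [Fin.sum_univ_eq_sum_range fun k => fmono (w c) ^ k, geom_sum_mul_neg]
  rw [h1, zOp_sum, coneNum, map_sum]
  exact Finset.sum_congr rfl fun k _ => (zOp_fmono _).symm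

end Expansion

/-! ### Lattice points of a shifted cone with integral dual functionals. -/

section GeneratingFunction

variable {n : ℕ} {κ : Type} [Fintype κ]

/-- The product of a Laurent polynomial and a formal series. -/
def convSeries (q : LaurentPoly (Fin n)) (φ : (Fin n → ℤ) → ℂ) (γ : Fin n → ℤ) : ℂ :=
  q.coeff.sum fun α a => a * φ (γ - α)

lemma convSeries_add (p q : LaurentPoly (Fin n)) (φ : (Fin n → ℤ) → ℂ) (γ : Fin n → ℤ) :
    convSeries (p + q) φ γ = convSeries p φ γ + convSeries q φ γ := by
  rw [convSeries, AddMonoidAlgebra.coeff_add, Finsupp.sum_add_index']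
  · rfl
  · simp
  · intros
    ring

lemma convSeries_single (δ : Fin n → ℤ) (a : ℂ) (φ : (Fin n → ℤ) → ℂ) (γ : Fin n → ℤ) :
    convSeries (AddMonoidAlgebra.single δ a) φ γ = a * φ (γ - δ) := by
  rw [convSeries, AddMonoidAlgebra.coeff_single, Finsupp.sum_single_index]
  simp

lemma convSeries_one (φ : (Fin n → ℤ) → ℂ) (γ : Fin n → ℤ) : convSeries 1 φ γ = φ γ := by
  rw [AddMonoidAlgebra.one_def, convSeries_single, one_mul, sub_zero]

lemma convSeries_single_mul (δ : Fin n → ℤ) (a : ℂ) (q : LaurentPoly (Fin n))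
    (φ : (Fin n → ℤ) → ℂ) (γ : Fin n → ℤ) :
    convSeries (AddMonoidAlgebra.single δ a * q) φ γ = a * convSeries q φ (γ - δ) := by
  induction q using AddMonoidAlgebra.induction_linear with
  | zero => simp [convSeries]
  | add p q hp hq => rw [mul_add, convSeries_add, hp, hq, convSeries_add, mul_add]
  | single α b =>
    rw [AddMonoidAlgebra.single_mul_single, convSeries_single, convSeries_single, mul_assoc,
      sub_add_eq_sub_sub]

lemma convSeries_one_sub_single_mul (δ : Fin n → ℤ) (q : LaurentPoly (Fin n))
    (φ : (Fin n → ℤ) → ℂ) (γ : Fin n → ℤ) :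
    convSeries ((1 - AddMonoidAlgebra.single δ 1) * q) φ γ =
      convSeries q φ γ - convSeries q φ (γ - δ) := by
  have : (1 - AddMonoidAlgebra.single δ 1 : LaurentPoly (Fin n)) * q =
      q + AddMonoidAlgebra.single δ (-1) * q := by
    rw [AddMonoidAlgebra.single_neg]
    ring
  rw [this, convSeries_add, convSeries_single_mul]
  ring

open scoped Classical in
/-- Integer functionals that are dual to the generators of the cone and integral at its vertex. -/
def IsConeDual (ρ : κ → Fin n → ℤ) (B : Matrix (Fin n) (κ ⊕ Unit) ℚ) : Prop :=
  (∀ c d, ∑ p, (ρ c p : ℚ) * B p (Sum.inl d) = if c = d then 1 else 0) ∧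
    ∀ c, ∃ m : ℤ, ∑ p, (ρ c p : ℚ) * B p (Sum.inr ()) = m

lemma IsConeDual.eq_coeff {ρ : κ → Fin n → ℤ} {B : Matrix (Fin n) (κ ⊕ Unit) ℚ}
    (h : IsConeDual ρ B) {k : κ → ℕ} {x : Fin n → ℚ} (hx : x = conePoint B k) (c : κ) :
    (k c : ℚ) = ∑ p, (ρ c p : ℚ) * (x p - B p (Sum.inr ())) := by
  classical
  have : ∀ p, (ρ c p : ℚ) * (x p - B p (Sum.inr ())) =
      ∑ d, (k d : ℚ) * ((ρ c p : ℚ) * B p (Sum.inl d)) := by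
    intro p
    rw [hx, conePoint, add_sub_cancel_left, Finset.mul_sum]
    exact Finset.sum_congr rfl fun d _ => by ring
  simp only [this]
  rw [Finset.sum_comm]
  simp only [← Finset.mul_sum, h.1]
  simp

lemma IsConeDual.injective {ρ : κ → Fin n → ℤ} {B : Matrix (Fin n) (κ ⊕ Unit) ℚ}
    (h : IsConeDual ρ B) : Function.Injective (conePoint B) := by
  intro k k' hk
  ext c
  have h1 := h.eq_coeff rfl c (k := k)
  have h2 := h.eq_coeff hk c (k := k')
  exact_mod_cast h1.trans h2.symm

/-- An integer functional dual to the generators, integral at the vertex, evaluates at a lattice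
point to an integer plus `k c`. Nonnegative real coefficients are therefore natural numbers. -/
lemma IsConeDual.mem_shiftedCone_iff {ρ : κ → Fin n → ℤ} {B : Matrix (Fin n) (κ ⊕ Unit) ℚ}
    (h : IsConeDual ρ B) (γ : Fin n → ℤ) :
    (fun p => (γ p : ℝ)) ∈ shiftedCone B ↔ ∃ k : κ → ℕ, castVec γ = conePoint B k := by
  classical
  constructor
  · rintro ⟨k, hk0, hk⟩
    beta_reduce at hk
    have hint : ∀ c, ∃ m : ℕ, k c = m := by
      intro c
      obtain ⟨m, hm⟩ := h.2 c
      have h1 : k c = ((∑ p, ρ c p * γ p - m : ℤ) : ℝ) := by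
        have h2 : ∀ p, (ρ c p : ℝ) * γ p = (ρ c p : ℝ) * ((B p (Sum.inr ()) : ℚ) : ℝ) +
            ∑ d, k d * ((ρ c p : ℝ) * ((B p (Sum.inl d) : ℚ) : ℝ)) := by
          intro p
          rw [hk p, mul_add, Finset.mul_sum]
          congr 1
          exact Finset.sum_congr rfl fun d _ => by ring
        have h3 : ∀ d, ∑ p, (ρ c p : ℝ) * ((B p (Sum.inl d) : ℚ) : ℝ) = if c = d then 1 else 0 := by
          intro d
          have := congrArg (Rat.cast : ℚ → ℝ) (h.1 c d)
          push_cast at this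
          rw [this]
          split_ifs <;> simp
        have h4 : ∑ p, (ρ c p : ℝ) * ((B p (Sum.inr ()) : ℚ) : ℝ) = m := by
          have := congrArg (Rat.cast : ℚ → ℝ) hm
          push_cast at this
          exact this
        push_cast
        rw [Finset.sum_congr rfl fun p _ => h2 p, Finset.sum_add_distrib, h4, Finset.sum_comm]
        simp only [← Finset.mul_sum, h3]
        simp
      have h5 : (0 : ℤ) ≤ ∑ p, ρ c p * γ p - m := by
        have := hk0 c
        rw [h1] at this
        exact_mod_cast this
      obtain ⟨m', hm'⟩ := Int.eq_ofNat_of_zero_le h5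
      exact ⟨m', by rw [h1, hm']; simp⟩
    choose k' hk' using hint
    refine ⟨k', ?_⟩
    ext p
    have := hk p
    simp only [hk'] at this
    rw [castVec, conePoint]
    exact_mod_cast this
  · rintro ⟨k, hk⟩
    refine ⟨fun c => k c, fun c => Nat.cast_nonneg _, fun p => ?_⟩
    have := congrFun hk p
    rw [castVec, conePoint] at this
    beta_reduce
    exact_mod_cast this

lemma conePoint_add_single [DecidableEq κ] (B : Matrix (Fin n) (κ ⊕ Unit) ℚ) (k : κ → ℕ) (c : κ)
    (N : ℕ) : conePoint B (k + Pi.single c N) = conePoint B k + N • fun p => B p (Sum.inl c) := by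
  ext p
  simp only [conePoint, Pi.add_apply, Nat.cast_add, add_mul, Finset.sum_add_distrib, ← add_assoc]
  congr 1
  rw [Finset.sum_eq_single c]
  · simp
  · intro d _ hd
    simp [hd]
  · simp

open scoped Classical in
/-- The indicator function of the integer points `v + ∑ k_c w_c` with `k_c < N` for `c ∈ s`. -/
def boxIndicator (N : ℕ) (B : Matrix (Fin n) (κ ⊕ Unit) ℚ) (s : Finset κ) (γ : Fin n → ℤ) : ℂ :=
  if ∃ k : κ → ℕ, (∀ c ∈ s, k c < N) ∧ castVec γ = conePoint B k then 1 else 0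

/-- Each factor `1 - y^{G c}` subtracts the copy translated by `N w_c`, which consists of the points
with `k c ≥ N`. Uniqueness of the coefficients makes this exact. -/
lemma convSeries_coneDen {ρ : κ → Fin n → ℤ} {B : Matrix (Fin n) (κ ⊕ Unit) ℚ}
    (h : IsConeDual ρ B) (N : ℕ) (G : κ → Fin n → ℤ)
    (hG : ∀ c, castVec (G c) = N • fun p => B p (Sum.inl c)) (s : Finset κ) (γ : Fin n → ℤ) :
    convSeries (coneDen s G) (boxIndicator N B ∅) γ = boxIndicator N B s γ := by
  classical
  induction s using Finset.induction_on generalizing γ with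
  | empty => rw [coneDen, Finset.prod_empty, convSeries_one]
  | insert c s hc ih =>
    rw [coneDen, Finset.prod_insert hc, convSeries_one_sub_single_mul, ← coneDen, ih, ih]
    have hshift : ∀ k : κ → ℕ, castVec (γ - G c) = conePoint B k ↔
        castVec γ = conePoint B (k + Pi.single c N) := by
      intro k
      rw [conePoint_add_single, castVec_sub, hG, sub_eq_iff_eq_add]
    have hins : ∀ k : κ → ℕ, (∀ d ∈ insert c s, k d < N) ↔ k c < N ∧ ∀ d ∈ s, k d < N :=
      fun k => Finset.forall_mem_insert _ _ _
    have hbox : ∀ k : κ → ℕ, (∀ d ∈ s, (k + Pi.single c N : κ → ℕ) d < N) ↔ ∀ d ∈ s, k d < N := by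
      intro k
      refine forall₂_congr fun d hd => ?_
      have : d ≠ c := by rintro rfl; exact hc hd
      simp [this]
    rw [boxIndicator, boxIndicator, boxIndicator]
    by_cases h1 : ∃ k : κ → ℕ, (∀ d ∈ s, k d < N) ∧ castVec γ = conePoint B k
    · obtain ⟨k, hk, hγ⟩ := h1
      by_cases hkc : k c < N
      · rw [if_pos ⟨k, hk, hγ⟩, if_neg, if_pos ⟨k, (hins k).2 ⟨hkc, hk⟩, hγ⟩, sub_zero]
        rintro ⟨k', -, hk'⟩
        have := h.injective (hγ.symm.trans ((hshift k').1 hk'))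
        rw [this] at hkc
        simp at hkc
      · have hkk : k - Pi.single c N + Pi.single c N = k := by
          ext d
          by_cases hd : d = c
          · subst hd
            simp
            omega
          · simp [hd]
        rw [if_pos ⟨k, hk, hγ⟩, if_pos, if_neg, sub_self]
        · rintro ⟨k', hk', hγ'⟩
          rw [h.injective (hγ.symm.trans hγ')] at hkc
          exact hkc (hk' c (Finset.mem_insert_self c s))
        · exact ⟨k - Pi.single c N, (hbox _).1 (by rwa [hkk]), (hshift _).2 (by rwa [hkk])⟩
    · rw [if_neg h1, if_neg, if_neg, sub_zero]
      · rintro ⟨k, hk, hγ⟩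
        exact h1 ⟨k, ((hins k).1 hk).2, hγ⟩
      · rintro ⟨k, hk, hγ⟩
        exact h1 ⟨_, (hbox k).2 hk, (hshift k).1 hγ⟩

lemma coeff_coneNum {ρ : κ → Fin n → ℤ} {B : Matrix (Fin n) (κ ⊕ Unit) ℚ} (h : IsConeDual ρ B)
    (N : ℕ) (γ : Fin n → ℤ) : (coneNum N B).coeff γ = boxIndicator N B Finset.univ γ := by
  classical
  rw [coneNum, AddMonoidAlgebra.coeff_sum, Finsupp.finsetSum_apply]
  simp only [coeff_intMono]
  rw [boxIndicator]
  by_cases h1 : ∃ k : κ → ℕ, (∀ c ∈ Finset.univ, k c < N) ∧ castVec γ = conePoint B k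
  · obtain ⟨k, hk, hγ⟩ := h1
    rw [if_pos ⟨k, hk, hγ⟩, Finset.sum_eq_single fun c => ⟨k c, hk c (Finset.mem_univ c)⟩]
    · rw [if_pos hγ]
    · intro k' _ hk'
      rw [if_neg]
      intro hγ'
      apply hk'
      ext c
      exact congrFun (h.injective (hγ'.symm.trans hγ)) c
    · simp
  · rw [if_neg h1]
    refine Finset.sum_eq_zero fun k _ => if_neg fun hk => ?_
    exact h1 ⟨fun c => k c, fun c _ => (k c).2, hk⟩

lemma isGenFun_coneFun {ρ : κ → Fin n → ℤ} {B : Matrix (Fin n) (κ ⊕ Unit) ℚ}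
    (h : IsConeDual ρ B) (N : ℕ) (G : κ → Fin n → ℤ)
    (hG : ∀ c, castVec (G c) = N • fun p => B p (Sum.inl c)) (hG0 : ∀ c, G c ≠ 0) :
    IsGenFun (shiftedCone B) (coneFun N B G) := by
  classical
  refine ⟨coneNum N B, coneDen Finset.univ G, coneDen_ne_zero _ hG0, fun γ => ?_, rfl⟩
  rw [coeff_coneNum h, ← convSeries_coneDen h N G hG, convSeries, Finsupp.sum]
  refine Finset.sum_congr rfl fun α _ => ?_
  rw [latticeCoeff, boxIndicator]
  congr 1
  simp only [h.mem_shiftedCone_iff, Finset.notMem_empty, false_implies, implies_true, true_and]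

end GeneratingFunction

/-! ### Generating functions of unimodular cones. -/

section UnimodularCone

variable {n : ℕ}

open SignedTerm

lemma exists_isConeDual_coneMatrix {T : SignedTerm (Fin n)} (hT : HasDual T.den) :
    ∃ ρ, IsConeDual ρ T.coneMatrix := by
  classical
  have hdual : ∀ c : Fin T.den.length, ∃ φ : (Fin n → ℤ) →ₗ[ℤ] ℤ,
      ∀ d, φ (T.den.get d) = if c = d then 1 else 0 := by
    intro c
    obtain ⟨φ, h1, h2⟩ := hT.2 (T.den.get c) (List.get_mem _ _)
    refine ⟨φ, fun d => ?_⟩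
    by_cases hcd : c = d
    · rw [if_pos hcd, ← hcd, h1]
    · rw [if_neg hcd, h2 _ (List.get_mem _ _)]
      exact fun he => hcd (List.nodup_iff_injective_get.1 hT.1 he).symm
  choose φ hφ using hdual
  have hsum : ∀ c (x : Fin n → ℤ), ∑ p, φ c (Pi.single p 1) * x p = φ c x := by
    intro c x
    conv_rhs => rw [pi_eq_sum_univ' x, map_sum]
    refine Finset.sum_congr rfl fun p _ => ?_
    rw [map_smul, smul_eq_mul, mul_comm]
  refine ⟨fun c p => φ c (Pi.single p 1), fun c d => ?_, fun c => ⟨φ c T.num, ?_⟩⟩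
  · have := hsum c (T.den.get d)
    rw [hφ] at this
    simp only [coneMatrix, Matrix.of_apply, Sum.elim_inl]
    have h2 := congrArg (Int.cast : ℤ → ℚ) this
    push_cast at h2
    convert h2
  · simp only [coneMatrix, Matrix.of_apply, Sum.elim_inr]
    rw [← hsum c T.num]
    push_cast
    rfl

/-- With `N = 1` the box contains only `k = 0`, so the numerator is the vertex monomial. -/
lemma coneFun_coneMatrix (T : SignedTerm (Fin n)) : coneFun 1 T.coneMatrix T.den.get = T.frac := by
  rw [coneFun, algebraMap_coneDen, frac]
  have h1 : coneNum 1 T.coneMatrix = AddMonoidAlgebra.single T.num 1 := by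
    rw [coneNum, Finset.sum_eq_single (fun _ => 0), ← intMono_castVec]
    · congr 1
      ext p
      simp [conePoint, coneMatrix, castVec]
    · exact fun k _ hk => absurd (Subsingleton.elim _ _) hk
    · simp
  have h2 : ∏ c, (1 - mono (T.den.get c)) = (T.den.map fun γ => 1 - mono γ).prod := by
    conv_rhs => rw [← List.ofFn_get T.den, List.map_ofFn, List.prod_ofFn]
    rfl
  rw [h1, h2]
  rfl

lemma isGenFun_frac {T : SignedTerm (Fin n)} (hT : HasDual T.den) :
    IsGenFun (shiftedCone T.coneMatrix) T.frac := by
  obtain ⟨ρ, hρ⟩ := exists_isConeDual_coneMatrix hT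
  rw [← coneFun_coneMatrix]
  refine isGenFun_coneFun hρ 1 _ (fun c => ?_) fun c h0 => ?_
  · ext p
    simp [castVec, coneMatrix]
  · obtain ⟨φ, h1, -⟩ := hT.2 (T.den.get c) (List.get_mem _ _)
    rw [h0, map_zero] at h1
    exact zero_ne_one h1

end UnimodularCone

/-! ### Existence of the Smith normal form over `ℤ`. -/

section SmithNormalForm

/-- Equivalence of integer matrices under multiplication by unimodular matrices on both sides. -/
def IsUnimodEquiv {r : ℕ} (A B : Matrix (Fin r) (Fin r) ℤ) : Prop :=
  ∃ U V : Matrix (Fin r) (Fin r) ℤ, IsUnit U.det ∧ IsUnit V.det ∧ B = U * A * V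

variable {r : ℕ} {A B : Matrix (Fin r) (Fin r) ℤ}

lemma IsUnimodEquiv.refl (A : Matrix (Fin r) (Fin r) ℤ) : IsUnimodEquiv A A :=
  ⟨1, 1, by simp, by simp, by simp⟩

lemma IsUnimodEquiv.mul (h : IsUnimodEquiv A B) {U V : Matrix (Fin r) (Fin r) ℤ}
    (hU : IsUnit U.det) (hV : IsUnit V.det) : IsUnimodEquiv A (U * B * V) := by
  obtain ⟨U', V', hU', hV', rfl⟩ := h
  refine ⟨U * U', V' * V, ?_, ?_, by simp only [Matrix.mul_assoc]⟩
  · rw [Matrix.det_mul]; exact hU.mul hU'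
  · rw [Matrix.det_mul]; exact hV'.mul hV

lemma IsUnimodEquiv.neg (h : IsUnimodEquiv A B) : IsUnimodEquiv A (-B) := by
  have := h.mul (U := -1) (V := 1) (by
    rw [Matrix.det_neg, Matrix.det_one, mul_one]
    exact isUnit_one.neg.pow _) (by simp)
  simpa using this

lemma IsUnimodEquiv.submatrix (h : IsUnimodEquiv A B) (e f : Equiv.Perm (Fin r)) :
    IsUnimodEquiv A (B.submatrix e f) := by
  have h1 : ∀ e : Equiv.Perm (Fin r), IsUnit (e.permMatrix ℤ).det := fun e => by
    rw [Matrix.det_permutation]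
    exact (Equiv.Perm.sign e).isUnit
  have := h.mul (h1 e) (h1 f⁻¹)
  rw [Equiv.Perm.permMatrix, Equiv.Perm.permMatrix, PEquiv.toMatrix_toPEquiv_mul,
    PEquiv.mul_toMatrix_toPEquiv] at this
  exact this

lemma IsUnimodEquiv.mul_transvection (h : IsUnimodEquiv A B) {a b : Fin r} (hab : a ≠ b) (c : ℤ) :
    IsUnimodEquiv A (B * transvection a b c) := by
  have := h.mul (U := 1) (V := transvection a b c) (by simp) (by simp [hab])
  simpa using this

lemma IsUnimodEquiv.transvection_mul (h : IsUnimodEquiv A B) {a b : Fin r} (hab : a ≠ b) (c : ℤ) :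
    IsUnimodEquiv A (transvection a b c * B) := by
  have := h.mul (U := transvection a b c) (V := 1) (by simp [hab]) (by simp)
  simpa using this

/-- The block matrix with first row `(1, 0)`, first column `(1, q)` and lower right block `U`. -/
def lowerBlock (q : Fin r → ℤ) (U : Matrix (Fin r) (Fin r) ℤ) :
    Matrix (Fin (r + 1)) (Fin (r + 1)) ℤ :=
  Matrix.of (Fin.cons (Fin.cons 1 0) fun i => Fin.cons (q i) (U i))

lemma lowerBlock_det (q : Fin r → ℤ) (U : Matrix (Fin r) (Fin r) ℤ) :
    (lowerBlock q U).det = U.det := by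
  rw [Matrix.det_succ_row_zero, Fin.sum_univ_succ, Finset.sum_eq_zero]
  · have : (lowerBlock q U).submatrix Fin.succ (Fin.succAbove 0) = U := by
      ext i k
      simp [lowerBlock]
    rw [this]
    simp [lowerBlock]
  · intro k _
    simp [lowerBlock]

/-- Take the least positive entry `m` occurring in any matrix equivalent to `A`. Division with
remainder shows that, once in the corner, `m` divides its row and column; after clearing these it
also divides the remaining block, to which induction applies. -/
lemma exists_smith_diagonal : ∀ (r : ℕ) (A : Matrix (Fin r) (Fin r) ℤ), ∃ h : Fin r → ℕ,
    IsUnimodEquiv A (Matrix.diagonal fun k => (h k : ℤ)) ∧ ∀ k l, k ≤ l → h k ∣ h l := by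
  classical
  intro r
  induction r with
  | zero => exact fun A => ⟨fun k => k.elim0, ⟨1, 1, by simp, by simp, Subsingleton.elim _ _⟩,
      fun k => k.elim0⟩
  | succ r ih =>
  intro A
  by_cases hA : A = 0
  · refine ⟨fun _ => 0, ?_, fun _ _ _ => dvd_rfl⟩
    have : (Matrix.diagonal fun _ : Fin (r + 1) => ((0 : ℕ) : ℤ)) = A := by
      rw [hA]
      simp
    rw [this]
    exact IsUnimodEquiv.refl A
  have hex : ∃ m : ℕ, 0 < m ∧ ∃ B, IsUnimodEquiv A B ∧ ∃ a b, B a b = (m : ℤ) := by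
    have : ∃ a b, A a b ≠ 0 := by
      by_contra hcon
      push Not at hcon
      exact hA (Matrix.ext hcon)
    obtain ⟨a, b, hab⟩ := this
    refine ⟨(A a b).natAbs, by omega, ?_⟩
    rcases le_total 0 (A a b) with h | h
    · exact ⟨A, IsUnimodEquiv.refl A, a, b, by omega⟩
    · exact ⟨-A, (IsUnimodEquiv.refl A).neg, a, b, by rw [Matrix.neg_apply]; omega⟩
  obtain ⟨m, ⟨hm, B, hB, a, b, hab⟩, hmin'⟩ : ∃ m : ℕ, (0 < m ∧ ∃ B, IsUnimodEquiv A B ∧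
      ∃ a b, B a b = (m : ℤ)) ∧ ∀ m' < m, ¬ (0 < m' ∧ ∃ B, IsUnimodEquiv A B ∧
        ∃ a b, B a b = (m' : ℤ)) :=
    ⟨Nat.find hex, Nat.find_spec hex, fun m' hm' => Nat.find_min hex hm'⟩
  have hmin : ∀ B, IsUnimodEquiv A B → ∀ a b, 0 ≤ B a b → B a b < m → B a b = 0 := by
    intro B hB a b h0 h1
    by_contra hne
    exact hmin' (B a b).toNat (by omega) ⟨by omega, B, hB, a, b, by omega⟩
  have hrow : ∀ B, IsUnimodEquiv A B → B 0 0 = (m : ℤ) → ∀ k, (m : ℤ) ∣ B 0 k := by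
    intro B hB h0 k
    by_cases hk : k = 0
    · rw [hk, h0]
    · have h1 := hmin _ (hB.mul_transvection (a := 0) (b := k) (Ne.symm hk) (-(B 0 k / m))) 0 k
      rw [Matrix.mul_transvection_apply_same, h0, show B 0 k + -(B 0 k / m) * m = B 0 k % m by
        rw [Int.emod_def]; ring] at h1
      exact Int.dvd_of_emod_eq_zero
        (h1 (Int.emod_nonneg _ (by omega)) (Int.emod_lt_of_pos _ (by omega)))
  have hcol : ∀ B, IsUnimodEquiv A B → B 0 0 = (m : ℤ) → ∀ k, (m : ℤ) ∣ B k 0 := by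
    intro B hB h0 k
    by_cases hk : k = 0
    · rw [hk, h0]
    · have h1 := hmin _ (hB.transvection_mul (a := k) (b := 0) hk (-(B k 0 / m))) k 0
      rw [Matrix.transvection_mul_apply_same, h0, show B k 0 + -(B k 0 / m) * m = B k 0 % m by
        rw [Int.emod_def]; ring] at h1
      exact Int.dvd_of_emod_eq_zero
        (h1 (Int.emod_nonneg _ (by omega)) (Int.emod_lt_of_pos _ (by omega)))
  replace hB := hB.submatrix (Equiv.swap 0 a) (Equiv.swap 0 b)
  set B₀ := B.submatrix (Equiv.swap 0 a) (Equiv.swap 0 b)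
  have hB₀ : B₀ 0 0 = m := by simp [B₀, hab]
  choose p hp using hrow B₀ hB hB₀
  choose q hq using hcol B₀ hB hB₀
  set C := lowerBlock (fun i => -q i.succ) 1 * B₀ * (lowerBlock (fun i => -p i.succ) 1)ᵀ
  have hC : IsUnimodEquiv A C := hB.mul (by rw [lowerBlock_det]; simp)
    (by rw [Matrix.det_transpose, lowerBlock_det]; simp)
  have h00 : C 0 0 = m := by
    simp [C, Matrix.mul_apply, Fin.sum_univ_succ, lowerBlock, hB₀]
  have h0s : ∀ k : Fin r, C 0 k.succ = 0 := by
    intro k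
    simp [C, Matrix.mul_apply, Fin.sum_univ_succ, lowerBlock, hB₀, hp k.succ, Matrix.one_apply]
  have hs0 : ∀ k : Fin r, C k.succ 0 = 0 := by
    intro k
    simp [C, Matrix.mul_apply, Fin.sum_univ_succ, lowerBlock, hB₀, hq k.succ, Matrix.one_apply]
    ring
  -- Adding row `i + 1` to row `0` keeps the corner equal to `m`, because column `0` is already
  -- cleared. The divisibility of row `0` then applies to the added entries.
  have hdvd : ∀ i k : Fin r, (m : ℤ) ∣ C i.succ k.succ := by
    intro i k
    have h1 := hrow _ (hC.transvection_mul (a := 0) (b := i.succ) (Fin.succ_ne_zero i).symm 1)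
      (by rw [Matrix.transvection_mul_apply_same, h00, hs0]; ring) k.succ
    rwa [Matrix.transvection_mul_apply_same, h0s, zero_add, one_mul] at h1
  obtain ⟨h', ⟨U', V', hU', hV', hdiag⟩, hchain⟩ := ih (C.submatrix Fin.succ Fin.succ)
  have hmh : ∀ k, m ∣ h' k := by
    intro k
    have h1 := congrFun (congrFun hdiag k) k
    rw [Matrix.diagonal_apply_eq, Matrix.mul_apply] at h1
    have h2 : (m : ℤ) ∣ h' k := by
      rw [h1]
      refine Finset.dvd_sum fun l _ => Dvd.dvd.mul_right ?_ _
      rw [Matrix.mul_apply]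
      exact Finset.dvd_sum fun t _ => Dvd.dvd.mul_left (hdvd t l) _
    exact_mod_cast h2
  refine ⟨Fin.cons m h', ?_, ?_⟩
  · have h1 := hC.mul (U := lowerBlock 0 U') (V := (lowerBlock 0 V'ᵀ)ᵀ)
      (by rwa [lowerBlock_det]) (by rwa [Matrix.det_transpose, lowerBlock_det, Matrix.det_transpose])
    convert h1 using 1
    ext i k
    refine Fin.cases ?_ (fun i => ?_) i <;> refine Fin.cases ?_ (fun k => ?_) k
    · simp [Matrix.mul_apply, Fin.sum_univ_succ, lowerBlock, h00]
    · simp [Matrix.mul_apply, Fin.sum_univ_succ, lowerBlock, h0s,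
        Matrix.diagonal_apply_ne' _ (Fin.succ_ne_zero k)]
    · simp [Matrix.mul_apply, Fin.sum_univ_succ, lowerBlock, hs0]
    · have h2 := congrFun (congrFun hdiag i) k
      simp only [Matrix.mul_apply, Matrix.submatrix_apply] at h2
      simp [Matrix.mul_apply, Fin.sum_univ_succ, lowerBlock, Matrix.diagonal_apply, hs0, ← h2]
  · intro k l
    refine Fin.cases ?_ (fun k => ?_) k <;> refine Fin.cases ?_ (fun l => ?_) l
    · simp
    · intro _
      simpa using hmh l
    · intro h
      exact absurd h (by simp)
    · intro h
      simpa using hchain k l (Fin.succ_le_succ_iff.1 h)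

lemma exists_isSmithForm (A : Matrix (Fin r) (Fin r) ℤ) : ∃ U V h, IsSmithForm A U V h := by
  obtain ⟨h, ⟨U, V, hU, hV, hUV⟩, hh⟩ := exists_smith_diagonal r A
  exact ⟨U, V, h, hU, hV, hUV, hh⟩

end SmithNormalForm

/-! ### What successive elimination with nonzero pivots computes. -/

section Pivots

variable {n r : ℕ}

/-- If row `i` annihilates `x`, then the pivoted matrix acts on `x` with its `j`-th coordinate
deleted just as `M` acts on `x`. Induction kills every other coordinate, and the nonzero pivot kills
the `j`-th. -/
lemma PivotsNonzero.eq_zero_of_mulVec_eq_zero (s : List (Fin r × Fin n)) :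
    ∀ M : Matrix (Fin n ⊕ Fin r) (Fin n ⊕ Unit) ℚ, PivotsNonzero M s → ∀ x : Fin n → ℚ,
      (∀ c, c ∉ s.map Prod.snd → x c = 0) →
      (∀ l ∈ s.map Prod.fst, ∑ c, M (Sum.inr l) (Sum.inl c) * x c = 0) → x = 0 := by
  induction s with
  | nil =>
    intro M _ x hx _
    ext c
    exact hx c (by simp)
  | cons ij s ih =>
    rintro M ⟨hp, hs⟩ x hx hM
    obtain ⟨i, j⟩ := ij
    simp only at hp
    set y := Function.update x j 0 with hy
    have hMx : ∑ c, M (Sum.inr i) (Sum.inl c) * x c = 0 := hM i (by simp)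
    have key : ∀ p, ∑ c, pivotStep M (i, j) p (Sum.inl c) * y c =
        ∑ c, M p (Sum.inl c) * x c := by
      intro p
      have h1 : ∀ c, pivotStep M (i, j) p (Sum.inl c) * y c = M p (Sum.inl c) * x c -
          M (Sum.inr i) (Sum.inl c) * x c * (M p (Sum.inl j) / M (Sum.inr i) (Sum.inl j)) := by
        intro c
        by_cases hc : c = j
        · subst hc
          rw [hy, Function.update_self]
          field_simp
          ring
        · rw [hy, Function.update_of_ne hc]
          simp only [pivotStep, Matrix.of_apply, Sum.inl.injEq, hc, if_false]
          ring
      rw [Finset.sum_congr rfl fun c _ => h1 c, Finset.sum_sub_distrib, ← Finset.sum_mul, hMx,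
        zero_mul, sub_zero]
    have hy0 : y = 0 := by
      refine ih _ hs y (fun c hc => ?_) fun l hl => ?_
      · by_cases hcj : c = j
        · rw [hcj, hy, Function.update_self]
        · rw [hy, Function.update_of_ne hcj]
          exact hx c (by simpa [hcj] using hc)
      · rw [key]
        exact hM l (by simpa using Or.inr (by simpa using hl))
    have hxc : ∀ c, c ≠ j → x c = 0 := by
      intro c hc
      have := congrFun hy0 c
      rwa [hy, Function.update_of_ne hc] at this
    rw [Finset.sum_eq_single j (fun c _ hc => by rw [hxc c hc, mul_zero]) (by simp)] at hMx
    ext c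
    by_cases hc : c = j
    · rw [hc]
      exact (mul_eq_zero.1 hMx).resolve_left hp
    · exact hxc c hc

/-- `R` and `C` record the rows and columns already used. A later pivot column is not in `C`, so it
is zero in the rows of `R`, and adding multiples of it there does no harm. -/
lemma pivotAll_inr_eq_zero (s : List (Fin r × Fin n)) :
    ∀ (M : Matrix (Fin n ⊕ Fin r) (Fin n ⊕ Unit) ℚ) (R : Set (Fin r)) (C : Set (Fin n)),
      (∀ l ∈ R, ∀ x, (∀ c ∈ C, x ≠ Sum.inl c) → M (Sum.inr l) x = 0) → PivotsNonzero M s →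
      (s.map Prod.snd).Nodup → (∀ ij ∈ s, ij.2 ∉ C) →
      ∀ l, l ∈ R ∨ l ∈ s.map Prod.fst → ∀ x, (∀ c, c ∈ C ∨ c ∈ s.map Prod.snd → x ≠ Sum.inl c) →
        pivotAll M s (Sum.inr l) x = 0 := by
  induction s with
  | nil =>
    intro M R C h0 _ _ _ l hl x hx
    exact h0 l (by simpa using hl) x fun c hc => hx c (Or.inl hc)
  | cons ij s ih =>
    rintro M R C h0 ⟨hp, hs⟩ hnd hC l hl x hx
    obtain ⟨i, j⟩ := ij
    simp only at hp
    simp only [List.map_cons, List.nodup_cons] at hnd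
    refine ih (pivotStep M (i, j)) (insert i R) (insert j C) ?_ hs hnd.2 ?_ l ?_ x ?_
    · intro l hl x hx
      have hxj : x ≠ Sum.inl j := hx j (Set.mem_insert j C)
      simp only [pivotStep, Matrix.of_apply, hxj, if_false]
      rcases hl with rfl | hl
      · field_simp
        ring
      · rw [h0 l hl x fun c hc => hx c (Set.mem_insert_of_mem j hc), h0 l hl (Sum.inl j)]
        · ring
        · intro c hc h
          rw [← Sum.inl.inj h] at hc
          exact hC (i, j) List.mem_cons_self hc
    · intro ij hij hij2
      rcases hij2 with h | h
      · exact hnd.1 (h ▸ List.mem_map_of_mem hij)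
      · exact hC ij (List.mem_cons_of_mem _ hij) h
    · simp only [List.map_cons, List.mem_cons] at hl
      rw [Set.mem_insert_iff]
      tauto
    · intro c hc
      apply hx
      rw [Set.mem_insert_iff] at hc
      simp only [List.map_cons, List.mem_cons]
      tauto

/-- The relations between the rows of `[[id, 0], [A, -b]]` that are preserved by column operations
with pivot columns in `J`. -/
def IsReduction (A : Matrix (Fin r) (Fin n) ℤ) (b : Fin r → ℤ) (J : Set (Fin n))
    (M : Matrix (Fin n ⊕ Fin r) (Fin n ⊕ Unit) ℚ) : Prop :=
  (∀ l x, M (Sum.inr l) x =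
    ∑ p, (A l p : ℚ) * M (Sum.inl p) x - Sum.elim (fun _ => 0) (fun _ => (b l : ℚ)) x) ∧
  ∀ p ∉ J, ∀ x, M (Sum.inl p) x = Sum.elim (fun c => if p = c then 1 else 0) (fun _ => 0) x

variable {A : Matrix (Fin r) (Fin n) ℤ} {b : Fin r → ℤ} {J : Set (Fin n)}

lemma isReduction_startMatrix : IsReduction A b J ((startMatrix A b).map (Int.cast : ℤ → ℚ)) := by
  constructor
  · rintro l (c | u)
    · simp [startMatrix, Matrix.one_apply]
    · simp [startMatrix]
  · rintro p _ (c | u)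
    · simp [startMatrix, Matrix.one_apply]
    · simp [startMatrix]

lemma IsReduction.pivotStep {M : Matrix (Fin n ⊕ Fin r) (Fin n ⊕ Unit) ℚ} (h : IsReduction A b J M)
    (ij : Fin r × Fin n) (hj : ij.2 ∈ J) : IsReduction A b J (pivotStep M ij) := by
  constructor
  · intro l x
    by_cases hx : x = Sum.inl ij.2
    · simp only [_root_.pivotStep, Matrix.of_apply, hx, if_true]
      exact h.1 l _
    · simp only [_root_.pivotStep, Matrix.of_apply, hx, if_false]
      rw [h.1 l x, h.1 l (Sum.inl ij.2)]
      simp only [mul_sub, Finset.sum_sub_distrib, Sum.elim_inl, sub_zero, Finset.mul_sum]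
      rw [sub_right_comm]
      congr 2
      exact Finset.sum_congr rfl fun p _ => by ring
  · intro p hp x
    by_cases hx : x = Sum.inl ij.2
    · simp only [_root_.pivotStep, Matrix.of_apply, hx, if_true]
      exact h.2 p hp _
    · simp only [_root_.pivotStep, Matrix.of_apply, hx, if_false]
      have hpj : p ≠ ij.2 := by rintro rfl; exact hp hj
      rw [h.2 p hp x, h.2 p hp (Sum.inl ij.2)]
      simp [hpj]

lemma IsReduction.pivotAll (s : List (Fin r × Fin n)) :
    ∀ M : Matrix (Fin n ⊕ Fin r) (Fin n ⊕ Unit) ℚ, IsReduction A b J M →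
      (∀ ij ∈ s, ij.2 ∈ J) → IsReduction A b J (pivotAll M s) := by
  induction s with
  | nil => exact fun M h _ => h
  | cons ij s ih =>
    intro M h hs
    exact ih _ (h.pivotStep ij (hs ij List.mem_cons_self)) fun ij hij =>
      hs ij (List.mem_cons_of_mem _ hij)

variable {i : Equiv.Perm (Fin r)} {j : Fin r ↪ Fin n}

lemma map_fst_pivotList (i : Equiv.Perm (Fin r)) (j : Fin r ↪ Fin n) :
    (pivotList i j).map Prod.fst = List.ofFn i := by
  simp [pivotList, List.map_ofFn, Function.comp_def]

lemma map_snd_pivotList (i : Equiv.Perm (Fin r)) (j : Fin r ↪ Fin n) :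
    (pivotList i j).map Prod.snd = List.ofFn j := by
  simp [pivotList, List.map_ofFn, Function.comp_def]

/-- A kernel vector of `A₁`, extended by zero, would be a nonzero kernel vector supported on the
pivot columns. -/
lemma det_submatrix_ne_zero
    (hpiv : PivotsNonzero ((startMatrix A b).map (Int.cast : ℤ → ℚ)) (pivotList i j)) :
    (A.submatrix id j).det ≠ 0 := by
  classical
  intro h0
  obtain ⟨x, hx0, hx⟩ := Matrix.exists_mulVec_eq_zero_iff.2 h0
  set y : Fin n → ℚ := Function.extend j (fun k => (x k : ℚ)) 0
  have hyj : ∀ k, y (j k) = x k := fun k => j.injective.extend_apply _ _ k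
  have hyc : ∀ c, c ∉ Set.range j → y c = 0 := fun c hc =>
    Function.extend_apply' _ _ _ hc
  have hsum : ∀ a : Fin n → ℚ, ∑ c, a c * y c = ∑ k, a (j k) * x k := by
    intro a
    rw [← (colEquiv j).sum_comp, Fintype.sum_sum_type]
    rw [Finset.sum_eq_zero (s := (Finset.univ : Finset (CoCols j))), add_zero]
    · exact Finset.sum_congr rfl fun k _ => by rw [← hyj]; rfl
    · intro c _
      exact mul_eq_zero_of_right _ (hyc _ c.2)
  have := PivotsNonzero.eq_zero_of_mulVec_eq_zero _ _ hpiv y ?_ ?_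
  · apply hx0
    ext k
    have h1 := congrFun this (j k)
    rw [hyj] at h1
    simpa using h1
  · intro c hc
    rw [map_snd_pivotList] at hc
    exact hyc c fun ⟨k, hk⟩ => hc ((List.mem_ofFn' _ _).2 ⟨k, hk⟩)
  · intro l _
    rw [hsum]
    have h1 := congrFun hx l
    simp only [Matrix.mulVec, dotProduct, Matrix.submatrix_apply, id, Pi.zero_apply] at h1
    simp only [startMatrix, Matrix.map_apply, Matrix.fromBlocks_apply₂₁]
    exact_mod_cast h1

/-- These equations determine `M_r⟨J⟩` because `A₁` is invertible over `ℚ`. Only they are used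
afterwards; the elimination itself is no longer needed. -/
lemma reducedMatrix_apply
    (hpiv : PivotsNonzero ((startMatrix A b).map (Int.cast : ℤ → ℚ)) (pivotList i j)) :
    (∀ l c, ∑ p, (A l p : ℚ) * reducedMatrix A b i j p (Sum.inl c) = 0) ∧
    (∀ l, ∑ p, (A l p : ℚ) * reducedMatrix A b i j p (Sum.inr ()) = b l) ∧
    (∀ p ∉ Set.range j, ∀ c : CoCols j,
      reducedMatrix A b i j p (Sum.inl c) = if p = (c : Fin n) then 1 else 0) ∧
    ∀ p ∉ Set.range j, reducedMatrix A b i j p (Sum.inr ()) = 0 := by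
  have hred : IsReduction A b (Set.range j)
      (pivotAll ((startMatrix A b).map (Int.cast : ℤ → ℚ)) (pivotList i j)) := by
    refine IsReduction.pivotAll _ _ isReduction_startMatrix fun ij hij => ?_
    have := List.mem_map_of_mem (f := Prod.snd) hij
    rw [map_snd_pivotList] at this
    exact (List.mem_ofFn' _ _).1 this
  have hzero : ∀ l x, (∀ c ∈ Set.range j, x ≠ Sum.inl c) →
      pivotAll ((startMatrix A b).map (Int.cast : ℤ → ℚ)) (pivotList i j) (Sum.inr l) x = 0 := by
    intro l x hx
    refine pivotAll_inr_eq_zero _ _ ∅ ∅ (by simp) hpiv ?_ (by simp) l (Or.inr ?_) x ?_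
    · rw [map_snd_pivotList]
      exact List.nodup_ofFn.2 j.injective
    · rw [map_fst_pivotList]
      exact (List.mem_ofFn' _ _).2 (i.surjective l)
    · rintro c (hc | hc)
      · exact absurd hc (Set.notMem_empty c)
      · rw [map_snd_pivotList] at hc
        exact hx c ((List.mem_ofFn' _ _).1 hc)
  refine ⟨fun l c => ?_, fun l => ?_, fun p hp c => hred.2 p hp _, fun p hp => hred.2 p hp _⟩
  · have h1 := hred.1 l (Sum.inl c)
    rw [hzero l (Sum.inl c) fun c' hc' he => c.2 (Sum.inl.inj he ▸ hc')] at h1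
    rw [Sum.elim_inl, sub_zero] at h1
    exact h1.symm
  · have h1 := hred.1 l (Sum.inr ())
    rw [hzero l (Sum.inr ()) fun c' hc' he => by simp at he] at h1
    simp only [Sum.elim_inr] at h1
    exact (sub_eq_zero.1 h1.symm)

end Pivots

/-! ### Splitting coordinates into `J` and its complement. -/

section ColumnSplitting

variable {n r : ℕ} (j : Fin r ↪ Fin n)

@[simp] lemma colEquiv_inl (k : Fin r) : colEquiv j (Sum.inl k) = j k := rfl

@[simp] lemma colEquiv_inr (c : CoCols j) : colEquiv j (Sum.inr c) = c := rfl

@[simp] lemma colEquiv_symm_apply (k : Fin r) : (colEquiv j).symm (j k) = Sum.inl k :=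
  (colEquiv j).symm_apply_eq.2 rfl

@[simp] lemma colEquiv_symm_coe (c : CoCols j) : (colEquiv j).symm (c : Fin n) = Sum.inr c :=
  (colEquiv j).symm_apply_eq.2 rfl

lemma mulVec_eq_add {R ι : Type*} [CommRing R] (A : Matrix ι (Fin n) R) (x : Fin n → R) :
    A *ᵥ x = A.submatrix id j *ᵥ (x ∘ j) +
      A.submatrix id (Subtype.val : CoCols j → Fin n) *ᵥ fun c => x c := by
  ext l
  simp only [Matrix.mulVec, dotProduct, Pi.add_apply, Matrix.submatrix_apply, id]
  rw [← (colEquiv j).sum_comp, Fintype.sum_sum_type]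
  rfl

lemma diagExt_mulVec_apply (V : Matrix (Fin r) (Fin r) ℤ) (x : Fin n → ℚ) (k : Fin r) :
    ((diagExt j V).map (Int.cast : ℤ → ℚ) *ᵥ x) (j k) =
      (V.map (Int.cast : ℤ → ℚ) *ᵥ (x ∘ j)) k := by
  simp only [Matrix.mulVec, dotProduct]
  rw [← (colEquiv j).sum_comp, Fintype.sum_sum_type]
  simp [diagExt]

lemma diagExt_mulVec_coe (V : Matrix (Fin r) (Fin r) ℤ) (x : Fin n → ℚ) (c : CoCols j) :
    ((diagExt j V).map (Int.cast : ℤ → ℚ) *ᵥ x) c = x c := by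
  classical
  simp only [Matrix.mulVec, dotProduct]
  rw [← (colEquiv j).sum_comp, Fintype.sum_sum_type]
  simp [diagExt, Matrix.one_apply]

variable {j} {A : Matrix (Fin r) (Fin n) ℤ}

lemma eq_of_mulVec_eq (hA : (A.submatrix id j).det ≠ 0) {x y : Fin n → ℚ}
    (hxy : ∀ c : CoCols j, x c = y c)
    (hAxy : A.map (Int.cast : ℤ → ℚ) *ᵥ x = A.map (Int.cast : ℤ → ℚ) *ᵥ y) : x = y := by
  rw [mulVec_eq_add j, mulVec_eq_add j (x := y), funext hxy, add_left_inj] at hAxy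
  have hdet : ((A.map (Int.cast : ℤ → ℚ)).submatrix id j).det ≠ 0 := by
    have h1 := Int.cast_det (R := ℚ) (A.submatrix id j)
    intro h2
    exact hA (Int.cast_injective (α := ℚ) (by rw [h1, Int.cast_zero]; exact h2))
  have h2 := Matrix.mulVec_injective_of_det_ne_zero hdet hAxy
  ext p
  by_cases hp : p ∈ Set.range j
  · obtain ⟨k, rfl⟩ := hp
    exact congrFun h2 k
  · exact hxy ⟨p, hp⟩

end ColumnSplitting

/-! ### The substitution `λ_l = y_{j_l}^(-1/h_l)` on exponents. -/

section RationalElimination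

variable {n r : ℕ} (j : Fin r ↪ Fin n) (h : Fin r → ℕ)

/-- The exponent vector in the variables `y` that results from `γ` by the substitution
`λₗ = y_{jₗ} ^ (-1 / hₗ)`. -/
def elimVec (γ : Fin n ⊕ Fin r → ℤ) : Fin n → ℚ := fun p =>
  γ (Sum.inl p) - ∑ l, (γ (Sum.inr l) : ℚ) / h l * (if p = j l then 1 else 0)

lemma elimVec_apply (γ : Fin n ⊕ Fin r → ℤ) (k : Fin r) :
    elimVec j h γ (j k) = γ (Sum.inl (j k)) - (γ (Sum.inr k) : ℚ) / h k := by
  simp [elimVec, j.injective.eq_iff]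

lemma elimVec_coe (γ : Fin n ⊕ Fin r → ℤ) (c : CoCols j) :
    elimVec j h γ c = γ (Sum.inl c) := by
  rw [elimVec, Finset.sum_eq_zero, sub_zero]
  intro l _
  rw [if_neg fun hc => c.2 ⟨l, hc.symm⟩, mul_zero]

lemma elimVec_add (γ δ : Fin n ⊕ Fin r → ℤ) :
    elimVec j h (γ + δ) = elimVec j h γ + elimVec j h δ := by
  ext p
  simp only [elimVec, Pi.add_apply, Int.cast_add, add_div, add_mul, Finset.sum_add_distrib]
  ring

lemma elimVec_nsmul (m : ℕ) (γ : Fin n ⊕ Fin r → ℤ) :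
    elimVec j h (m • γ) = m • elimVec j h γ := by
  ext p
  simp only [elimVec, Pi.smul_apply, nsmul_eq_mul, Int.cast_mul, Int.cast_natCast, mul_sub,
    Finset.mul_sum, mul_div_assoc, mul_assoc]

lemma elimVec_sum {ι : Type*} (s : Finset ι) (γ : ι → Fin n ⊕ Fin r → ℤ) :
    elimVec j h (∑ c ∈ s, γ c) = ∑ c ∈ s, elimVec j h (γ c) := by
  classical
  induction s using Finset.induction_on with
  | empty =>
    ext p
    simp [elimVec]
  | insert c s hc ih => rw [Finset.sum_insert hc, Finset.sum_insert hc, elimVec_add, ih]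

variable {j h} {B : Matrix (Fin r) (Fin n) ℤ}

lemma castVec_elimExp (hh : ∀ k, 0 < h k) {γ : Fin n ⊕ Fin r → ℤ}
    (hγ : ∀ l, (h l : ℤ) ∣ γ (Sum.inr l)) :
    castVec (elimExp j h r γ ∘ Sum.inl) = elimVec j h γ := by
  ext p
  rw [castVec, Function.comp_apply, elimExp_last_inl, elimVec]
  push_cast
  congr 1
  refine Finset.sum_congr rfl fun l _ => ?_
  rw [Int.cast_div (hγ l) (by exact_mod_cast (hh l).ne')]
  simp

open scoped Classical in
-- The coordinate at `j_l` is an integer minus `γ_l / h_l`, and the coordinates outside `J` are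
-- integers anyway.
lemma intMono_elimVec (hh : ∀ k, 0 < h k) (γ : Fin n ⊕ Fin r → ℤ) :
    intMono (elimVec j h γ) = if ∀ l, (h l : ℤ) ∣ γ (Sum.inr l) then
      AddMonoidAlgebra.single (elimExp j h r γ ∘ Sum.inl) 1 else 0 := by
  split_ifs with hγ
  · rw [← castVec_elimExp hh hγ, intMono_castVec]
  · refine intMono_of_notMem ?_
    rintro ⟨δ, hδ⟩
    refine hγ fun l => ⟨γ (Sum.inl (j l)) - δ (j l), ?_⟩
    have h1 := congrFun hδ (j l)
    rw [elimVec_apply, castVec] at h1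
    have h2 : (h l : ℚ) ≠ 0 := by exact_mod_cast (hh l).ne'
    field_simp at h1
    have h3 : (γ (Sum.inr l) : ℚ) = h l * (γ (Sum.inl (j l)) - δ (j l)) := by linear_combination h1
    exact_mod_cast h3

/-- The columns of the matrix `[[id, 0], [B, -β]]` outside `J` after the substitution
`λₗ = y_{jₗ} ^ (-1 / hₗ)`. -/
def elimMatrix (j : Fin r ↪ Fin n) (h : Fin r → ℕ) (B : Matrix (Fin r) (Fin n) ℤ)
    (β : Fin r → ℤ) : Matrix (Fin n) (CoCols j ⊕ Unit) ℚ :=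
  Matrix.of fun p => Sum.elim (fun c => elimVec j h (startCol B c) p)
    fun _ => elimVec j h (startNum n β) p

lemma conePoint_elimMatrix (β : Fin r → ℤ) {N : ℕ} (k : CoCols j → Fin N) :
    conePoint (elimMatrix j h B β) (fun c => k c) = elimVec j h (expandedNum B β j k) := by
  rw [expandedNum, elimVec_add, elimVec_sum]
  simp only [elimVec_nsmul]
  ext p
  rw [Pi.add_apply, Finset.sum_apply]
  simp only [Pi.smul_apply, nsmul_eq_mul]
  rfl

/-- The denominator exponents of the iterated constant term. -/
def elimCol (j : Fin r ↪ Fin n) (h : Fin r → ℕ) (B : Matrix (Fin r) (Fin n) ℤ) (N : ℕ)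
    (c : CoCols j) : Fin n → ℤ :=
  elimExp j h r (N • startCol B c) ∘ Sum.inl

lemma dvd_nsmul_startCol {N : ℕ} (hN : ∀ k, h k ∣ N) (c : Fin n) (l : Fin r) :
    (h l : ℤ) ∣ (N • startCol B c) (Sum.inr l) := by
  rw [Pi.smul_apply, nsmul_eq_mul]
  exact Dvd.dvd.mul_right (Int.natCast_dvd_natCast.2 (hN l)) _

lemma castVec_elimCol (hh : ∀ k, 0 < h k) {N : ℕ} (hN : ∀ k, h k ∣ N) (β : Fin r → ℤ)
    (c : CoCols j) :
    castVec (elimCol j h B N c) = N • fun p => elimMatrix j h B β p (Sum.inl c) := by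
  have h1 := castVec_elimExp (j := j) (γ := N • startCol B c) hh
    (dvd_nsmul_startCol (B := B) hN (c : Fin n))
  rw [elimVec_nsmul] at h1
  exact h1

lemma inclVars_mono_comp_inl {γ : Fin n ⊕ Fin r → ℤ} (hγ : ∀ k, γ (Sum.inr k) = 0) :
    inclVars Sum.inl Sum.inl_injective (mono (γ ∘ Sum.inl)) = mono γ := by
  rw [inclVars, monoSubst_mono]
  congr 1
  ext (p | k)
  · exact Sum.inl_injective.extend_apply _ _ p
  · rw [hγ k]
    exact Function.extend_apply' _ _ _ (by simp)

/-- Both sides are sums over the same box of multi-indices. Divisibility of the `λ`-exponents on one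
side is integrality of the substituted exponent on the other. -/
lemma inclVars_coneFun (hh : ∀ k, 0 < h k) {N : ℕ} (hN : ∀ k, h k ∣ N) (β : Fin r → ℤ) :
    inclVars Sum.inl Sum.inl_injective
      (coneFun N (elimMatrix j h B β) (elimCol j h B N)) = elimSum B β j h N r := by
  classical
  have hinr : ∀ γ : Fin n ⊕ Fin r → ℤ, (∀ l, (h l : ℤ) ∣ γ (Sum.inr l)) →
      inclVars Sum.inl Sum.inl_injective (mono (elimExp j h r γ ∘ Sum.inl)) =
        mono (elimExp j h r γ) := fun γ hγ =>
    inclVars_mono_comp_inl fun k => by rw [elimExp_last_inr, Int.emod_eq_zero_of_dvd (hγ k)]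
  rw [coneFun, map_div₀, coneNum, map_sum, map_sum, algebraMap_coneDen, map_prod, elimSum,
    Finset.sum_div]
  refine Finset.sum_congr (Finset.ext fun _ => by simp only [Finset.mem_univ]) fun k _ => ?_
  rw [conePoint_elimMatrix, intMono_elimVec hh]
  simp only [Fin.is_lt, forall_true_left]
  split_ifs with hk
  · rw [SignedTerm.toRat_eq, div_eq_mul_inv, ← Finset.prod_inv_distrib]
    change inclVars Sum.inl Sum.inl_injective (mono _) * _ = _
    rw [hinr _ hk, elimDen, List.drop_eq_nil_of_le (by simp), List.nil_append, List.map_map,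
      Finset.prod_map_toList]
    simp only [Units.val_one, Int.cast_one, one_mul]
    congr 1
    refine Finset.prod_congr rfl fun c _ => ?_
    rw [map_sub, map_one, elimCol, hinr _ (dvd_nsmul_startCol hN c)]
    rfl
  · rw [map_zero, map_zero, zero_div]

/-- On the columns in `J` the factor `h_s` of `B` cancels the denominator. For `startCol` the result
is `0` and for `startNum` it is `β`, the same equations as for `M_r⟨J⟩`. -/
lemma IsDiagOn.mulVec_elimVec (hB : IsDiagOn j h B) (hh : ∀ k, 0 < h k)
    (γ : Fin n ⊕ Fin r → ℤ) :
    B.map (Int.cast : ℤ → ℚ) *ᵥ elimVec j h γ =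
      fun s => ∑ p, (B s p : ℚ) * γ (Sum.inl p) - γ (Sum.inr s) := by
  ext s
  have h1 : ∀ p, (B s p : ℚ) * elimVec j h γ p = B s p * γ (Sum.inl p) -
      ∑ l, (γ (Sum.inr l) : ℚ) / h l * (if p = j l then (B s p : ℚ) else 0) := by
    intro p
    rw [elimVec, mul_sub, Finset.mul_sum]
    congr 1
    refine Finset.sum_congr rfl fun l _ => ?_
    split_ifs <;> ring
  have h2 : (h s : ℚ) ≠ 0 := by exact_mod_cast (hh s).ne'
  simp only [Matrix.mulVec, dotProduct, Matrix.map_apply, h1, Finset.sum_sub_distrib]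
  rw [Finset.sum_comm]
  simp only [← Finset.mul_sum, Finset.sum_ite_eq', Finset.mem_univ, if_true, hB s]
  simp [h2]

end RationalElimination

/-! ### Comparison of the Smith form computation with `M_r⟨J⟩`. -/

section SmithElimination

variable {n r : ℕ} {A : Matrix (Fin r) (Fin n) ℤ} {b : Fin r → ℤ} {j : Fin r ↪ Fin n}
  {U V : Matrix (Fin r) (Fin r) ℤ} {h : Fin r → ℕ}

/-- The lower left block of the matrix `M̂`. -/
def smithBlock (A : Matrix (Fin r) (Fin n) ℤ) (j : Fin r ↪ Fin n) (U : Matrix (Fin r) (Fin r) ℤ)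
    (h : Fin r → ℕ) : Matrix (Fin r) (Fin n) ℤ :=
  (Matrix.fromCols (Matrix.diagonal fun k => (h k : ℤ))
    (U * A.submatrix id (Subtype.val : CoCols j → Fin n))).submatrix id (colEquiv j).symm

lemma smithBlock_isDiagOn : IsDiagOn j h (smithBlock A j U h) := by
  intro l k
  simp only [smithBlock, Matrix.submatrix_apply, colEquiv_symm_apply, Matrix.fromCols_apply_inl,
    Matrix.diagonal_apply, id]
  split_ifs with hlk
  · rw [hlk]
  · rfl

lemma IsSmithForm.pos (hUV : IsSmithForm (A.submatrix id j) U V h)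
    (hA : (A.submatrix id j).det ≠ 0) (k : Fin r) : 0 < h k := by
  have h1 := congrArg Matrix.det hUV.2.2.1
  rw [Matrix.det_mul, Matrix.det_mul, Matrix.det_diagonal] at h1
  have h2 : ∏ k, (h k : ℤ) ≠ 0 := by
    rw [h1]
    exact mul_ne_zero (mul_ne_zero hUV.1.ne_zero hA) hUV.2.1.ne_zero
  have := Finset.prod_ne_zero_iff.1 h2 k (Finset.mem_univ k)
  omega

/-- The product of the `h_k` is `det A₁` up to sign, so `|det A₁|` serves every Smith form at once.
-/
lemma IsSmithForm.dvd (hUV : IsSmithForm (A.submatrix id j) U V h) (k : Fin r) :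
    h k ∣ (A.submatrix id j).det.natAbs := by
  have h1 := congrArg Matrix.det hUV.2.2.1
  rw [Matrix.det_mul, Matrix.det_mul, Matrix.det_diagonal] at h1
  have h2 : (h k : ℤ) ∣ U.det * (A.submatrix id j).det * V.det :=
    h1 ▸ Finset.dvd_prod_of_mem (fun k => (h k : ℤ)) (Finset.mem_univ k)
  rw [hUV.2.1.dvd_mul_right, hUV.1.dvd_mul_left] at h2
  exact Int.natCast_dvd.1 h2

lemma IsSmithForm.mulVec_diagExt (hUV : IsSmithForm (A.submatrix id j) U V h) (x : Fin n → ℚ) :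
    U.map (Int.cast : ℤ → ℚ) *ᵥ (A.map (Int.cast : ℤ → ℚ) *ᵥ
      ((diagExt j V).map (Int.cast : ℤ → ℚ) *ᵥ x)) =
        (smithBlock A j U h).map (Int.cast : ℤ → ℚ) *ᵥ x := by
  rw [mulVec_eq_add j (A.map (Int.cast : ℤ → ℚ)),
    mulVec_eq_add j ((smithBlock A j U h).map (Int.cast : ℤ → ℚ)),
    Matrix.mulVec_add, Matrix.mulVec_mulVec, Matrix.mulVec_mulVec]
  congr 1
  · have h1 : ((diagExt j V).map (Int.cast : ℤ → ℚ) *ᵥ x) ∘ j =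
        V.map (Int.cast : ℤ → ℚ) *ᵥ (x ∘ j) := funext fun k => diagExt_mulVec_apply j V x k
    rw [h1, Matrix.mulVec_mulVec]
    congr 1
    rw [Matrix.submatrix_map, ← Matrix.map_mul_intCast, ← Matrix.map_mul_intCast, ← hUV.2.2.1]
    ext l k
    simp only [Matrix.map_apply, Matrix.submatrix_apply, id, smithBlock_isDiagOn l k,
      Matrix.diagonal_apply]
    split_ifs with hlk
    · rw [hlk]
    · rfl
  · have h1 : (fun c : CoCols j => ((diagExt j V).map (Int.cast : ℤ → ℚ) *ᵥ x) c) =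
        fun c : CoCols j => x c := funext fun c => diagExt_mulVec_coe j V x c
    rw [h1]
    congr 1
    refine (Matrix.map_mul (L := U) (M := A.submatrix id (Subtype.val : CoCols j → Fin n))
      (f := Int.castRingHom ℚ)).symm.trans ?_
    ext l c
    simp [smithBlock]

variable {i : Equiv.Perm (Fin r)}

/-- Corresponding columns agree outside `J` and have the same image under `A`, which is checked
after applying the injective `U`. Invertibility of `A₁` makes them equal. -/
lemma IsSmithForm.diagExt_mul_elimMatrix (hUV : IsSmithForm (A.submatrix id j) U V h)
    (hpiv : PivotsNonzero ((startMatrix A b).map (Int.cast : ℤ → ℚ)) (pivotList i j)) :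
    (diagExt j V).map (Int.cast : ℤ → ℚ) * elimMatrix j h (smithBlock A j U h) (U *ᵥ b) =
      reducedMatrix A b i j := by
  have hdet := det_submatrix_ne_zero hpiv
  have hh := hUV.pos hdet
  obtain ⟨h1, h2, h3, h4⟩ := reducedMatrix_apply hpiv
  have hU : Function.Injective (U.map (Int.cast : ℤ → ℚ)).mulVec := by
    refine Matrix.mulVec_injective_of_det_ne_zero ?_
    have := Int.cast_det (R := ℚ) U
    intro h5
    exact hUV.1.ne_zero (Int.cast_injective (α := ℚ) (by rw [this, Int.cast_zero]; exact h5))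
  ext p (c | u)
  · refine congrFun (eq_of_mulVec_eq (x := (diagExt j V).map (Int.cast : ℤ → ℚ) *ᵥ
      elimVec j h (startCol (smithBlock A j U h) c))
      (y := fun p => reducedMatrix A b i j p (Sum.inl c)) hdet (fun d => ?_) (hU ?_)) p
    · rw [diagExt_mulVec_coe, elimVec_coe, h3 d d.2, startCol, Sum.elim_inl, Pi.single_apply]
      norm_cast
    · rw [hUV.mulVec_diagExt, smithBlock_isDiagOn.mulVec_elimVec hh,
        show A.map (Int.cast : ℤ → ℚ) *ᵥ (fun p => reducedMatrix A b i j p (Sum.inl c)) = 0 from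
          funext fun l => h1 l c, Matrix.mulVec_zero]
      ext s
      simp [startCol, Pi.single_apply]
  · refine congrFun (eq_of_mulVec_eq (x := (diagExt j V).map (Int.cast : ℤ → ℚ) *ᵥ
      elimVec j h (startNum n (U *ᵥ b)))
      (y := fun p => reducedMatrix A b i j p (Sum.inr ())) hdet (fun d => ?_) (hU ?_)) p
    · rw [diagExt_mulVec_coe, elimVec_coe, h4 d d.2, startNum, Sum.elim_inl]
      simp
    · rw [hUV.mulVec_diagExt, smithBlock_isDiagOn.mulVec_elimVec hh,
        show A.map (Int.cast : ℤ → ℚ) *ᵥ (fun p => reducedMatrix A b i j p (Sum.inr ())) =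
          fun l => (b l : ℚ) from funext fun l => h2 l]
      ext s
      simp [startNum, Matrix.mulVec, dotProduct]

end SmithElimination

/-! ### Substitutions applied to signed terms. -/

section MonomialSubstitution

variable {σ τ : Type} [Finite σ] [Finite τ]

lemma SignedTerm.monoSubst_toRat (L : (σ → ℤ) →+ (τ → ℤ)) (hL : Function.Injective L)
    (T : SignedTerm σ) : monoSubst L hL T.toRat = (T.mapExp L).toRat := by
  rw [toRat_eq, toRat_eq, map_mul, map_mul, monoSubst_mono, map_intCast, map_list_prod,
    List.map_map, mapExp, List.map_map]
  congr 3
  ext γ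
  simp [monoSubst_mono]

lemma SignedTerm.monoSubst_sumRat (L : (σ → ℤ) →+ (τ → ℤ)) (hL : Function.Injective L)
    (D : List (SignedTerm σ)) : monoSubst L hL (sumRat D) = sumRat (D.map (mapExp L)) := by
  rw [sumRat, sumRat, map_list_sum, List.map_map, List.map_map]
  congr 1
  exact List.map_congr_left fun T _ => monoSubst_toRat L hL T

variable {n r : ℕ}

lemma extendHom_inl_comp {γ : Fin n ⊕ Fin r → ℤ} (hγ : ∀ k, γ (Sum.inr k) = 0) :
    extendHom Sum.inl Sum.inl_injective (γ ∘ Sum.inl) = γ := by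
  ext (p | k)
  · exact Sum.inl_injective.extend_apply _ _ p
  · rw [hγ k]
    exact Function.extend_apply' _ _ _ (by simp)

lemma SignedTerm.inclVars_sumRat {D : List (SignedTerm (Fin n ⊕ Fin r))}
    (hD : ∀ T ∈ D, ∀ k, T.FreeOf (Sum.inr k)) :
    inclVars Sum.inl Sum.inl_injective (sumRat (D.map (mapExp (· ∘ Sum.inl)))) = sumRat D := by
  rw [inclVars, monoSubst_sumRat, List.map_map]
  congr 1
  conv_rhs => rw [← List.map_id D]
  refine List.map_congr_left fun T hT => ?_
  obtain ⟨s, ν, l⟩ := T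
  have h1 : ∀ k, ν (Sum.inr k) = 0 := fun k => (hD _ hT k).1
  have h2 : ∀ γ ∈ l, ∀ k, γ (Sum.inr k) = 0 := fun γ hγ k => (hD _ hT k).2 γ hγ
  simp only [Function.comp_apply, mapExp, List.map_map, id, extendHom_inl_comp h1]
  congr 1
  conv_rhs => rw [← List.map_id l]
  exact List.map_congr_left fun γ hγ => extendHom_inl_comp (h2 γ hγ)

end MonomialSubstitution

/-! ### Transport of unimodularity and of generating functions by `W`. -/

section Decomposition

variable {n r : ℕ}

lemma HasDual.map_mulVec {l : List (Fin n ⊕ Fin r → ℤ)} (hl : HasDual l)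
    (hfree : ∀ γ ∈ l, ∀ k, γ (Sum.inr k) = 0) {W Z : Matrix (Fin n) (Fin n) ℤ}
    (hW : IsUnit W.det) (hZ : IsUnit Z.det) :
    HasDual (l.map fun γ => mulVecHom W (mulVecHom Z (γ ∘ Sum.inl))) := by
  refine hl.map_of_leftInverse _
    ((extendHom (Sum.inl : Fin n → Fin n ⊕ Fin r) Sum.inl_injective).toIntLinearMap ∘ₗ
      (Z⁻¹).mulVecLin ∘ₗ (W⁻¹).mulVecLin) fun γ hγ => ?_
  change extendHom Sum.inl Sum.inl_injective (Z⁻¹ *ᵥ (W⁻¹ *ᵥ (W *ᵥ (Z *ᵥ (γ ∘ Sum.inl))))) = γ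
  rw [Matrix.mulVec_mulVec (M := W⁻¹), Matrix.nonsing_inv_mul W hW, Matrix.one_mulVec,
    Matrix.mulVec_mulVec, Matrix.nonsing_inv_mul Z hZ, Matrix.one_mulVec,
    extendHom_inl_comp (hfree γ hγ)]

/-- The rows of `W⁻¹` with index outside `J` are the integral dual functionals: they read off
coordinates of `M_r⟨J⟩`, where the generators form an identity block and the vertex is zero. -/
lemma isGenFun_matAct_coneFun {A : Matrix (Fin r) (Fin n) ℤ} {b : Fin r → ℤ}
    {i : Equiv.Perm (Fin r)} {j : Fin r ↪ Fin n}
    (hpiv : PivotsNonzero ((startMatrix A b).map (Int.cast : ℤ → ℚ)) (pivotList i j))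
    {W : Matrix (Fin n) (Fin n) ℤ} (hW : IsUnit W.det) {N : ℕ} {G : CoCols j → Fin n → ℤ}
    (hG : ∀ c, castVec (G c) = N • fun p => reducedMatrix A b i j p (Sum.inl c))
    (hG0 : ∀ c, G c ≠ 0) :
    IsGenFun (shiftedCone (W.map (Int.cast : ℤ → ℚ) * reducedMatrix A b i j))
      (matAct W hW.ne_zero (coneFun N (reducedMatrix A b i j) G)) := by
  classical
  obtain ⟨-, -, h3, h4⟩ := reducedMatrix_apply hpiv
  have hdual : ∀ (c : Fin n) x, ∑ p, ((W⁻¹ c p : ℤ) : ℚ) *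
      (W.map (Int.cast : ℤ → ℚ) * reducedMatrix A b i j) p x = reducedMatrix A b i j c x := by
    intro c x
    have h1 : (W⁻¹).map (Int.cast : ℤ → ℚ) * W.map (Int.cast : ℤ → ℚ) = 1 := by
      rw [← Matrix.map_mul_intCast, Matrix.nonsing_inv_mul W hW,
        Matrix.map_one _ Int.cast_zero Int.cast_one]
    have h2 : (W⁻¹).map (Int.cast : ℤ → ℚ) * (W.map (Int.cast : ℤ → ℚ) * reducedMatrix A b i j) =
        reducedMatrix A b i j := by rw [← Matrix.mul_assoc, h1, Matrix.one_mul]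
    exact congrFun (congrFun h2 c) x
  rw [matAct_coneFun W hW]
  refine isGenFun_coneFun (ρ := fun c : CoCols j => W⁻¹ c) ⟨fun c d => ?_, fun c => ⟨0, ?_⟩⟩ N _
    (fun c => ?_) fun c h0 => hG0 c (mulVecHom_injective W hW.ne_zero (h0.trans (map_zero _).symm))
  · rw [hdual, h3 c c.2]
    simp only [Subtype.coe_inj]
    congr
  · rw [hdual, h4 c c.2, Int.cast_zero]
  · rw [castVec_mulVec, hG, Matrix.mulVec_smul]
    rfl

end Decomposition

end

/-! ### Assembly of the theorem. -/

theorem theorem5p3 {n r : ℕ} (A : Matrix (Fin r) (Fin n) ℤ) (b : Fin r → ℤ)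
    (i : Equiv.Perm (Fin r)) (j : Fin r ↪ Fin n)
    (hpiv : PivotsNonzero ((startMatrix A b).map (Int.cast : ℤ → ℚ)) (pivotList i j))
    (W : Matrix (Fin n) (Fin n) ℤ) (hW : IsUnit W.det) :
    ∃ f : RatFun (Fin n),
      expandSeries n f = zOp (eratSeries (reducedMatrix A b i j)) ∧
      IsGenFun (shiftedCone (W.map (Int.cast : ℤ → ℚ) * reducedMatrix A b i j))
        (matAct W hW.ne_zero f) ∧
      (∃ U V h, IsSmithForm (A.submatrix id j) U V h) ∧
      ∀ (U V : Matrix (Fin r) (Fin r) ℤ) (h : Fin r → ℕ)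
        (hUV : IsSmithForm (A.submatrix id j) U V h),
        (∃ E : Fin (r + 1) → RatFun (Fin n ⊕ Fin r), ∃ g : RatFun (Fin n),
          IsIteratedCT j h (smithMatrix A b j U h) E ∧
          inclVars Sum.inl Sum.inl_injective g = E (Fin.last r) ∧
          f = matAct (diagExt j V) ((diagExt_det j V).symm ▸ hUV.2.1.ne_zero) g) ∧
        (∃ L, IsDecDenuRun j h (smithMatrix A b j U h) L) ∧
        ∀ L, IsDecDenuRun j h (smithMatrix A b j U h) L →
          IsUnimodularDecomposition (n - r)
            (shiftedCone (W.map (Int.cast : ℤ → ℚ) * reducedMatrix A b i j))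
            ((L (Fin.last r)).map
              (SignedTerm.mapExp fun γ => mulVecHom W (mulVecHom (diagExt j V) (γ ∘ Sum.inl)))) := by
  have hdet := det_submatrix_ne_zero hpiv
  -- This `N` depends only on `A₁`, so one function `f` works for all choices of `U`, `V`, `h`.
  set N := (A.submatrix id j).det.natAbs with hNdef
  have hN : 0 < N := Int.natAbs_pos.2 hdet
  obtain ⟨-, -, hR, -⟩ := reducedMatrix_apply hpiv
  have hcol : ∀ (U V : Matrix (Fin r) (Fin r) ℤ) (h : Fin r → ℕ),
      IsSmithForm (A.submatrix id j) U V h → ∀ c,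
        castVec ((diagExt j V).mulVec (elimCol j h (smithBlock A j U h) N c)) =
          N • fun p => reducedMatrix A b i j p (Sum.inl c) := by
    intro U V h hUV c
    rw [castVec_mulVec, castVec_elimCol (hUV.pos hdet) hUV.dvd (U.mulVec b), Matrix.mulVec_smul,
      ← hUV.diagExt_mul_elimMatrix hpiv]
    rfl
  -- Integrality of the vectors `N w_c` is obtained from an arbitrary Smith form.
  obtain ⟨G, hG⟩ : ∃ G : CoCols j → Fin n → ℤ, ∀ c,
      castVec (G c) = N • fun p => reducedMatrix A b i j p (Sum.inl c) := by
    obtain ⟨U, V, h, hUV⟩ := exists_isSmithForm (A.submatrix id j)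
    exact ⟨_, hcol U V h hUV⟩
  have hG0 : ∀ c, G c ≠ 0 := by
    intro c h0
    have h1 := congrFun (hG c) c
    rw [Pi.smul_apply, hR c c.2, if_pos rfl, h0] at h1
    rw [nsmul_eq_mul, mul_one, castVec, Pi.zero_apply, Int.cast_zero] at h1
    exact hN.ne (by exact_mod_cast h1)
  have hgen := isGenFun_matAct_coneFun hpiv hW hG hG0
  refine ⟨coneFun N (reducedMatrix A b i j) G, expandSeries_coneFun N _ G hG hG0, hgen,
    exists_isSmithForm _, fun U V h hUV => ?_⟩
  have hh := hUV.pos hdet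
  have hZ : IsUnit (diagExt j V).det := by
    rw [diagExt_det]
    exact hUV.2.1
  have hE := isIteratedCT_elimSum hh (smithBlock_isDiagOn (A := A) (j := j) (U := U)) (U.mulVec b) hN
    hUV.dvd
  have hincl := inclVars_coneFun (j := j) (B := smithBlock A j U h) hh hUV.dvd (U.mulVec b)
  -- The vectors `G c` were built from another Smith form, but `castVec` is injective and both equal
  -- `N w_c`.
  have hf : coneFun N (reducedMatrix A b i j) G = matAct (diagExt j V) hZ.ne_zero
      (coneFun N (elimMatrix j h (smithBlock A j U h) (U.mulVec b))
        (elimCol j h (smithBlock A j U h) N)) := by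
    rw [matAct_coneFun _ hZ, hUV.diagExt_mul_elimMatrix hpiv]
    congr 1
    ext1 c
    exact castVec_injective ((hG c).trans (hcol U V h hUV c).symm)
  have hM : HasDual (SignedTerm.ofMatrix (smithMatrix A b j U h)).den := by
    change HasDual (SignedTerm.ofMatrix (startMatrix (smithBlock A j U h) (U.mulVec b))).den
    rw [ofMatrix_startMatrix]
    exact hasDual_ofFn_startCol _
  refine ⟨⟨_, _, hE, hincl, hf⟩, exists_isDecDenuRun hh _ hM fun k => ?_, fun L hL => ?_⟩
  · change _ ∈ (SignedTerm.ofMatrix (startMatrix (smithBlock A j U h) (U.mulVec b))).den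
    rw [ofMatrix_startMatrix, ← (smithBlock_isDiagOn (A := A) (U := U)).startCol_eq]
    exact (List.mem_ofFn' _ _).2 ⟨j k, rfl⟩
  · have hfree : ∀ T ∈ L (Fin.last r), ∀ k, T.FreeOf (Sum.inr k) := fun T hT k =>
      hL.free _ T hT k (Fin.castSucc_lt_last k)
    have hsum := hL.sumRat_eq hh hE (Fin.last r)
    refine ⟨?_, fun T hT => ?_⟩
    · have h1 : SignedTerm.sumRat ((L (Fin.last r)).map
          (SignedTerm.mapExp fun γ => mulVecHom W (mulVecHom (diagExt j V) (γ ∘ Sum.inl)))) =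
          matAct W hW.ne_zero (coneFun N (reducedMatrix A b i j) G) := by
        rw [← SignedTerm.inclVars_sumRat hfree] at hsum
        rw [hf, ← (RingHom.injective _ (hsum.trans hincl.symm)), matAct, matAct,
          SignedTerm.monoSubst_sumRat, SignedTerm.monoSubst_sumRat, List.map_map, List.map_map]
        congr 1
        refine List.map_congr_left fun T _ => ?_
        simp [SignedTerm.mapExp, Function.comp_def]
      rw [h1]
      exact hgen
    · obtain ⟨T, hT', rfl⟩ := List.mem_map.1 hT
      have hdual := (hL.hasDual hM (Fin.last r) T hT').map_mulVec
        (fun γ hγ k => (hfree T hT' k).2 γ hγ) hW hZ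
      refine ⟨?_, isUnimodular_of_hasDual hdual, isGenFun_frac hdual⟩
      have h1 := hL.length_den (Fin.last r) T hT'
      rw [Fin.val_last] at h1
      simp only [SignedTerm.mapExp, List.length_map]
      -- After `r` steps the number of factors plus `r` is `n`, so the natural subtraction `n - r`
      -- is exact.
      omega
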